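/- Setting. Let $\mathcal A$ be an abelian category with small coproducts and enough injectives, $\Phi:\mathcal A\to\mathcal A$ an autoequivalence, and $w:\mathrm{Id}_{\mathcal A}\to\Phi$ a natural transformation with $w_{\Phi(X)}=\Phi(w_X)$ for all $X$; we suppress the canonical isomorphisms $\Phi\Phi^{-1}\cong\mathrm{Id}\cong\Phi^{-1}\Phi$. A factorization $E=(E^{-1},E^0,\phi_E^{-1},\phi_E^0)$ consists of morphisms $\phi_E^{-1}:\Phi^{-1}(E^0)\to E^{-1}$ and $\phi_E^0:E^{-1}\to E^0$ with $\phi^0_E\phi^{-1}_E=\Phi^{-1}(w_{E^0})$ and $\Phi(\phi^{-1}_E)\phi^0_E=w_{E^{-1}}$. A morphism $g:E\to F$ is a pair $(g^{-1},g^0)$ with $g^{-1}\phi_E^{-1}=\phi_F^{-1}\Phi^{-1}(g^0)$ and $g^0\phi_E^0=\phi_F^0g^{-1}$. A homotopy between $g_1,g_2:E\to F$ is a pair $h^{-1}:E^{-1}\to\Phi^{-1}(F^0)$, $h^0:E^0\to F^{-1}$ with $g_1^{-1}-g_2^{-1}=h^0\phi_E^0+\phi_F^{-1}h^{-1}$ and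 $g_1^0-g_2^0=\phi_F^0h^0+\Phi(h^{-1}\phi_E^{-1})$. Let $K(\mathrm{Fact}\,w)$ be the homotopy category, triangulated by the translation $E[1]=(E^0,\Phi(E^{-1}),-\phi_E^0,-\Phi(\phi_E^{-1}))$ and the cones $$C(g)=\left(E^0\oplus F^{-1},\ \Phi(E^{-1})\oplus F^0,\ \begin{pmatrix}-\phi_E^0&0\\ g^{-1}&\phi_F^{-1}\end{pmatrix},\ \begin{pmatrix}-\Phi(\phi_E^{-1})&0\\ g^0&\phi_F^0\end{pmatrix}\right).$$ The totalization of a bounded complex $(E_l)_{l\in\mathbb Z}$ of factorizations is $\bigoplus_l E_l[-l]$, with structure maps those of the $E_l[-l]$ plus the maps induced by the differentials of the complex. A factorization is totally acyclic if it lies in the smallest thick subcategory of $K(\mathrm{Fact}\,w)$ containing the totalizations of all bounded exact complexes of factorizations, and co-acyclic if it lies in the smallest such thick subcategory closed under small coproducts. A morphism of factorizations is a quasi-isomorphism (respectively a co-quasi-isomorphism) if it becomes invertible in the Verdier quotient of $K(\mathrm{Fact}\,w)$ by the totally acyclic (respectively co-acyclic) factorizations. For complexes $A^{-1}_\bullet$,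 $A^0_\bullet$ in $\mathcal A$ concentrated in degrees $\ge0$, with differentials $d^i_j:A^i_{j-1}\to A^i_j$, put $$\mathrm{tot}^{-1}=\bigoplus_{l\ge0}\Phi^{-l}(A^{-1}_{2l})\oplus\bigoplus_{l\ge0}\Phi^{-l-1}(A^0_{2l+1}),\qquad \mathrm{tot}^{0}=\bigoplus_{l\ge0}\Phi^{-l}(A^{0}_{2l})\oplus\bigoplus_{l\ge0}\Phi^{-l}(A^{-1}_{2l+1}).$$ For morphisms $\phi^{-1}:\Phi^{-1}(\mathrm{tot}^0)\to\mathrm{tot}^{-1}$ and $\phi^0:\mathrm{tot}^{-1}\to\mathrm{tot}^0$, let $\phi^i_{p,q}$ be the component from the summand involving degree $p$ to the summand involving degree $q$. A $\oplus$-folding of $(A^{-1}_\bullet,A^0_\bullet)$ is a factorization $(\mathrm{tot}^{-1},\mathrm{tot}^0,\phi^{-1},\phi^0)$ with $\phi^{-1}_{p,q}=\phi^0_{p,q}=0$ for $q>p+1$ and, for all $l\ge0$, $$\phi^{-1}_{2l+1,2l+2}=\Phi^{-l-1}(d^{-1}_{2l+2}),\quad \phi^{-1}_{2l,2l+1}=-\Phi^{-l-1}(d^0_{2l+1}),\quad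 \phi^0_{2l+1,2l+2}=-\Phi^{-l-1}(d^0_{2l+2}),\quad \phi^0_{2l,2l+1}=\Phi^{-l}(d^{-1}_{2l+1}).$$ Theorem. Let $E$ be a factorization. Let $d^{i}_0:E^{i}\to I^{i}_0$ and $d^i_j:I^i_{j-1}\to I^i_j$ ($j\ge1$) be injective resolutions of $E^i$ for $i=-1,0$. Let $\phi^{-1}_j:\Phi^{-1}(I^0_j)\to I^{-1}_j$ and $\phi^0_j:I^{-1}_j\to I^0_j$ ($j\ge0$) be chain maps lifting $\phi^{-1}_E$ and $\phi^0_E$. Let $h^0_j:\Phi^{-1}(I^0_{j+1})\to I^0_j$ and $h^{-1}_j:I^{-1}_{j+1}\to\Phi(I^{-1}_j)$ be null-homotopies of the differences of $w$ and the composites of the lifts, that is, for all $j\ge0$, $$w_{\Phi^{-1}(I^0_j)}-\phi^0_j\phi^{-1}_j=d^0_jh^0_{j-1}+h^0_j\Phi^{-1}(d^0_{j+1}),\qquad w_{I^{-1}_j}-\Phi(\phi^{-1}_j)\phi^0_j=\Phi(d^{-1}_j)h^{-1}_{j-1}+h^{-1}_jd^{-1}_{j+1},$$ where the terms with index $j-1$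 are omitted for $j=0$. Then there are a $\oplus$-folding $I=(I^{-1},I^0,\phi^{-1}_I,\phi^0_I)$ of $(I^{-1}_\bullet,I^0_\bullet)$, whose components we write $\phi^{-1}_{p,q},\phi^0_{p,q}$, and a co-quasi-isomorphism $d_0:E\to I$ such that: 1. for all $l\ge0$, $$\phi^{-1}_{2l+1,2l+1}=\Phi^{-l-1}(\phi^0_{2l+1}),\quad \phi^{-1}_{2l,2l}=\Phi^{-l}(\phi^{-1}_{2l}),\quad \phi^0_{2l+1,2l+1}=\Phi^{-l}(\phi^{-1}_{2l+1}),\quad \phi^0_{2l,2l}=\Phi^{-l}(\phi^0_{2l});$$ 2. $\phi^{-1}_{2l+1,2l}=\Phi^{-l-1}(h^{-1}_{2l})$ and $\phi^0_{2l+1,2l}=-\Phi^{-l}(h^0_{2l})$ for all $l\ge0$, and $\phi^{-1}_{2l,2l-1}=-\Phi^{-l}(h^0_{2l-1})$ and $\phi^0_{2l,2l-1}=\Phi^{-l}(h^{-1}_{2l-1})$ for all $l\ge1$; 3. $d_0$ has components $E^{-1}\xrightarrow{d_0^{-1}}I^{-1}_0\hookrightarrow I^{-1}$ and $E^{0}\xrightarrow{d_0^{0}}I^{0}_0\hookrightarrow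 I^{0}$; 4. if both injective resolutions are finite, then $d_0$ is a quasi-isomorphism. -/

import Mathlib

open CategoryTheory CategoryTheory.Limits

set_option linter.unusedSectionVars false

universe v u

noncomputable section

namespace MF

/-! ## Factorizations of a triple `(A, Φ, w)` -/

/-- A natural transformation `w : Id ⟶ Φ` with `w_{Φ(X)} = Φ(w_X)` for all `X`,
where `Φ` is an autoequivalence of `A`. -/
structure Potential {A : Type u} [Category.{v} A] (Φ : A ≌ A) where
  nat : 𝟭 A ⟶ Φ.functor
  comm : ∀ X : A, nat.app (Φ.functor.obj X) = Φ.functor.map (nat.app X)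

section

variable {A : Type u} [Category.{v} A] {Φ : A ≌ A}

/-- The component `w_X : X ⟶ Φ(X)`. -/
def Potential.app (w : Potential Φ) (X : A) : X ⟶ Φ.functor.obj X := w.nat.app X

/-- The morphism `Φ⁻¹(w_X) : Φ⁻¹(X) ⟶ X` (with `Φ⁻¹Φ(X)` identified with `X`). -/
def Potential.invApp (w : Potential Φ) (X : A) : Φ.inverse.obj X ⟶ X :=
  Φ.inverse.map (w.app X) ≫ Φ.unitIso.inv.app X

lemma Potential.naturality (w : Potential Φ) {X Y : A} (f : X ⟶ Y) :
    f ≫ w.app Y = w.app X ≫ Φ.functor.map f :=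
  w.nat.naturality f

lemma Potential.app_functor (w : Potential Φ) (X : A) :
    w.app (Φ.functor.obj X) = Φ.functor.map (w.app X) := w.comm X

lemma Potential.invApp_naturality (w : Potential Φ) {X Y : A} (f : X ⟶ Y) :
    Φ.inverse.map f ≫ w.invApp Y = w.invApp X ≫ f := by
  have h := Φ.unitIso.inv.naturality f
  dsimp at h
  simp only [invApp, Category.assoc]
  rw [← h, ← Functor.map_comp_assoc, w.naturality, Functor.map_comp_assoc]

/-- `Φ⁻¹(w_X) = w_{Φ⁻¹(X)}`, with `ΦΦ⁻¹(X)` identified with `X`. -/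
lemma Potential.invApp_eq (w : Potential Φ) (X : A) :
    w.invApp X = w.app (Φ.inverse.obj X) ≫ Φ.counitIso.hom.app X := by
  apply Φ.functor.map_injective
  have h1 := w.naturality (Φ.counitIso.hom.app X)
  have h2 := Φ.counitIso.hom.naturality (w.app X)
  dsimp at h1 h2
  rw [Functor.map_comp, ← w.app_functor, ← h1, ← h2, invApp, Functor.map_comp]
  congr 1
  exact (Φ.counit_app_functor X).symm

lemma transpose_aux {N Z : A} (a : Φ.inverse.obj Z ⟶ N) :
    Φ.inverse.map (Φ.counitIso.inv.app Z) ≫ Φ.inverse.map (Φ.functor.map a) ≫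
      Φ.unitIso.inv.app N = a := by
  have h2 := Φ.unitIso.inv.naturality a
  have h3 := Φ.inverse_counitInv_comp Z
  dsimp at h2 h3
  rw [h2, reassoc_of% h3]

/-- Two equivalent forms of the second axiom of a factorization. -/
lemma factorization_aux (w : Potential Φ) {N Z : A} (a : Φ.inverse.obj Z ⟶ N) (b : N ⟶ Z) :
    b ≫ Φ.counitIso.inv.app Z ≫ Φ.functor.map a = w.app N ↔
      Φ.inverse.map b ≫ a = w.invApp N := by
  have h1 : Φ.inverse.map (b ≫ Φ.counitIso.inv.app Z ≫ Φ.functor.map a) ≫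
      Φ.unitIso.inv.app N = Φ.inverse.map b ≫ a := by
    simp only [Functor.map_comp, Category.assoc]
    rw [transpose_aux]
  rw [← h1, Potential.invApp]
  constructor
  · intro h
    rw [h]
  · intro h
    exact Φ.inverse.map_injective ((cancel_mono _).1 h)

end

section

variable {A : Type u} [Category.{v} A] [Abelian A] {Φ : A ≌ A}

instance functor_additive (Φ : A ≌ A) : Φ.functor.Additive :=
  Φ.functor.additive_of_preserves_binary_products

instance inverse_additive (Φ : A ≌ A) : Φ.inverse.Additive :=
  Φ.inverse.additive_of_preserves_binary_products

/-- A factorization `(E⁻¹, E⁰, φ⁻¹, φ⁰)` of `(A, Φ, w)`. Indices `-1` and `0` are written `neg` and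
`zero`. The canonical isomorphisms `Φ⁻¹Φ ≅ Id ≅ ΦΦ⁻¹` are written out. -/
structure Factorization (w : Potential Φ) where
  neg : A
  zero : A
  φneg : Φ.inverse.obj zero ⟶ neg
  φzero : neg ⟶ zero
  φneg_φzero : φneg ≫ φzero = w.invApp zero
  φzero_φneg : φzero ≫ Φ.counitIso.inv.app zero ≫ Φ.functor.map φneg = w.app neg

namespace Factorization

variable {w : Potential Φ}

/-- A morphism of factorizations. -/
@[ext]
structure Hom (E F : Factorization w) where
  neg : E.neg ⟶ F.neg
  zero : E.zero ⟶ F.zero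
  comm_neg : E.φneg ≫ neg = Φ.inverse.map zero ≫ F.φneg
  comm_zero : E.φzero ≫ zero = neg ≫ F.φzero

instance : Category (Factorization w) where
  Hom E F := Hom E F
  id E := ⟨𝟙 _, 𝟙 _, by simp, by simp⟩
  comp f g := ⟨f.neg ≫ g.neg, f.zero ≫ g.zero,
    by rw [← Category.assoc, f.comm_neg, Category.assoc, g.comm_neg, Functor.map_comp,
      Category.assoc],
    by rw [← Category.assoc, f.comm_zero, Category.assoc, g.comm_zero, Category.assoc]⟩

@[ext]
lemma hom_ext {E F : Factorization w} {f g : E ⟶ F} (h₁ : f.neg = g.neg) (h₂ : f.zero = g.zero) :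
    f = g := Hom.ext h₁ h₂

@[simp] lemma id_neg (E : Factorization w) : Hom.neg (𝟙 E) = 𝟙 E.neg := rfl
@[simp] lemma id_zero (E : Factorization w) : Hom.zero (𝟙 E) = 𝟙 E.zero := rfl
@[simp] lemma comp_neg {E F G : Factorization w} (f : E ⟶ F) (g : F ⟶ G) :
    (f ≫ g).neg = f.neg ≫ g.neg := rfl
@[simp] lemma comp_zero {E F G : Factorization w} (f : E ⟶ F) (g : F ⟶ G) :
    (f ≫ g).zero = f.zero ≫ g.zero := rfl

section additive

variable {E F : Factorization w}

instance : Zero (E ⟶ F) := ⟨(⟨0, 0, by simp, by simp⟩ : Hom E F)⟩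
instance : Add (E ⟶ F) := ⟨fun f g => (⟨f.neg + g.neg, f.zero + g.zero,
  by simp [f.comm_neg, g.comm_neg], by simp [f.comm_zero, g.comm_zero]⟩ : Hom E F)⟩
instance : Neg (E ⟶ F) := ⟨fun f => (⟨-f.neg, -f.zero,
  by simp [f.comm_neg], by simp [f.comm_zero]⟩ : Hom E F)⟩
instance : Sub (E ⟶ F) := ⟨fun f g => (⟨f.neg - g.neg, f.zero - g.zero,
  by simp [f.comm_neg, g.comm_neg], by simp [f.comm_zero, g.comm_zero]⟩ : Hom E F)⟩
instance : SMul ℕ (E ⟶ F) := ⟨fun n f => (⟨n • f.neg, n • f.zero,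
  by simp [f.comm_neg], by simp [f.comm_zero]⟩ : Hom E F)⟩
instance : SMul ℤ (E ⟶ F) := ⟨fun n f => (⟨n • f.neg, n • f.zero,
  by simp [f.comm_neg], by simp [f.comm_zero]⟩ : Hom E F)⟩

@[simp] lemma zero_neg : Hom.neg (0 : E ⟶ F) = 0 := rfl
@[simp] lemma zero_zero : Hom.zero (0 : E ⟶ F) = 0 := rfl
@[simp] lemma add_neg (f g : E ⟶ F) : (f + g).neg = f.neg + g.neg := rfl
@[simp] lemma add_zero (f g : E ⟶ F) : (f + g).zero = f.zero + g.zero := rfl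
@[simp] lemma sub_neg (f g : E ⟶ F) : (f - g).neg = f.neg - g.neg := rfl
@[simp] lemma sub_zero (f g : E ⟶ F) : (f - g).zero = f.zero - g.zero := rfl
@[simp] lemma neg_neg (f : E ⟶ F) : (-f).neg = -f.neg := rfl
@[simp] lemma neg_zero (f : E ⟶ F) : (-f).zero = -f.zero := rfl

instance : AddCommGroup (E ⟶ F) :=
  Function.Injective.addCommGroup
    (fun f : E ⟶ F => ((f.neg, f.zero) : (E.neg ⟶ F.neg) × (E.zero ⟶ F.zero)))
    (fun _ _ h => hom_ext (congrArg Prod.fst h) (congrArg Prod.snd h))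
    rfl (fun _ _ => rfl) (fun _ => rfl) (fun _ _ => rfl) (fun _ _ => rfl) (fun _ _ => rfl)

end additive

instance : Preadditive (Factorization w) where
  add_comp _ _ _ f f' g := by ext <;> simp
  comp_add _ _ _ f g g' := by ext <;> simp

/-- The functor `E ↦ E⁻¹`. -/
@[simps] def evNeg (w : Potential Φ) : Factorization w ⥤ A where
  obj E := E.neg
  map f := f.neg

/-- The functor `E ↦ E⁰`. -/
@[simps] def evZero (w : Potential Φ) : Factorization w ⥤ A where
  obj E := E.zero
  map f := f.zero

instance : (evNeg w).Additive where
instance : (evZero w).Additive where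

/-! ### Translation, cones, homotopies -/

/-- `E[1] = (E⁰, Φ(E⁻¹), -φ⁰, -Φ(φ⁻¹))`. -/
@[simps] def shiftObj (E : Factorization w) : Factorization w where
  neg := E.zero
  zero := Φ.functor.obj E.neg
  φneg := Φ.unitIso.inv.app E.neg ≫ (-E.φzero)
  φzero := Φ.counitIso.inv.app E.zero ≫ Φ.functor.map (-E.φneg)
  φneg_φzero := by
    have h := E.φzero_φneg
    have h2 := Φ.unitIso.inv.naturality (w.app E.neg)
    dsimp at h2
    rw [Functor.map_neg, Preadditive.comp_neg, Preadditive.comp_neg, Preadditive.comp_neg,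
      Preadditive.neg_comp, _root_.neg_neg, Category.assoc, h, Potential.invApp,
      w.app_functor, h2]
  φzero_φneg := by
    have h2 := Φ.counitIso.inv.naturality (w.app E.zero)
    have h3 := Φ.counitInv_functor_comp E.neg
    have h4 := Φ.counitInv_functor_comp E.zero
    dsimp at h2 h3 h4
    simp only [Functor.map_neg, Functor.map_comp, Preadditive.comp_neg, Preadditive.neg_comp,
      _root_.neg_neg, Category.assoc]
    rw [reassoc_of% h3, ← Functor.map_comp, E.φneg_φzero, Potential.invApp, Functor.map_comp,
      ← reassoc_of% h2, h4, Category.comp_id]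

/-- `E[-1] = (Φ⁻¹(E⁰), E⁻¹, -Φ⁻¹(φ⁰), -φ⁻¹)`. -/
@[simps] def unshiftObj (E : Factorization w) : Factorization w where
  neg := Φ.inverse.obj E.zero
  zero := E.neg
  φneg := -Φ.inverse.map E.φzero
  φzero := -E.φneg
  φneg_φzero := by
    rw [Preadditive.neg_comp, Preadditive.comp_neg, _root_.neg_neg]
    exact (factorization_aux w _ _).1 E.φzero_φneg
  φzero_φneg := by
    rw [factorization_aux, Functor.map_neg, Preadditive.neg_comp, Preadditive.comp_neg,
      _root_.neg_neg, ← Functor.map_comp, E.φneg_φzero, w.invApp_eq E.zero, Potential.invApp,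
      Functor.map_comp]
    exact congrArg _ (Φ.unitInv_app_inverse E.zero).symm

/-- The translation functor `E ↦ E[1]`. -/
@[simps] def shift (w : Potential Φ) : Factorization w ⥤ Factorization w where
  obj E := E.shiftObj
  map {E F} g := (⟨g.zero, Φ.functor.map g.neg, by
    have h := Φ.unitIso.inv.naturality g.neg
    dsimp at h
    change (Φ.unitIso.inv.app E.neg ≫ (-E.φzero)) ≫ g.zero =
      Φ.inverse.map (Φ.functor.map g.neg) ≫ Φ.unitIso.inv.app F.neg ≫ (-F.φzero)
    rw [Preadditive.comp_neg, Preadditive.comp_neg, Preadditive.neg_comp, Preadditive.comp_neg,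
      reassoc_of% h, Category.assoc, g.comm_zero], by
    have h := Φ.counitIso.inv.naturality g.zero
    dsimp at h
    change (Φ.counitIso.inv.app E.zero ≫ Φ.functor.map (-E.φneg)) ≫ Φ.functor.map g.neg =
      g.zero ≫ Φ.counitIso.inv.app F.zero ≫ Φ.functor.map (-F.φneg)
    rw [reassoc_of% h, Category.assoc, ← Functor.map_comp, ← Functor.map_comp,
      Preadditive.comp_neg, Preadditive.neg_comp, g.comm_neg]⟩ : Hom E.shiftObj F.shiftObj)
  map_id _ := hom_ext rfl (Φ.functor.map_id _)
  map_comp _ _ := hom_ext rfl (Φ.functor.map_comp _ _)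

/-- The inverse translation functor `E ↦ E[-1]`. -/
@[simps] def unshift (w : Potential Φ) : Factorization w ⥤ Factorization w where
  obj E := E.unshiftObj
  map {E F} g := (⟨Φ.inverse.map g.zero, g.neg, by
    change (-Φ.inverse.map E.φzero) ≫ Φ.inverse.map g.zero =
      Φ.inverse.map g.neg ≫ (-Φ.inverse.map F.φzero)
    rw [Preadditive.comp_neg, Preadditive.neg_comp, ← Functor.map_comp, ← Functor.map_comp,
      g.comm_zero], by
    change (-E.φneg) ≫ g.neg = Φ.inverse.map g.zero ≫ (-F.φneg)
    rw [Preadditive.comp_neg, Preadditive.neg_comp, g.comm_neg]⟩ :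
      Hom E.unshiftObj F.unshiftObj)
  map_id _ := hom_ext (Φ.inverse.map_id _) rfl
  map_comp _ _ := hom_ext (Φ.inverse.map_comp _ _) rfl

lemma shiftUnshift_aux (E : Factorization w) :
    E.shiftObj.unshiftObj.φneg ≫ Φ.unitIso.inv.app E.neg = E.φneg := by
  change (-Φ.inverse.map (Φ.counitIso.inv.app E.zero ≫ Φ.functor.map (-E.φneg))) ≫
    Φ.unitIso.inv.app E.neg = E.φneg
  rw [Functor.map_neg, Preadditive.comp_neg, Functor.map_neg, _root_.neg_neg, Functor.map_comp,
    Category.assoc, transpose_aux]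

lemma shiftUnshift_aux' (E : Factorization w) :
    E.shiftObj.unshiftObj.φzero = Φ.unitIso.inv.app E.neg ≫ E.φzero := by
  change -(Φ.unitIso.inv.app E.neg ≫ (-E.φzero)) = _
  rw [Preadditive.comp_neg, _root_.neg_neg]

/-- `E[1][-1] ≅ E`. -/
def shiftUnshiftIso (w : Potential Φ) : shift w ⋙ unshift w ≅ 𝟭 (Factorization w) :=
  NatIso.ofComponents (fun E =>
    { hom := (⟨Φ.unitIso.inv.app E.neg, 𝟙 E.zero, by
        have h : Φ.inverse.map (𝟙 E.zero) ≫ E.φneg = E.φneg := by simp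
        exact (shiftUnshift_aux E).trans h.symm,
        (Category.comp_id _).trans (shiftUnshift_aux' E)⟩ : Hom E.shiftObj.unshiftObj E)
      inv := (⟨Φ.unitIso.hom.app E.neg, 𝟙 E.zero, by
        have h : Φ.inverse.map (𝟙 E.zero) ≫ E.shiftObj.unshiftObj.φneg =
          E.shiftObj.unshiftObj.φneg := by
            rw [Φ.inverse.map_id]
            exact Category.id_comp _
        refine Eq.trans ?_ h.symm
        rw [← shiftUnshift_aux]
        exact (Category.assoc _ _ _).trans ((congrArg _ (Φ.unitIso.inv_hom_id_app E.neg)).trans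
          (Category.comp_id _)), by
        refine (Category.comp_id E.φzero).trans ?_
        rw [shiftUnshift_aux']
        exact (Φ.unitIso.hom_inv_id_app_assoc E.neg E.φzero).symm⟩ :
          Hom E E.shiftObj.unshiftObj)
      hom_inv_id := hom_ext (Φ.unitIso.inv_hom_id_app E.neg) (Category.comp_id (𝟙 E.zero))
      inv_hom_id := hom_ext (Φ.unitIso.hom_inv_id_app E.neg) (Category.comp_id (𝟙 E.zero)) })
    (fun {E F} g => hom_ext (Φ.unitIso.inv.naturality g.neg)
      ((Category.comp_id g.zero).trans (Category.id_comp g.zero).symm))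

/-- The cone of `g : E ⟶ F`, with components `E⁰ ⊕ F⁻¹` and `Φ(E⁻¹) ⊕ F⁰`. -/
def cone {E F : Factorization w} (g : E ⟶ F) : Factorization w where
  neg := E.zero ⊞ F.neg
  zero := Φ.functor.obj E.neg ⊞ F.zero
  φneg := biprod.lift
    (-(Φ.inverse.map (biprod.fst : Φ.functor.obj E.neg ⊞ F.zero ⟶ Φ.functor.obj E.neg) ≫
      (Φ.unitIso.inv.app E.neg ≫ E.φzero : Φ.inverse.obj (Φ.functor.obj E.neg) ⟶ E.zero)))
    (Φ.inverse.map (biprod.fst : Φ.functor.obj E.neg ⊞ F.zero ⟶ Φ.functor.obj E.neg) ≫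
        (Φ.unitIso.inv.app E.neg ≫ g.neg : Φ.inverse.obj (Φ.functor.obj E.neg) ⟶ F.neg) +
      Φ.inverse.map (biprod.snd : Φ.functor.obj E.neg ⊞ F.zero ⟶ F.zero) ≫ F.φneg)
  φzero := biprod.lift
    (-((biprod.fst : E.zero ⊞ F.neg ⟶ E.zero) ≫
      (Φ.counitIso.inv.app E.zero ≫ Φ.functor.map E.φneg : E.zero ⟶ Φ.functor.obj E.neg)))
    (biprod.fst ≫ g.zero + biprod.snd ≫ F.φzero)
  φneg_φzero := by
    have h := E.φzero_φneg
    have h1 := Φ.unitIso.inv.naturality (w.app E.neg)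
    dsimp at h1
    apply biprod.hom_ext
    · have e := w.invApp_naturality (biprod.fst : Φ.functor.obj E.neg ⊞ F.zero ⟶ _)
      rw [← e, Category.assoc, biprod.lift_fst, Preadditive.comp_neg, biprod.lift_fst_assoc,
        Preadditive.neg_comp, _root_.neg_neg, Category.assoc, Category.assoc, h, ← h1,
        Potential.invApp, w.app_functor]
    · have e := w.invApp_naturality (biprod.snd : Φ.functor.obj E.neg ⊞ F.zero ⟶ _)
      rw [← e, Category.assoc, biprod.lift_snd, Preadditive.comp_add, biprod.lift_fst_assoc,
        biprod.lift_snd_assoc, Preadditive.neg_comp, Preadditive.add_comp]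
      simp only [Category.assoc]
      rw [g.comm_zero, F.φneg_φzero]
      abel
  φzero_φneg := by
    rw [factorization_aux]
    apply biprod.hom_ext
    · rw [← w.invApp_naturality, Category.assoc, biprod.lift_fst, Preadditive.comp_neg,
        ← Functor.map_comp_assoc, biprod.lift_fst, Functor.map_neg, Preadditive.neg_comp,
        _root_.neg_neg]
      simp only [Functor.map_comp, Category.assoc]
      rw [reassoc_of% (transpose_aux E.φneg), E.φneg_φzero]
    · rw [← w.invApp_naturality, Category.assoc, biprod.lift_snd, Preadditive.comp_add,
        ← Functor.map_comp_assoc, ← Functor.map_comp_assoc, biprod.lift_fst, biprod.lift_snd,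
        Functor.map_neg, Preadditive.neg_comp, Functor.map_add, Preadditive.add_comp]
      simp only [Functor.map_comp, Category.assoc]
      rw [reassoc_of% (transpose_aux E.φneg), g.comm_neg,
        (factorization_aux w _ _).1 F.φzero_φneg]
      abel

/-- A homotopy between two morphisms of factorizations. -/
structure Homotopy {E F : Factorization w} (g₁ g₂ : E ⟶ F) where
  neg : E.neg ⟶ Φ.inverse.obj F.zero
  zero : E.zero ⟶ F.neg
  eq_neg : g₁.neg - g₂.neg = E.φzero ≫ zero + neg ≫ F.φneg
  eq_zero : g₁.zero - g₂.zero = zero ≫ F.φzero +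
    (Φ.counitIso.inv.app E.zero ≫ Φ.functor.map E.φneg ≫ Φ.functor.map neg ≫
      Φ.counitIso.hom.app F.zero : E.zero ⟶ F.zero)

/-- The relation of being homotopic. -/
def homotopic (w : Potential Φ) : HomRel (Factorization w) :=
  fun _ _ g₁ g₂ => Nonempty (Homotopy g₁ g₂)

instance : Congruence (homotopic w) where
  equivalence :=
    { refl := fun g => ⟨⟨0, 0, by simp, by simp⟩⟩
      symm := fun {g₁ g₂} ⟨h⟩ => ⟨⟨-h.neg, -h.zero, by
        rw [← _root_.neg_sub, h.eq_neg]
        simp only [Preadditive.neg_comp, Preadditive.comp_neg]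
        abel, by
        rw [← _root_.neg_sub, h.eq_zero]
        simp only [Preadditive.neg_comp, Preadditive.comp_neg, Functor.map_neg]
        abel⟩⟩
      trans := fun {g₁ g₂ g₃} ⟨h⟩ ⟨k⟩ => ⟨⟨h.neg + k.neg, h.zero + k.zero, by
        rw [← sub_add_sub_cancel _ g₂.neg, h.eq_neg, k.eq_neg]
        simp only [Preadditive.add_comp, Preadditive.comp_add]
        abel, by
        rw [← sub_add_sub_cancel _ g₂.zero, h.eq_zero, k.eq_zero]
        simp only [Preadditive.add_comp, Preadditive.comp_add, Functor.map_add]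
        abel⟩⟩ }
  comp_left {E F G} f g g' := fun ⟨h⟩ => ⟨⟨f.neg ≫ h.neg, f.zero ≫ h.zero, by
    rw [comp_neg, comp_neg, ← Preadditive.comp_sub, h.eq_neg, Preadditive.comp_add,
      ← reassoc_of% f.comm_zero, Category.assoc], by
    have e := Φ.counitIso.inv.naturality f.zero
    dsimp at e
    rw [comp_zero, comp_zero, ← Preadditive.comp_sub, h.eq_zero, Preadditive.comp_add,
      Category.assoc, Functor.map_comp, Category.assoc]
    congr 1
    rw [← Functor.map_comp_assoc _ E.φneg, f.comm_neg, reassoc_of% e]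
    simp only [Functor.map_comp, Category.assoc]⟩⟩
  comp_right {E F G} f f' g := fun ⟨h⟩ => ⟨⟨h.neg ≫ Φ.inverse.map g.zero, h.zero ≫ g.neg, by
    rw [comp_neg, comp_neg, ← Preadditive.sub_comp, h.eq_neg, Preadditive.add_comp,
      Category.assoc, Category.assoc, Category.assoc, g.comm_neg], by
    have e := Φ.counitIso.hom.naturality g.zero
    dsimp at e
    rw [comp_zero, comp_zero, ← Preadditive.sub_comp, h.eq_zero, Preadditive.add_comp,
      Category.assoc, Category.assoc, g.comm_zero, Functor.map_comp]
    simp only [Category.assoc]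
    rw [← e]⟩⟩

end Factorization

/-- The homotopy category `K(Fact w)`. -/
abbrev KFact (w : Potential Φ) := CategoryTheory.Quotient (Factorization.homotopic w)

/-- The quotient functor `Fact w ⥤ K(Fact w)`. -/
abbrev toK (w : Potential Φ) : Factorization w ⥤ KFact w :=
  CategoryTheory.Quotient.functor (Factorization.homotopic w)

end

/-! ## Totalizations -/

lemma hasCoproductsOfShape_type_zero {A : Type u} [Category.{v} A] [HasCoproducts.{v} A]
    (J : Type) : HasCoproductsOfShape J A := by
  have := hasCoproducts_shrink.{0, v} (C := A)
  infer_instance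

instance hasCoproductsOfShape_int {A : Type u} [Category.{v} A] [HasCoproducts.{v} A] :
    HasCoproductsOfShape ℤ A := hasCoproductsOfShape_type_zero ℤ

instance hasCoproductsOfShape_nat_sum {A : Type u} [Category.{v} A] [HasCoproducts.{v} A] :
    HasCoproductsOfShape (ℕ ⊕ ℕ) A := hasCoproductsOfShape_type_zero (ℕ ⊕ ℕ)

section

variable {A : Type u} [Category.{v} A] [Abelian A] {Φ : A ≌ A} {w : Potential Φ}

lemma ι_coproductIso_hom {J : Type} [HasCoproductsOfShape J A] (f : J → A) (j : J) :
    Φ.inverse.map (Sigma.ι f j) ≫ (PreservesCoproduct.iso Φ.inverse f).hom =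
      Sigma.ι (fun j => Φ.inverse.obj (f j)) j := by
  rw [← Iso.eq_comp_inv, PreservesCoproduct.inv_hom, ι_comp_sigmaComparison]

lemma inverse_coproduct_hom_ext {J : Type} [HasCoproductsOfShape J A] {f : J → A} {X : A}
    {a b : Φ.inverse.obj (∐ f) ⟶ X}
    (h : ∀ j, Φ.inverse.map (Sigma.ι f j) ≫ a = Φ.inverse.map (Sigma.ι f j) ≫ b) : a = b := by
  rw [← cancel_epi (PreservesCoproduct.iso Φ.inverse f).inv]
  apply Sigma.hom_ext
  intro j
  rw [PreservesCoproduct.inv_hom, ι_comp_sigmaComparison_assoc, ι_comp_sigmaComparison_assoc, h]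

namespace Factorization

/-- The iterate `E ↦ E[-n]`, `n : ℕ`. -/
def unshiftNat (w : Potential Φ) : ℕ → (Factorization w ⥤ Factorization w)
  | 0 => 𝟭 _
  | n + 1 => unshiftNat w n ⋙ unshift w

/-- The iterate `E ↦ E[n]`, `n : ℕ`. -/
def shiftNat (w : Potential Φ) : ℕ → (Factorization w ⥤ Factorization w)
  | 0 => 𝟭 _
  | n + 1 => shiftNat w n ⋙ shift w

/-- The functor `E ↦ E[-l]`, `l : ℤ`. -/
def unshiftInt (w : Potential Φ) : ℤ → (Factorization w ⥤ Factorization w)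
  | .ofNat n => unshiftNat w n
  | .negSucc n => shiftNat w (n + 1)

/-- `E[-l][-1] ≅ E[-(l + 1)]`. -/
def unshiftIntSucc (w : Potential Φ) :
    ∀ l : ℤ, unshiftInt w l ⋙ unshift w ≅ unshiftInt w (l + 1)
  | .ofNat n => Iso.refl (unshiftNat w (n + 1))
  | .negSucc 0 => Functor.isoWhiskerLeft (𝟭 _) (shiftUnshiftIso w)
  | .negSucc (n + 1) => Functor.isoWhiskerLeft (shiftNat w (n + 1)) (shiftUnshiftIso w)

/-- The isomorphism `Φ⁻¹(X[-l]⁰) = X[-l][-1]⁻¹ ≅ X[-(l+1)]⁻¹`. -/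
def succNeg (X : Factorization w) (l : ℤ) :
    Φ.inverse.obj ((unshiftInt w l).obj X).zero ⟶ ((unshiftInt w (l + 1)).obj X).neg :=
  ((unshiftIntSucc w l).hom.app X).neg

/-- The isomorphism `X[-l]⁻¹ = X[-l][-1]⁰ ≅ X[-(l+1)]⁰`. -/
def succZero (X : Factorization w) (l : ℤ) :
    ((unshiftInt w l).obj X).neg ⟶ ((unshiftInt w (l + 1)).obj X).zero :=
  ((unshiftIntSucc w l).hom.app X).zero

lemma succNeg_comm (X : Factorization w) (l : ℤ) :
    Φ.inverse.map ((unshiftInt w l).obj X).φzero ≫ succNeg X l =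
      -(Φ.inverse.map (succZero X l) ≫ ((unshiftInt w (l + 1)).obj X).φneg) := by
  have h : (-Φ.inverse.map ((unshiftInt w l).obj X).φzero) ≫ succNeg X l =
      Φ.inverse.map (succZero X l) ≫ ((unshiftInt w (l + 1)).obj X).φneg :=
    ((unshiftIntSucc w l).hom.app X).comm_neg
  rw [← h, Preadditive.neg_comp, _root_.neg_neg]

lemma succZero_comm (X : Factorization w) (l : ℤ) :
    ((unshiftInt w l).obj X).φneg ≫ succZero X l =
      -(succNeg X l ≫ ((unshiftInt w (l + 1)).obj X).φzero) := by
  have h : (-((unshiftInt w l).obj X).φneg) ≫ succZero X l =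
      succNeg X l ≫ ((unshiftInt w (l + 1)).obj X).φzero :=
    ((unshiftIntSucc w l).hom.app X).comm_zero
  rw [← h, Preadditive.neg_comp, _root_.neg_neg]

lemma succNeg_naturality {X Y : Factorization w} (f : X ⟶ Y) (l : ℤ) :
    Φ.inverse.map ((unshiftInt w l).map f).zero ≫ succNeg Y l =
      succNeg X l ≫ ((unshiftInt w (l + 1)).map f).neg :=
  congrArg Hom.neg ((unshiftIntSucc w l).hom.naturality f)

lemma succZero_naturality {X Y : Factorization w} (f : X ⟶ Y) (l : ℤ) :
    ((unshiftInt w l).map f).neg ≫ succZero Y l =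
      succZero X l ≫ ((unshiftInt w (l + 1)).map f).zero :=
  congrArg Hom.zero ((unshiftIntSucc w l).hom.naturality f)

/-- The map `E_l[-l]⁻¹ ⟶ E_{l+1}[-(l+1)]⁰` induced by the differential `E_l ⟶ E_{l+1}`. -/
def totDiffZero (K : CochainComplex (Factorization w) ℤ) (l : ℤ) :
    ((unshiftInt w l).obj (K.X l)).neg ⟶ ((unshiftInt w (l + 1)).obj (K.X (l + 1))).zero :=
  ((unshiftInt w l).map (K.d l (l + 1))).neg ≫ succZero (K.X (l + 1)) l

/-- The map `Φ⁻¹(E_l[-l]⁰) ⟶ E_{l+1}[-(l+1)]⁻¹` induced by the differential `E_l ⟶ E_{l+1}`. -/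
def totDiffNeg (K : CochainComplex (Factorization w) ℤ) (l : ℤ) :
    Φ.inverse.obj ((unshiftInt w l).obj (K.X l)).zero ⟶
      ((unshiftInt w (l + 1)).obj (K.X (l + 1))).neg :=
  Φ.inverse.map ((unshiftInt w l).map (K.d l (l + 1))).zero ≫ succNeg (K.X (l + 1)) l

lemma shift_zero_map {E F : Factorization w} : (shift w).map (0 : E ⟶ F) = 0 :=
  hom_ext rfl (Φ.functor.map_zero _ _)

lemma unshift_zero_map {E F : Factorization w} : (unshift w).map (0 : E ⟶ F) = 0 :=
  hom_ext (Φ.inverse.map_zero _ _) rfl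

lemma shiftNat_map_zero {E F : Factorization w} (n : ℕ) : (shiftNat w n).map (0 : E ⟶ F) = 0 := by
  induction n with
  | zero => rfl
  | succ n ih =>
    change (shift w).map ((shiftNat w n).map 0) = 0
    rw [ih, shift_zero_map]

lemma unshiftNat_map_zero {E F : Factorization w} (n : ℕ) :
    (unshiftNat w n).map (0 : E ⟶ F) = 0 := by
  induction n with
  | zero => rfl
  | succ n ih =>
    change (unshift w).map ((unshiftNat w n).map 0) = 0
    rw [ih, unshift_zero_map]

lemma unshiftInt_map_zero {E F : Factorization w} (l : ℤ) :
    (unshiftInt w l).map (0 : E ⟶ F) = 0 := by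
  cases l with
  | ofNat n => exact unshiftNat_map_zero n
  | negSucc n => exact shiftNat_map_zero (n + 1)

section totLemmas

variable (K : CochainComplex (Factorization w) ℤ) (l : ℤ)

lemma tot_aux₁ : ((unshiftInt w l).obj (K.X l)).φneg ≫ totDiffZero K l +
    totDiffNeg K l ≫ ((unshiftInt w (l + 1)).obj (K.X (l + 1))).φzero = 0 := by
  have h₁ := ((unshiftInt w l).map (K.d l (l + 1))).comm_neg
  rw [totDiffZero, totDiffNeg, reassoc_of% h₁, Category.assoc, succZero_comm,
    Preadditive.comp_neg, neg_add_cancel]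

lemma tot_aux₂ : Φ.inverse.map ((unshiftInt w l).obj (K.X l)).φzero ≫ totDiffNeg K l +
    Φ.inverse.map (totDiffZero K l) ≫ ((unshiftInt w (l + 1)).obj (K.X (l + 1))).φneg = 0 := by
  have h₁ := ((unshiftInt w l).map (K.d l (l + 1))).comm_zero
  rw [totDiffZero, totDiffNeg, Functor.map_comp, Category.assoc, ← Functor.map_comp_assoc,
    h₁, Functor.map_comp_assoc, succNeg_comm, Preadditive.comp_neg, neg_add_cancel]

lemma tot_aux₃ : totDiffNeg K l ≫ totDiffZero K (l + 1) = 0 := by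
  have h' : Φ.inverse.map ((unshiftInt w l).map (K.d l (l + 1))).zero ≫
      Φ.inverse.map ((unshiftInt w l).map (K.d (l + 1) (l + 1 + 1))).zero = 0 := by
    rw [← Functor.map_comp, ← comp_zero, ← Functor.map_comp, K.d_comp_d, unshiftInt_map_zero,
      zero_zero, Functor.map_zero]
  rw [totDiffZero, totDiffNeg, Category.assoc, ← reassoc_of% (succNeg_naturality _ l),
    reassoc_of% h', Limits.zero_comp]

lemma tot_aux₄ : Φ.inverse.map (totDiffZero K l) ≫ totDiffNeg K (l + 1) = 0 := by
  have h' : ((unshiftInt w l).map (K.d l (l + 1))).neg ≫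
      ((unshiftInt w l).map (K.d (l + 1) (l + 1 + 1))).neg = 0 := by
    rw [← comp_neg, ← Functor.map_comp, K.d_comp_d, unshiftInt_map_zero, zero_neg]
  rw [totDiffZero, totDiffNeg, ← Functor.map_comp_assoc, Category.assoc, ← succZero_naturality,
    reassoc_of% h', Limits.zero_comp, Functor.map_zero, Limits.zero_comp]

end totLemmas

variable [HasCoproducts.{v} A]

/-- The totalization `⨁_l E_l[-l]` of a complex of factorizations: its structure maps are those of
the `E_l[-l]` plus the maps induced by the differentials of the complex. -/
def tot (K : CochainComplex (Factorization w) ℤ) : Factorization w where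
  neg := ∐ fun l : ℤ => ((unshiftInt w l).obj (K.X l)).neg
  zero := ∐ fun l : ℤ => ((unshiftInt w l).obj (K.X l)).zero
  φneg := (PreservesCoproduct.iso Φ.inverse _).hom ≫ Sigma.desc fun l =>
    ((unshiftInt w l).obj (K.X l)).φneg ≫
        Sigma.ι (fun l : ℤ => ((unshiftInt w l).obj (K.X l)).neg) l +
      totDiffNeg K l ≫ Sigma.ι (fun l : ℤ => ((unshiftInt w l).obj (K.X l)).neg) (l + 1)
  φzero := Sigma.desc fun l =>
    ((unshiftInt w l).obj (K.X l)).φzero ≫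
        Sigma.ι (fun l : ℤ => ((unshiftInt w l).obj (K.X l)).zero) l +
      totDiffZero K l ≫ Sigma.ι (fun l : ℤ => ((unshiftInt w l).obj (K.X l)).zero) (l + 1)
  φneg_φzero := by
    apply inverse_coproduct_hom_ext
    intro l
    rw [w.invApp_naturality, Category.assoc, reassoc_of% (ι_coproductIso_hom (Φ := Φ)
      (fun l : ℤ => ((unshiftInt w l).obj (K.X l)).zero) l), Sigma.ι_desc_assoc,
      Preadditive.add_comp, Category.assoc, Category.assoc, Sigma.ι_desc, Sigma.ι_desc,
      Preadditive.comp_add, Preadditive.comp_add, reassoc_of% (tot_aux₃ K l), Limits.zero_comp,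
      _root_.add_zero, ← Category.assoc, ← Category.assoc, ← Category.assoc,
      Factorization.φneg_φzero, add_assoc, ← Preadditive.add_comp, tot_aux₁, Limits.zero_comp,
      _root_.add_zero]
  φzero_φneg := by
    rw [factorization_aux]
    apply inverse_coproduct_hom_ext
    intro l
    rw [w.invApp_naturality, ← Functor.map_comp_assoc, Sigma.ι_desc, Functor.map_add,
      Preadditive.add_comp, Functor.map_comp_assoc, Functor.map_comp_assoc,
      reassoc_of% (ι_coproductIso_hom (Φ := Φ)
        (fun l : ℤ => ((unshiftInt w l).obj (K.X l)).zero) l),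
      reassoc_of% (ι_coproductIso_hom (Φ := Φ)
        (fun l : ℤ => ((unshiftInt w l).obj (K.X l)).zero) (l + 1)),
      Sigma.ι_desc, Sigma.ι_desc,
      Preadditive.comp_add, Preadditive.comp_add, reassoc_of% (tot_aux₄ K l), Limits.zero_comp,
      _root_.add_zero, ← Category.assoc, ← Category.assoc, ← Category.assoc,
      (factorization_aux w _ _).1 (Factorization.φzero_φneg _), add_assoc,
      ← Preadditive.add_comp, tot_aux₂, Limits.zero_comp, _root_.add_zero]

end Factorization

end

/-! ## Absolute derived and co-derived categories, quasi-isomorphisms -/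

section

variable {A : Type u} [Category.{v} A] [Abelian A] {Φ : A ≌ A}

/-- A bounded exact complex of factorizations. Kernels and cokernels in `Fact w` are computed
componentwise, so exactness means exactness of both complexes of components in `A`. -/
structure IsBoundedExact {w : Potential Φ} (K : CochainComplex (Factorization w) ℤ) : Prop where
  bounded : ∃ a b : ℤ, ∀ i : ℤ, i < a ∨ b < i → IsZero (K.X i)
  exact_neg :
    (((Factorization.evNeg w).mapHomologicalComplex (ComplexShape.up ℤ)).obj K).Acyclic
  exact_zero :
    (((Factorization.evZero w).mapHomologicalComplex (ComplexShape.up ℤ)).obj K).Acyclic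

/-- Thick (triangulated) subcategories of `K(Fact w)`: strictly full subcategories containing the
zero objects, stable under translation in both directions, under cones and under direct
summands. -/
structure IsThick {w : Potential Φ} (P : ObjectProperty (KFact w)) : Prop where
  iso : P.IsClosedUnderIsomorphisms
  zero : ∀ X : KFact w, IsZero X → P X
  shift : ∀ E : Factorization w,
    P ((toK w).obj E) → P ((toK w).obj ((Factorization.shift w).obj E))
  unshift : ∀ E : Factorization w,
    P ((toK w).obj E) → P ((toK w).obj ((Factorization.unshift w).obj E))
  cone : ∀ {E F : Factorization w} (g : E ⟶ F),
    P ((toK w).obj E) → P ((toK w).obj F) → P ((toK w).obj (Factorization.cone g))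
  retract : P.IsStableUnderRetracts

/-- For a full subcategory `N` of `K(Fact w)`, the class of morphisms of `K(Fact w)` that fit into
a distinguished triangle whose third object (the cone) is in `N`. -/
def coneIn {w : Potential Φ} (N : ObjectProperty (KFact w)) : MorphismProperty (KFact w) :=
  fun X Y f => ∃ g : X.as ⟶ Y.as, (toK w).map g = f ∧ N ((toK w).obj (Factorization.cone g))

variable [HasCoproducts.{v} A]

/-- The totally acyclic factorizations: the smallest thick subcategory of `K(Fact w)` containing
the totalizations of all bounded exact complexes. -/
def totallyAcyclic (w : Potential Φ) : ObjectProperty (KFact w) :=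
  fun X => ∀ P : ObjectProperty (KFact w), IsThick P →
    (∀ K : CochainComplex (Factorization w) ℤ, IsBoundedExact K →
      P ((toK w).obj (Factorization.tot K))) → P X

/-- The co-acyclic factorizations: the smallest thick subcategory of `K(Fact w)` containing
the totalizations of all bounded exact complexes and closed under small coproducts. -/
def coacyclic (w : Potential Φ) : ObjectProperty (KFact w) :=
  fun X => ∀ P : ObjectProperty (KFact w), IsThick P →
    (∀ J : Type v, P.IsClosedUnderColimitsOfShape (Discrete J)) →
    (∀ K : CochainComplex (Factorization w) ℤ, IsBoundedExact K →
      P ((toK w).obj (Factorization.tot K))) → P X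

/-- The absolute derived category, the Verdier quotient of `K(Fact w)` by the totally acyclic
factorizations. -/
abbrev DAbs (w : Potential Φ) := (coneIn (totallyAcyclic w)).Localization

/-- The co-derived category, the Verdier quotient of `K(Fact w)` by the co-acyclic
factorizations. -/
abbrev DCo (w : Potential Φ) := (coneIn (coacyclic w)).Localization

/-- The functor `Fact w ⥤ D^abs(Fact w)`. -/
abbrev toDAbs (w : Potential Φ) : Factorization w ⥤ DAbs w :=
  toK w ⋙ (coneIn (totallyAcyclic w)).Q

/-- The functor `Fact w ⥤ D^co(Fact w)`. -/
abbrev toDCo (w : Potential Φ) : Factorization w ⥤ DCo w :=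
  toK w ⋙ (coneIn (coacyclic w)).Q

/-- A quasi-isomorphism: a morphism of factorizations that becomes invertible in `D^abs`. -/
def IsQuasiIso {w : Potential Φ} {E F : Factorization w} (g : E ⟶ F) : Prop :=
  IsIso ((toDAbs w).map g)

/-- A co-quasi-isomorphism: a morphism of factorizations that becomes invertible in `D^co`. -/
def IsCoQuasiIso {w : Potential Φ} {E F : Factorization w} (g : E ⟶ F) : Prop :=
  IsIso ((toDCo w).map g)

end

/-! ## Foldings -/

section

variable {A : Type u} [Category.{v} A]

/-- The functor `Φ⁻ⁿ`, `n : ℕ`. -/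
def negPow (Φ : A ≌ A) : ℕ → (A ⥤ A)
  | 0 => 𝟭 A
  | n + 1 => Φ.inverse ⋙ negPow Φ n

/-- The canonical isomorphism `Φ⁻ⁿ⁻¹(X) = Φ⁻ⁿ(Φ⁻¹(X)) ≅ Φ⁻¹(Φ⁻ⁿ(X))`. -/
def negPowComm (Φ : A ≌ A) : ∀ n : ℕ, negPow Φ (n + 1) ≅ negPow Φ n ⋙ Φ.inverse
  | 0 => Φ.inverse.rightUnitor ≪≫ Φ.inverse.leftUnitor.symm
  | n + 1 => Functor.isoWhiskerLeft Φ.inverse (negPowComm Φ n)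

/-- The canonical isomorphism `Φ⁻ⁿ⁻¹(Φ(X)) = Φ⁻ⁿ(Φ⁻¹Φ(X)) ≅ Φ⁻ⁿ(X)`. -/
def negPowCancel (Φ : A ≌ A) (n : ℕ) (X : A) :
    (negPow Φ (n + 1)).obj (Φ.functor.obj X) ⟶ (negPow Φ n).obj X :=
  (negPow Φ n).map (Φ.unitIso.inv.app X)

/-- The degree of an index: `inl l` stands for `2l` and `inr l` for `2l + 1`. -/
def deg : ℕ ⊕ ℕ → ℕ
  | .inl l => 2 * l
  | .inr l => 2 * l + 1

variable [Abelian A]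

/-- The summands of `tot(A)⁻¹`: `Φ⁻ˡ(A⁻¹_{2l})` and `Φ⁻ˡ⁻¹(A⁰_{2l+1})`. (The complexes are
concentrated in degrees `≥ 0`, so that only these indices occur.) -/
def summandNeg (Φ : A ≌ A) (Am Az : CochainComplex A ℕ) : ℕ ⊕ ℕ → A
  | .inl l => (negPow Φ l).obj (Am.X (2 * l))
  | .inr l => (negPow Φ (l + 1)).obj (Az.X (2 * l + 1))

/-- The summands of `tot(A)⁰`: `Φ⁻ˡ(A⁰_{2l})` and `Φ⁻ˡ(A⁻¹_{2l+1})`. -/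
def summandZero (Φ : A ≌ A) (Am Az : CochainComplex A ℕ) : ℕ ⊕ ℕ → A
  | .inl l => (negPow Φ l).obj (Az.X (2 * l))
  | .inr l => (negPow Φ l).obj (Am.X (2 * l + 1))

/-- The summands of `Φ⁻¹(tot(A)⁰)`: `Φ⁻ˡ⁻¹(A⁰_{2l})` and `Φ⁻ˡ⁻¹(A⁻¹_{2l+1})`. -/
def summandInvZero (Φ : A ≌ A) (Am Az : CochainComplex A ℕ) : ℕ ⊕ ℕ → A
  | .inl l => (negPow Φ (l + 1)).obj (Az.X (2 * l))
  | .inr l => (negPow Φ (l + 1)).obj (Am.X (2 * l + 1))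

/-- The canonical isomorphism of the summands of `Φ⁻¹(tot(A)⁰)` with `Φ⁻¹` of those of
`tot(A)⁰`. -/
def summandInvZeroIso (Φ : A ≌ A) (Am Az : CochainComplex A ℕ) :
    ∀ s : ℕ ⊕ ℕ, summandInvZero Φ Am Az s ≅ Φ.inverse.obj (summandZero Φ Am Az s)
  | .inl l => (negPowComm Φ l).app (Az.X (2 * l))
  | .inr l => (negPowComm Φ l).app (Am.X (2 * l + 1))

variable [HasCoproducts.{v} A]

/-- `tot(A)⁻¹ = ⨁ Φ⁻ˡ(A⁻¹_{2l}) ⊕ ⨁ Φ⁻ˡ⁻¹(A⁰_{2l+1})`. -/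
def totNeg (Φ : A ≌ A) (Am Az : CochainComplex A ℕ) : A := ∐ summandNeg Φ Am Az

/-- `tot(A)⁰ = ⨁ Φ⁻ˡ(A⁰_{2l}) ⊕ ⨁ Φ⁻ˡ(A⁻¹_{2l+1})`. -/
def totZero (Φ : A ≌ A) (Am Az : CochainComplex A ℕ) : A := ∐ summandZero Φ Am Az

section components

variable {Φ : A ≌ A} {Am Az : CochainComplex A ℕ}

/-- The component `φ⁻¹_{p,q}` of `φ⁻¹ : Φ⁻¹(tot(A)⁰) ⟶ tot(A)⁻¹`. -/
def compNeg (φ : Φ.inverse.obj (totZero Φ Am Az) ⟶ totNeg Φ Am Az) (p q : ℕ ⊕ ℕ) :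
    summandInvZero Φ Am Az p ⟶ summandNeg Φ Am Az q :=
  (summandInvZeroIso Φ Am Az p).hom ≫ Φ.inverse.map (Sigma.ι (summandZero Φ Am Az) p) ≫ φ ≫
    Sigma.π (summandNeg Φ Am Az) q

/-- The component `φ⁰_{p,q}` of `φ⁰ : tot(A)⁻¹ ⟶ tot(A)⁰`. -/
def compZero (φ : totNeg Φ Am Az ⟶ totZero Φ Am Az) (p q : ℕ ⊕ ℕ) :
    summandNeg Φ Am Az p ⟶ summandZero Φ Am Az q :=
  Sigma.ι (summandNeg Φ Am Az) p ≫ φ ≫ Sigma.π (summandZero Φ Am Az) q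

end components

open Sum in
/-- A `⊕`-folding of the two complexes `A⁻¹ = Am` and `A⁰ = Az`, concentrated in degrees `≥ 0`.
The differential written `d_{i+1} : A_i ⟶ A_{i+1}` in the literature is `d i (i + 1)`. -/
structure Folding {Φ : A ≌ A} (w : Potential Φ) (Am Az : CochainComplex A ℕ) where
  φneg : Φ.inverse.obj (totZero Φ Am Az) ⟶ totNeg Φ Am Az
  φzero : totNeg Φ Am Az ⟶ totZero Φ Am Az
  φneg_φzero : φneg ≫ φzero = w.invApp (totZero Φ Am Az)
  φzero_φneg : φzero ≫ Φ.counitIso.inv.app (totZero Φ Am Az) ≫ Φ.functor.map φneg =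
    w.app (totNeg Φ Am Az)
  compNeg_eq_zero : ∀ p q : ℕ ⊕ ℕ, deg p + 1 < deg q → compNeg φneg p q = 0
  compZero_eq_zero : ∀ p q : ℕ ⊕ ℕ, deg p + 1 < deg q → compZero φzero p q = 0
  compNeg_odd : ∀ l : ℕ, compNeg φneg (inr l) (inl (l + 1)) =
    (negPow Φ (l + 1)).map (Am.d (2 * l + 1) (2 * (l + 1)))
  compNeg_even : ∀ l : ℕ, compNeg φneg (inl l) (inr l) =
    -(negPow Φ (l + 1)).map (Az.d (2 * l) (2 * l + 1))
  compZero_odd : ∀ l : ℕ, compZero φzero (inr l) (inl (l + 1)) =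
    -(negPow Φ (l + 1)).map (Az.d (2 * l + 1) (2 * (l + 1)))
  compZero_even : ∀ l : ℕ, compZero φzero (inl l) (inr l) =
    (negPow Φ l).map (Am.d (2 * l) (2 * l + 1))

/-- The factorization given by a folding. -/
def Folding.toFactorization {Φ : A ≌ A} {w : Potential Φ} {Am Az : CochainComplex A ℕ}
    (I : Folding w Am Az) : Factorization w where
  neg := totNeg Φ Am Az
  zero := totZero Φ Am Az
  φneg := I.φneg
  φzero := I.φzero
  φneg_φzero := I.φneg_φzero
  φzero_φneg := I.φzero_φneg

end

/-! ## Resolutions of the components of a factorization -/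

section

variable {A : Type u} [Category.{v} A] [Abelian A]

/-- The coaugmentation `d₀ : X ⟶ I₀` of an injective resolution of `X`. -/
def aug {X : A} (R : InjectiveResolution X) : X ⟶ R.cocomplex.X 0 :=
  (HomologicalComplex.singleObjXSelf (ComplexShape.up ℕ) 0 X).inv ≫ R.ι.f 0

/-- An injective resolution is finite if its terms eventually vanish. -/
def IsFiniteResolution {X : A} (R : InjectiveResolution X) : Prop :=
  ∃ n : ℕ, ∀ i : ℕ, n < i → IsZero (R.cocomplex.X i)

/-- A choice of injective resolutions `I⁻¹ = Rm`, `I⁰ = Rz` of the components of `E`, of lifts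
`φ⁻¹_j`, `φ⁰_j` of the structure maps to chain maps, and of null-homotopies `h⁰` and `h⁻¹` of the
differences `w - φ⁰_j φ⁻¹_j` and `w - Φ(φ⁻¹_j) φ⁰_j`. -/
structure ResolutionData {Φ : A ≌ A} {w : Potential Φ} (E : Factorization w) where
  Rm : InjectiveResolution E.neg
  Rz : InjectiveResolution E.zero
  liftNeg : ∀ j : ℕ, Φ.inverse.obj (Rz.cocomplex.X j) ⟶ Rm.cocomplex.X j
  liftZero : ∀ j : ℕ, Rm.cocomplex.X j ⟶ Rz.cocomplex.X j
  aug_liftNeg : Φ.inverse.map (aug Rz) ≫ liftNeg 0 = E.φneg ≫ aug Rm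
  aug_liftZero : aug Rm ≫ liftZero 0 = E.φzero ≫ aug Rz
  d_liftNeg : ∀ j : ℕ, Φ.inverse.map (Rz.cocomplex.d j (j + 1)) ≫ liftNeg (j + 1) =
    liftNeg j ≫ Rm.cocomplex.d j (j + 1)
  d_liftZero : ∀ j : ℕ, Rm.cocomplex.d j (j + 1) ≫ liftZero (j + 1) =
    liftZero j ≫ Rz.cocomplex.d j (j + 1)
  hZero : ∀ j : ℕ, Φ.inverse.obj (Rz.cocomplex.X (j + 1)) ⟶ Rz.cocomplex.X j
  hNeg : ∀ j : ℕ, Rm.cocomplex.X (j + 1) ⟶ Φ.functor.obj (Rm.cocomplex.X j)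
  hZero_zero : w.invApp (Rz.cocomplex.X 0) - liftNeg 0 ≫ liftZero 0 =
    Φ.inverse.map (Rz.cocomplex.d 0 1) ≫ hZero 0
  hZero_succ : ∀ j : ℕ,
    w.invApp (Rz.cocomplex.X (j + 1)) - liftNeg (j + 1) ≫ liftZero (j + 1) =
      hZero j ≫ Rz.cocomplex.d j (j + 1) +
        Φ.inverse.map (Rz.cocomplex.d (j + 1) (j + 2)) ≫ hZero (j + 1)
  hNeg_zero : w.app (Rm.cocomplex.X 0) -
      liftZero 0 ≫ Φ.counitIso.inv.app (Rz.cocomplex.X 0) ≫ Φ.functor.map (liftNeg 0) =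
    Rm.cocomplex.d 0 1 ≫ hNeg 0
  hNeg_succ : ∀ j : ℕ, w.app (Rm.cocomplex.X (j + 1)) -
      liftZero (j + 1) ≫ Φ.counitIso.inv.app (Rz.cocomplex.X (j + 1)) ≫
        Φ.functor.map (liftNeg (j + 1)) =
    hNeg j ≫ Φ.functor.map (Rm.cocomplex.d j (j + 1)) +
      Rm.cocomplex.d (j + 1) (j + 2) ≫ hNeg (j + 1)

end

end MF

/-! On pairs of objects put G(X, Y) = (Φ⁻¹Y, X), so that G² is Φ⁻¹ on each component. A
factorization is then one morphism c : G(M) → M whose square, G(c) followed by c, is the natural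
transformation W given by w. For a folding, c is a matrix with entries from degree m to degree r,
zero for r > m + 1. The entries of its square on and above the diagonal involve only entries with r
≥ m - 1, which the theorem prescribes; there the equation says that d² = 0, that the lifts are chain
maps, and that the h are null-homotopies.

The other entries are found row by row. For r ≤ n the entry (n + 1, r) of the square expresses the
differential followed by c(n + 2, r) through earlier rows. Associativity of the triple product of c,
with G(W) = WG and the naturality of W, shows that the preceding differential kills this expression.
Since the resolutions are exact with injective terms, it extends along the differential, and the
extension is c(n + 2, r) (`Extends.cocycle`, `Extends.step`, `exists_solution`).

It remains to see that the cone M of d₀ is acyclic. Give E[1] index 0 in M and the degree n part of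
the folding index n + 1. The structure maps raise the index by at most one, and their raising parts
are the exact coaugmented resolutions. Let F_p be the sum of the summands of index < p, and τ_p the
largest subfactorization of M inside F_{p+1}. Then F_p ⊂ τ_p ⊂ F_{p+1} and τ_0 = 0, and comparing
leading terms gives τ_{p+1} = F_{p+1} + φ(F_{p+1}). Hence there is an exact sequence 0 → τ_p[-1] →
free(F_{p+1}) → τ_{p+1} → 0 (`exists_shortExact`) whose middle term is contractible.

A thick subcategory containing the totalizations of bounded exact complexes contains the third term
of a short exact sequence along with the first two (`IsThick.of_shortExact`), so by induction every
τ_p is totally acyclic. For finite resolutions M is a retract of some τ_N. In general the telescope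
0 → ⊕τ_p → ⊕τ_p → M → 0 shows that M is co-acyclic. It is exact without any assumption on filtered
colimits, because the τ_p interlace with the split filtration by the F_p. -/

namespace MF

/-! ## Solving the twisted Maurer–Cartan equation row by row -/

section Recursion

variable {B : Type*} [Category B] [Preadditive B] {G : B ⥤ B} [G.Additive]

/-- The entries next to the diagonal of a matrix `c m r : G(X m) ⟶ X r` with square `W`. -/
structure Tridiagonal (W : G ⋙ G ⟶ 𝟭 B) (X : ℕ → B) where
  up : ∀ n, G.obj (X n) ⟶ X (n + 1)
  diag : ∀ n, G.obj (X n) ⟶ X n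
  down : ∀ n, G.obj (X (n + 1)) ⟶ X n
  up_up : ∀ n, G.map (up n) ≫ up (n + 1) = 0
  up_diag : ∀ n, G.map (up n) ≫ diag (n + 1) + G.map (diag n) ≫ up n = 0
  diag_zero : G.map (up 0) ≫ down 0 + G.map (diag 0) ≫ diag 0 = W.app (X 0)
  diag_succ : ∀ n, G.map (up (n + 1)) ≫ down (n + 1) +
    (G.map (diag (n + 1)) ≫ diag (n + 1) + G.map (down n) ≫ up n) = W.app (X (n + 1))

namespace Tridiagonal

variable {W : G ⋙ G ⟶ 𝟭 B} {X : ℕ → B} (T : Tridiagonal W X)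

/-- The matrix `c` has the prescribed entries next to the diagonal and zeros above. -/
structure Extends (c : ∀ m r, G.obj (X m) ⟶ X r) : Prop where
  up : ∀ n, c n (n + 1) = T.up n
  diag : ∀ n, c n n = T.diag n
  down : ∀ n, c (n + 1) n = T.down n
  eq_zero : ∀ m r, m + 1 < r → c m r = 0

/-- The entry `(m, r)` of the square of a matrix. -/
def sq (c : ∀ m r, G.obj (X m) ⟶ X r) (m r : ℕ) : G.obj (G.obj (X m)) ⟶ X r :=
  ∑ q ∈ Finset.range (m + 2), G.map (c m q) ≫ c q r

variable {T} {c : ∀ m r, G.obj (X m) ⟶ X r}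

/-- For `q < m < r` the factor `c q r` vanishes, so only `q = m` and `q = m + 1` contribute. Both
involve prescribed entries or zeros alone: above the diagonal the unknown entries impose no
condition. -/
lemma Extends.sq_of_lt (h : T.Extends c) {m r : ℕ} (hr : m < r) : sq c m r = 0 := by
  obtain ⟨k, rfl⟩ := Nat.exists_eq_add_of_lt hr
  have h0 : ∀ j, ∑ q ∈ Finset.range m, G.map (c m q) ≫ c q (m + j + 1) = 0 := fun j =>
    Finset.sum_eq_zero fun q hq => by
      rw [h.eq_zero q (m + j + 1) (by have := Finset.mem_range.1 hq; omega), comp_zero]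
  rw [sq, Finset.sum_range_succ, Finset.sum_range_succ, h0, zero_add, h.up, h.diag]
  -- The cases are `r = m + 1` (anticommutation of `up` and `diag`), `r = m + 2` (`up` squares to
  -- zero), and `r ≥ m + 3`, where both terms vanish.
  match k with
  | 0 =>
    rw [h.up, h.diag]
    exact (add_comm _ _).trans (T.up_diag m)
  | 1 => rw [h.eq_zero m (m + 1 + 1) (by omega), h.up, comp_zero, zero_add, T.up_up]
  | k + 2 =>
    rw [h.eq_zero m _ (by omega), h.eq_zero (m + 1) _ (by omega), comp_zero, comp_zero, add_zero]

/-- Only the neighbours `q = m - 1, m, m + 1` of the diagonal contribute, and all their entries are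
prescribed. -/
lemma Extends.sq_self (h : T.Extends c) (m : ℕ) : sq c m m = W.app (X m) := by
  match m with
  | 0 =>
    rw [sq, Finset.sum_range_succ, Finset.sum_range_one, h.up, h.diag, h.down, add_comm,
      T.diag_zero]
  | m + 1 =>
    have h0 : ∑ q ∈ Finset.range m, G.map (c (m + 1) q) ≫ c q (m + 1) = 0 :=
      Finset.sum_eq_zero fun q hq => by
        rw [h.eq_zero q (m + 1) (by have := Finset.mem_range.1 hq; omega), comp_zero]
    rw [sq, Finset.sum_range_succ, Finset.sum_range_succ, Finset.sum_range_succ, h0, zero_add,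
      h.up, h.down, h.down, h.diag, h.up, ← T.diag_succ]
    abel

/-- The obstruction to solving for row `n + 2` is a cocycle. -/
lemma Extends.cocycle (hW : ∀ Y, G.map (W.app Y) = W.app (G.obj Y)) (h : T.Extends c) (n : ℕ)
    (hc : ∀ m ≤ n, ∀ r < m, sq c m r = 0) (r : ℕ) (hr : r ≤ n) :
    G.map (G.map (T.up n)) ≫ ∑ q ∈ Finset.range (n + 2), G.map (c (n + 1) q) ≫ c q r = 0 := by
  have hs : ∀ m ≤ n, ∀ q, m ≠ q → sq c m q = 0 := fun m hm q hq => by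
    rcases lt_or_gt_of_ne hq with h' | h'
    · exact h.sq_of_lt h'
    · exact hc m hm q h'
  -- Solving row `n` of the square for its last term trades row `n + 1` of the matrix for earlier
  -- rows and the square itself.
  have key : ∀ q, G.map (T.up n) ≫ c (n + 1) q =
      sq c n q - ∑ q' ∈ Finset.range (n + 1), G.map (c n q') ≫ c q' q := fun q => by
    rw [sq, Finset.sum_range_succ _ (n + 1), h.up, add_sub_cancel_left]
  rw [Preadditive.comp_sum]
  simp only [← Functor.map_comp_assoc, key, Functor.map_sub, Preadditive.sub_comp,
    Finset.sum_sub_distrib]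
  rw [sub_eq_zero, Finset.sum_eq_single n
    (fun q _ hq => by rw [hs n le_rfl q hq.symm, Functor.map_zero, zero_comp])
    (fun hn => absurd (Finset.mem_range.2 (by omega)) hn), h.sq_self, hW]
  -- Associativity: exchanging the sums brackets the triple product the other way. The inner range
  -- shrinks to `q' + 2` because `c q' q = 0` beyond it.
  have swap : ∑ q ∈ Finset.range (n + 2),
      G.map (∑ q' ∈ Finset.range (n + 1), G.map (c n q') ≫ c q' q) ≫ c q r =
      ∑ q' ∈ Finset.range (n + 1), G.map (G.map (c n q')) ≫ sq c q' r := by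
    simp only [Functor.map_sum, Functor.map_comp, Preadditive.sum_comp, Category.assoc]
    rw [Finset.sum_comm]
    refine Finset.sum_congr rfl fun q' hq' => ?_
    have hle := Finset.mem_range.1 hq'
    rw [sq, Preadditive.comp_sum]
    refine (Finset.sum_subset (Finset.range_mono (by omega)) fun q _ hq => ?_).symm
    rw [h.eq_zero q' q (by simp only [Finset.mem_range] at hq; omega), Functor.map_zero,
      zero_comp, comp_zero]
  rw [swap, Finset.sum_eq_single r
    (fun q hq hne => by rw [hs q (by have := Finset.mem_range.1 hq; omega) r hne, comp_zero])
    (fun hn => absurd (Finset.mem_range.2 (by omega)) hn), h.sq_self]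
  -- One bracketing has become `W` followed by `c n r`, the other `G²(c n r)` followed by `W`.
  exact (W.naturality (c n r)).symm

/-- Row `n + 2` can be solved for when the preceding rows are given. -/
lemma Extends.step (hW : ∀ Y, G.map (W.app Y) = W.app (G.obj Y)) (h : T.Extends c) (n : ℕ)
    (hc : ∀ m ≤ n, ∀ r < m, sq c m r = 0)
    (hT : ∀ r (f : G.obj (G.obj (X (n + 1))) ⟶ X r), G.map (G.map (T.up n)) ≫ f = 0 →
      ∃ g : G.obj (X (n + 2)) ⟶ X r, G.map (T.up (n + 1)) ≫ g = f) :
    ∃ c' : ∀ m r, G.obj (X m) ⟶ X r, T.Extends c' ∧ (∀ m, m ≠ n + 2 → c' m = c m) ∧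
      ∀ m ≤ n + 1, ∀ r < m, sq c' m r = 0 := by
  have hg : ∀ r, ∃ g : G.obj (X (n + 2)) ⟶ X r, r ≤ n → G.map (T.up (n + 1)) ≫ g =
      -∑ q ∈ Finset.range (n + 2), G.map (c (n + 1) q) ≫ c q r := fun r => by
    by_cases hr : r ≤ n
    · obtain ⟨g, hg⟩ := hT r (-∑ q ∈ Finset.range (n + 2), G.map (c (n + 1) q) ≫ c q r)
        (by rw [Preadditive.comp_neg, h.cocycle hW n hc r hr, neg_zero])
      exact ⟨g, fun _ => hg⟩
    · exact ⟨0, fun h' => absurd h' hr⟩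
  choose g hg using hg
  -- Columns `r > n` of row `n + 2` keep their values, since the prescribed entries and the zeros of
  -- that row lie there.
  let c' : ∀ m r, G.obj (X m) ⟶ X r :=
    Function.update c (n + 2) fun r => if r ≤ n then g r else c (n + 2) r
  have e : ∀ m, m ≠ n + 2 → c' m = c m := fun m hm => Function.update_of_ne hm _ _
  have e' : ∀ r, n < r → c' (n + 2) r = c (n + 2) r := fun r hr => by
    simp only [c', Function.update_self, if_neg (not_le.2 hr)]
  have e'' : ∀ m r, n < r → c' m r = c m r := fun m r hr => by
    by_cases hm : m = n + 2
    · subst hm; exact e' r hr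
    · rw [e m hm]
  have e3 : ∀ m r, m ≤ r + 1 → c' m r = c m r := fun m r hr => by
    by_cases hm : m = n + 2
    · exact e'' m r (by omega)
    · rw [e m hm]
  refine ⟨c', ⟨fun m => ?_, fun m => ?_, fun m => ?_, fun m r hr => ?_⟩, e, fun m hm r hr => ?_⟩
  · rw [e3 _ _ (by omega), h.up]
  · rw [e3 _ _ (by omega), h.diag]
  · rw [e3 _ _ (by omega), h.down]
  · rw [e3 _ _ (by omega), h.eq_zero m r hr]
  -- The square in row `n + 1` sees the new row only through its last term `q = n + 2`; in rows `m ≤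
  -- n` it uses the matrix rows up to `n + 1` only, which are unchanged.
  · rcases Nat.lt_or_ge n m with hmn | hmn
    · obtain rfl : m = n + 1 := by omega
      have e4 : ∑ q ∈ Finset.range (n + 2), G.map (c' (n + 1) q) ≫ c' q r =
          ∑ q ∈ Finset.range (n + 2), G.map (c (n + 1) q) ≫ c q r :=
        Finset.sum_congr rfl fun q hq => by
          have := Finset.mem_range.1 hq
          rw [e q (by omega), e (n + 1) (by omega)]
      have e5 : c' (n + 2) r = g r := by
        simp only [c', Function.update_self, if_pos (Nat.lt_succ_iff.1 hr)]
      rw [sq, Finset.sum_range_succ, e4, e5, e (n + 1) (by omega), h.up,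
        hg r (Nat.lt_succ_iff.1 hr), add_neg_cancel]
    · rw [← hc m hmn r hr, sq, sq]
      refine Finset.sum_congr rfl fun q hq => ?_
      have := Finset.mem_range.1 hq
      rw [e q (by omega), e m (by omega)]

variable (T)

/-- The matrix with only the prescribed entries. -/
lemma exists_extends : ∃ c : ∀ m r, G.obj (X m) ⟶ X r, T.Extends c := by
  -- The three prescribed diagonals are described at arbitrary indices `m`, `r`, with `eqToHom`
  -- absorbing the equality of indices in each case.
  have key : ∀ m r, ∃ f : G.obj (X m) ⟶ X r, (∀ h : m + 1 = r, f = T.up m ≫ eqToHom (by rw [h])) ∧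
      (∀ h : m = r, f = T.diag m ≫ eqToHom (by rw [h])) ∧
      (∀ h : r + 1 = m, f = eqToHom (by rw [h]) ≫ T.down r) ∧ (m + 1 < r → f = 0) := by
    intro m r
    rcases lt_trichotomy m r with h | rfl | h
    · rcases (Nat.succ_le_of_lt h).eq_or_lt with rfl | h'
      · exact ⟨T.up m, by simp, fun h => by omega, fun h => by omega, fun h => by omega⟩
      · exact ⟨0, fun h => by omega, fun h => by omega, fun h => by omega, fun _ => rfl⟩
    · exact ⟨T.diag m, fun h => by omega, by simp, fun h => by omega, fun h => by omega⟩
    · rcases (Nat.succ_le_of_lt h).eq_or_lt with rfl | h'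
      · exact ⟨T.down r, fun h => by omega, fun h => by omega, by simp, fun h => by omega⟩
      · exact ⟨0, fun h => by omega, fun h => by omega, fun h => by omega, fun _ => rfl⟩
  choose c h1 h2 h3 h4 using key
  exact ⟨c, fun n => by simpa using h1 n (n + 1) rfl, fun n => by simpa using h2 n n rfl,
    fun n => by simpa using h3 (n + 1) n rfl, h4⟩

/-- A tridiagonal part extends to a solution if the obstruction cocycles are coboundaries. -/
theorem exists_solution (hW : ∀ Y, G.map (W.app Y) = W.app (G.obj Y))
    (hT : ∀ n r (f : G.obj (G.obj (X (n + 1))) ⟶ X r), G.map (G.map (T.up n)) ≫ f = 0 →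
      ∃ g : G.obj (X (n + 2)) ⟶ X r, G.map (T.up (n + 1)) ≫ g = f) :
    ∃ c : ∀ m r, G.obj (X m) ⟶ X r, T.Extends c ∧ ∀ m r, m ≠ r → sq c m r = 0 := by
  let S (n : ℕ) := { c : ∀ m r, G.obj (X m) ⟶ X r //
    T.Extends c ∧ ∀ m ≤ n, ∀ r < m, sq c m r = 0 }
  have step : ∀ n (s : S n), ∃ s' : S (n + 1), ∀ m, m ≠ n + 2 → s'.1 m = s.1 m := fun n s => by
    obtain ⟨c', h1, h2, h3⟩ := s.2.1.step hW n s.2.2 (hT n)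
    exact ⟨⟨c', h1, h3⟩, h2⟩
  choose next hnext using step
  obtain ⟨c₀, hc₀⟩ := T.exists_extends
  let s : ∀ n, S n := fun n => Nat.rec ⟨c₀, hc₀, fun m hm r hr =>
    absurd (hr.trans_le hm) (Nat.not_lt_zero r)⟩ next n
  -- Passing from stage `n` to stage `n + 1` changes row `n + 2` alone, so row `m` is final from
  -- stage `m - 1` on.
  have stab : ∀ m n, m ≤ n + 1 → (s n).1 m = (s m).1 m := by
    intro m n h
    rcases Nat.lt_or_ge n m with h' | h'
    · obtain rfl : m = n + 1 := by omega
      exact (hnext n (s n) (n + 1) (by omega)).symm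
    · induction n, h' using Nat.le_induction with
      | base => rfl
      | succ n h' ih => rw [← ih (by omega)]; exact hnext n (s n) m (by omega)
  -- The limit matrix takes row `m` from stage `m`. By `stab` stage `m` already has the final rows
  -- up to `m + 1`, which are all that row `m` of the square uses.
  have ext : T.Extends fun m r => (s m).1 m r :=
    ⟨fun n => (s n).2.1.up n, fun n => (s n).2.1.diag n, fun n => (s (n + 1)).2.1.down n,
      fun m r hr => (s m).2.1.eq_zero m r hr⟩
  refine ⟨_, ext, fun m r hmr => ?_⟩
  rcases lt_or_gt_of_ne hmr with h | h
  · exact ext.sq_of_lt h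
  · rw [← (s m).2.2 m le_rfl r h, sq, sq]
    refine Finset.sum_congr rfl fun q hq => ?_
    have := Finset.mem_range.1 hq
    rw [stab q m (by omega)]

end Tridiagonal

end Recursion

end MF

namespace MF

/-! ## Exact pairs of morphisms -/

section ExactAt

variable {A : Type u} [Category.{v} A] [Abelian A]

/-- The pair `X ⟶ Y ⟶ Z` is a complex, exact at `Y`. -/
def ExactAt {X Y Z : A} (f : X ⟶ Y) (g : Y ⟶ Z) : Prop :=
  ∃ h : f ≫ g = 0, (ShortComplex.mk f g h).Exact

namespace ExactAt

variable {X Y Z : A} {f : X ⟶ Y} {g : Y ⟶ Z}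

lemma of_iso {X' Y' Z' : A} {f' : X' ⟶ Y'} {g' : Y' ⟶ Z'} (h : ExactAt f g) (a : X' ≅ X)
    (b : Y' ≅ Y) (c : Z' ≅ Z) (h₁ : f' ≫ b.hom = a.hom ≫ f) (h₂ : g' ≫ c.hom = b.hom ≫ g) :
    ExactAt f' g' := by
  obtain ⟨h0, h⟩ := h
  have h0' : f' ≫ g' = 0 := by
    rw [← cancel_mono c.hom, Category.assoc, h₂, reassoc_of% h₁, h0, comp_zero, zero_comp]
  exact ⟨h0', ShortComplex.exact_of_iso
    (ShortComplex.isoMk (S₁ := ShortComplex.mk f' g' h0') (S₂ := ShortComplex.mk f g h0)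
      a b c h₁.symm h₂.symm).symm h⟩

lemma neg_left (h : ExactAt f g) : ExactAt (-f) g :=
  h.of_iso ⟨-𝟙 X, -𝟙 X, by simp, by simp⟩ (Iso.refl _) (Iso.refl _) (by simp) (by simp)

lemma neg_right (h : ExactAt f g) : ExactAt f (-g) :=
  h.of_iso (Iso.refl _) (Iso.refl _) ⟨-𝟙 Z, -𝟙 Z, by simp, by simp⟩ (by simp) (by simp)

lemma map (h : ExactAt f g) (F : A ⥤ A) [F.IsEquivalence] : ExactAt (F.map f) (F.map g) := by
  have : F.Additive := F.additive_of_preserves_binary_products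
  obtain ⟨h0, h⟩ := h
  exact ⟨by rw [← F.map_comp, h0, F.map_zero], h.map F⟩

lemma of_map (F : A ⥤ A) [F.IsEquivalence] (h : ExactAt (F.map f) (F.map g)) : ExactAt f g := by
  have : F.Additive := F.additive_of_preserves_binary_products
  obtain ⟨h0, h⟩ := h
  have h0' : f ≫ g = 0 := F.map_injective (by rw [F.map_comp, h0, F.map_zero])
  exact ⟨h0', ((ShortComplex.mk f g h0').exact_map_iff_of_faithful F).1 h⟩

/-- By exactness `k` factors through the image of `g`, and injectivity of `J` extends it from there
to `Z`. -/
lemma desc (h : ExactAt f g) {J : A} [Injective J] (k : Y ⟶ J) (hk : f ≫ k = 0) :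
    ∃ l : Z ⟶ J, g ≫ l = k :=
  ⟨h.2.descToInjective k hk, h.2.comp_descToInjective k hk⟩

lemma exists_lift (h : ExactAt f g) {T : A} (t : T ⟶ Y) (ht : t ≫ g = 0) :
    ∃ (T' : A) (π : T' ⟶ T) (_ : Epi π) (y : T' ⟶ X), π ≫ t = y ≫ f :=
  h.2.exact_up_to_refinements t ht

end ExactAt

variable {X : A} (R : InjectiveResolution X)

lemma exactAt_resolution (j : ℕ) :
    ExactAt (R.cocomplex.d j (j + 1)) (R.cocomplex.d (j + 1) (j + 2)) :=
  ⟨_, R.exact_succ j⟩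

lemma exactAt_aug : ExactAt (aug R) (R.cocomplex.d 0 1) :=
  ExactAt.of_iso (f := R.ι.f 0) ⟨_, R.exact₀⟩
    (HomologicalComplex.singleObjXSelf (ComplexShape.up ℕ) 0 X).symm (Iso.refl _) (Iso.refl _)
    (Category.comp_id _) ((Category.comp_id _).trans (Category.id_comp _).symm)

instance mono_aug : Mono (aug R) := mono_comp _ _

end ExactAt

/-! ## Indices -/

/-- The index of the next degree. -/
def nxt : ℕ ⊕ ℕ → ℕ ⊕ ℕ
  | .inl l => .inr l
  | .inr l => .inl (l + 1)

lemma deg_nxt (p : ℕ ⊕ ℕ) : deg (nxt p) = deg p + 1 := by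
  rcases p with l | l
  · rfl
  · simp only [nxt, deg]; omega

/-- The index of degree `n`. -/
def idx : ℕ → ℕ ⊕ ℕ
  | 0 => .inl 0
  | n + 1 => nxt (idx n)

lemma deg_idx (n : ℕ) : deg (idx n) = n := by
  induction n with
  | zero => rfl
  | succ n ih => rw [idx, deg_nxt, ih]

lemma deg_injective : Function.Injective deg := by
  rintro (l | l) (m | m) h <;> simp only [deg] at h
  · rw [show l = m by omega]
  · omega
  · omega
  · rw [show l = m by omega]

lemma idx_deg (p : ℕ ⊕ ℕ) : idx (deg p) = p := deg_injective (deg_idx _)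

lemma idx_injective : Function.Injective idx := fun m n h => by rw [← deg_idx m, h, deg_idx]

/-! ## The square root of `Φ⁻¹` on pairs of objects -/

section Pairs

variable {A : Type u} [Category.{v} A] [Abelian A] {Φ : A ≌ A}

/-- The matrix calculus needs sums of morphisms of pairs; they are taken componentwise. -/
instance prodPreadditive : Preadditive (A × A) where
  homGroup X Y := inferInstanceAs (AddCommGroup ((X.1 ⟶ Y.1) × (X.2 ⟶ Y.2)))
  add_comp _ _ _ f f' g := Prod.ext (Preadditive.add_comp _ _ _ f.1 f'.1 g.1)
    (Preadditive.add_comp _ _ _ f.2 f'.2 g.2)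
  comp_add _ _ _ f g g' := Prod.ext (Preadditive.comp_add _ _ _ f.1 g.1 g'.1)
    (Preadditive.comp_add _ _ _ f.2 g.2 g'.2)

/-- The functor `(X, Y) ↦ (Φ⁻¹ Y, X)`, whose square is `Φ⁻¹`. -/
def rootInv (Φ : A ≌ A) : A × A ⥤ A × A where
  obj X := (Φ.inverse.obj X.2, X.1)
  map f := (Φ.inverse.map f.2, f.1)

instance : (rootInv Φ).Additive where
  map_add {_ _ f g} := Prod.ext (Φ.inverse.map_add (f := f.2) (g := g.2)) rfl

/-- The assumption `w_{Φ(X)} = Φ(w_X)` enters here, through `invApp_eq`. It is what makes the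
potential on pairs commute with `rootInv`, the hypothesis `hW` of `exists_solution`. -/
lemma Potential.map_invApp (w : Potential Φ) (X : A) :
    Φ.inverse.map (w.invApp X) = w.invApp (Φ.inverse.obj X) := by
  rw [w.invApp_eq X, Potential.invApp, Functor.map_comp]
  exact congrArg _ (Φ.unitInv_app_inverse X).symm

/-- The potential on pairs. -/
def pairPotential (w : Potential Φ) : rootInv Φ ⋙ rootInv Φ ⟶ 𝟭 (A × A) where
  app X := (w.invApp X.1, w.invApp X.2)
  naturality _ _ f := Prod.ext (w.invApp_naturality f.1) (w.invApp_naturality f.2)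

lemma map_pairPotential (w : Potential Φ) (X : A × A) :
    (rootInv Φ).map ((pairPotential w).app X) = (pairPotential w).app ((rootInv Φ).obj X) :=
  Prod.ext (w.map_invApp X.2) rfl

end Pairs

/-! ## Powers of `Φ⁻¹` -/

section NegPow

variable {A : Type u} [Category.{v} A] [Abelian A] {Φ : A ≌ A}

instance negPow_isEquivalence (n : ℕ) : (negPow Φ n).IsEquivalence := by
  induction n with
  | zero => exact inferInstanceAs (𝟭 A).IsEquivalence
  | succ n ih => exact inferInstanceAs (Φ.inverse ⋙ negPow Φ n).IsEquivalence

instance negPow_additive (n : ℕ) : (negPow Φ n).Additive :=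
  (negPow Φ n).additive_of_preserves_binary_products

lemma injective_obj (F : A ⥤ A) [F.IsEquivalence] (J : A) [Injective J] : Injective (F.obj J) :=
  Injective.injective_of_adjoint F.asEquivalence.symm.toAdjunction J

variable (Φ) in
/-- The canonical isomorphism `Φ⁻¹Φ⁻ⁿ ≅ Φ⁻ⁿΦ⁻¹`. -/
def negPowSucc (n : ℕ) (X : A) :
    Φ.inverse.obj ((negPow Φ n).obj X) ≅ (negPow Φ n).obj (Φ.inverse.obj X) :=
  ((negPowComm Φ n).app X).symm

lemma negPowSucc_naturality (n : ℕ) {X Y : A} (f : X ⟶ Y) :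
    Φ.inverse.map ((negPow Φ n).map f) ≫ (negPowSucc Φ n Y).hom =
      (negPowSucc Φ n X).hom ≫ (negPow Φ n).map (Φ.inverse.map f) :=
  (negPowComm Φ n).inv.naturality f

lemma negPowSucc_invApp (w : Potential Φ) (n : ℕ) (X : A) :
    (negPowSucc Φ n X).hom ≫ (negPow Φ n).map (w.invApp X) = w.invApp ((negPow Φ n).obj X) := by
  induction n generalizing X with
  | zero =>
    have h : (negPowSucc Φ 0 X).hom = 𝟙 _ := Category.id_comp (𝟙 (Φ.inverse.obj X))
    rw [h]
    exact Category.id_comp _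
  | succ n ih =>
    have := ih (Φ.inverse.obj X)
    rw [← w.map_invApp] at this
    exact this

end NegPow

end MF

namespace MF

/-! ## The prescribed components of the folding -/

namespace ResolutionData

open Sum

variable {A : Type u} [Category.{v} A] [Abelian A] {Φ : A ≌ A} {w : Potential Φ}
  {E : Factorization w} (D : ResolutionData E)

/-- The null-homotopy `h⁻¹`, transposed to `Φ⁻¹(I⁻¹_{j+1}) ⟶ I⁻¹_j`. -/
def hNegT (j : ℕ) : Φ.inverse.obj (D.Rm.cocomplex.X (j + 1)) ⟶ D.Rm.cocomplex.X j :=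
  Φ.inverse.map (D.hNeg j) ≫ Φ.unitIso.inv.app _

/-- Transposition under the equivalence turns maps into `Φ(Z)` into maps out of `Φ⁻¹`; in this way
the equations for `h⁻¹` take the shape of those for `h⁰`. -/
lemma transpose_comp {X Y Z : A} (b : X ⟶ Y) (a : Φ.inverse.obj Y ⟶ Z) :
    Φ.inverse.map (b ≫ Φ.counitIso.inv.app Y ≫ Φ.functor.map a) ≫ Φ.unitIso.inv.app Z =
      Φ.inverse.map b ≫ a := by
  simp only [Functor.map_comp, Category.assoc]
  rw [transpose_aux]

lemma hNegT_zero : Φ.inverse.map (D.Rm.cocomplex.d 0 1) ≫ D.hNegT 0 +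
    Φ.inverse.map (D.liftZero 0) ≫ D.liftNeg 0 = w.invApp (D.Rm.cocomplex.X 0) := by
  have h := congrArg (fun f => Φ.inverse.map f ≫ Φ.unitIso.inv.app _) D.hNeg_zero
  rw [Functor.map_sub, Preadditive.sub_comp, transpose_comp, sub_eq_iff_eq_add,
    Functor.map_comp, Category.assoc] at h
  exact h.symm

lemma hNegT_succ (j : ℕ) : Φ.inverse.map (D.Rm.cocomplex.d (j + 1) (j + 2)) ≫ D.hNegT (j + 1) +
    (Φ.inverse.map (D.liftZero (j + 1)) ≫ D.liftNeg (j + 1) +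
      D.hNegT j ≫ D.Rm.cocomplex.d j (j + 1)) = w.invApp (D.Rm.cocomplex.X (j + 1)) := by
  have h := congrArg (fun f => Φ.inverse.map f ≫ Φ.unitIso.inv.app _) (D.hNeg_succ j)
  have h2 := Φ.unitIso.inv.naturality (D.Rm.cocomplex.d j (j + 1))
  dsimp at h h2
  rw [Functor.map_sub, Preadditive.sub_comp, transpose_comp, sub_eq_iff_eq_add, Functor.map_add,
    Preadditive.add_comp, Functor.map_comp, Category.assoc, h2, Functor.map_comp,
    Category.assoc] at h
  rw [hNegT, hNegT, Potential.invApp, h, Category.assoc]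
  abel

lemma hZero_zero' : Φ.inverse.map (D.Rz.cocomplex.d 0 1) ≫ D.hZero 0 +
    D.liftNeg 0 ≫ D.liftZero 0 = w.invApp (D.Rz.cocomplex.X 0) :=
  (sub_eq_iff_eq_add.1 D.hZero_zero).symm

lemma hZero_succ' (j : ℕ) : Φ.inverse.map (D.Rz.cocomplex.d (j + 1) (j + 2)) ≫ D.hZero (j + 1) +
    (D.liftNeg (j + 1) ≫ D.liftZero (j + 1) + D.hZero j ≫ D.Rz.cocomplex.d j (j + 1)) =
      w.invApp (D.Rz.cocomplex.X (j + 1)) := by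
  rw [sub_eq_iff_eq_add.1 (D.hZero_succ j)]
  abel

/-- The pairs of summands of `tot⁻¹` and `tot⁰`. -/
abbrev term (p : ℕ ⊕ ℕ) : A × A :=
  (summandNeg Φ D.Rm.cocomplex D.Rz.cocomplex p, summandZero Φ D.Rm.cocomplex D.Rz.cocomplex p)

/-- The components raising the degree. -/
def up : ∀ p : ℕ ⊕ ℕ, (rootInv Φ).obj (D.term p) ⟶ D.term (nxt p)
  | .inl l => ((negPowSucc Φ l (D.Rz.cocomplex.X (2 * l))).hom ≫
        (negPow Φ (l + 1)).map (-D.Rz.cocomplex.d (2 * l) (2 * l + 1)),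
      (negPow Φ l).map (D.Rm.cocomplex.d (2 * l) (2 * l + 1)))
  | .inr l => ((negPowSucc Φ l (D.Rm.cocomplex.X (2 * l + 1))).hom ≫
        (negPow Φ (l + 1)).map (D.Rm.cocomplex.d (2 * l + 1) (2 * (l + 1))),
      (negPow Φ (l + 1)).map (-D.Rz.cocomplex.d (2 * l + 1) (2 * (l + 1))))

/-- The components preserving the degree. -/
def diag : ∀ p : ℕ ⊕ ℕ, (rootInv Φ).obj (D.term p) ⟶ D.term p
  | .inl l => ((negPowSucc Φ l (D.Rz.cocomplex.X (2 * l))).hom ≫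
        (negPow Φ l).map (D.liftNeg (2 * l)),
      (negPow Φ l).map (D.liftZero (2 * l)))
  | .inr l => ((negPowSucc Φ l (D.Rm.cocomplex.X (2 * l + 1))).hom ≫
        (negPow Φ (l + 1)).map (D.liftZero (2 * l + 1)),
      (negPow Φ l).map (D.liftNeg (2 * l + 1)))

/-- The components lowering the degree by one. -/
def down : ∀ p : ℕ ⊕ ℕ, (rootInv Φ).obj (D.term (nxt p)) ⟶ D.term p
  | .inl l => ((negPowSucc Φ l (D.Rm.cocomplex.X (2 * l + 1))).hom ≫
        (negPow Φ l).map (D.hNegT (2 * l)),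
      (negPow Φ l).map (-D.hZero (2 * l)))
  | .inr l => ((negPowSucc Φ (l + 1) (D.Rz.cocomplex.X (2 * (l + 1)))).hom ≫
        (negPow Φ (l + 1)).map (-D.hZero (2 * l + 1)),
      (negPow Φ l).map (D.hNegT (2 * l + 1)))

section

variable (n : ℕ) {X Y Y' Y'' Z : A}

lemma negPow_comp (f : Φ.inverse.obj X ⟶ Y) (g : Y ⟶ Z) :
    ((negPowSucc Φ n X).hom ≫ (negPow Φ n).map f) ≫ (negPow Φ n).map g =
      (negPowSucc Φ n X).hom ≫ (negPow Φ n).map (f ≫ g) := by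
  rw [Category.assoc, Functor.map_comp]

lemma inverse_negPow_comp (f : X ⟶ Y) (g : Φ.inverse.obj Y ⟶ Z) :
    Φ.inverse.map ((negPow Φ n).map f) ≫ (negPowSucc Φ n Y).hom ≫ (negPow Φ n).map g =
      (negPowSucc Φ n X).hom ≫ (negPow Φ n).map (Φ.inverse.map f ≫ g) := by
  rw [Functor.map_comp]
  rw [reassoc_of% negPowSucc_naturality n f]

lemma negPowSucc_add (f g : Φ.inverse.obj X ⟶ Y) :
    (negPowSucc Φ n X).hom ≫ (negPow Φ n).map f + (negPowSucc Φ n X).hom ≫ (negPow Φ n).map g =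
      (negPowSucc Φ n X).hom ≫ (negPow Φ n).map (f + g) := by
  rw [Functor.map_add]
  exact (Preadditive.comp_add _ _ _ _ _ _).symm

lemma negPowSucc_zero :
    (negPowSucc Φ n X).hom ≫ (negPow Φ n).map (0 : Φ.inverse.obj X ⟶ Y) = 0 := by
  rw [Functor.map_zero]
  exact comp_zero

lemma negPow_comp_add (f : Φ.inverse.obj X ⟶ Y) (g : Y ⟶ Z) (f' : Φ.inverse.obj X ⟶ Y')
    (g' : Y' ⟶ Z) : ((negPowSucc Φ n X).hom ≫ (negPow Φ n).map f) ≫ (negPow Φ n).map g +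
      ((negPowSucc Φ n X).hom ≫ (negPow Φ n).map f') ≫ (negPow Φ n).map g' =
      (negPowSucc Φ n X).hom ≫ (negPow Φ n).map (f ≫ g + f' ≫ g') := by
  rw [negPow_comp, negPow_comp, negPowSucc_add]

lemma inverse_negPow_comp_add (f : X ⟶ Y) (g : Φ.inverse.obj Y ⟶ Z) (f' : X ⟶ Y')
    (g' : Φ.inverse.obj Y' ⟶ Z) :
    Φ.inverse.map ((negPow Φ n).map f) ≫ (negPowSucc Φ n Y).hom ≫ (negPow Φ n).map g +
      Φ.inverse.map ((negPow Φ n).map f') ≫ (negPowSucc Φ n Y').hom ≫ (negPow Φ n).map g' =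
      (negPowSucc Φ n X).hom ≫ (negPow Φ n).map (Φ.inverse.map f ≫ g + Φ.inverse.map f' ≫ g') := by
  rw [inverse_negPow_comp, inverse_negPow_comp, negPowSucc_add]

lemma negPow_comp_add_add (f : Φ.inverse.obj X ⟶ Y) (g : Y ⟶ Z) (f' : Φ.inverse.obj X ⟶ Y')
    (g' : Y' ⟶ Z) (f'' : Φ.inverse.obj X ⟶ Y'') (g'' : Y'' ⟶ Z) :
    ((negPowSucc Φ n X).hom ≫ (negPow Φ n).map f) ≫ (negPow Φ n).map g +
      (((negPowSucc Φ n X).hom ≫ (negPow Φ n).map f') ≫ (negPow Φ n).map g' +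
      ((negPowSucc Φ n X).hom ≫ (negPow Φ n).map f'') ≫ (negPow Φ n).map g'') =
      (negPowSucc Φ n X).hom ≫ (negPow Φ n).map (f ≫ g + (f' ≫ g' + f'' ≫ g'')) := by
  rw [negPow_comp, negPow_comp_add, negPowSucc_add]

lemma inverse_negPow_comp_add_add (f : X ⟶ Y) (g : Φ.inverse.obj Y ⟶ Z) (f' : X ⟶ Y')
    (g' : Φ.inverse.obj Y' ⟶ Z) (f'' : X ⟶ Y'') (g'' : Φ.inverse.obj Y'' ⟶ Z) :
    Φ.inverse.map ((negPow Φ n).map f) ≫ (negPowSucc Φ n Y).hom ≫ (negPow Φ n).map g +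
      (Φ.inverse.map ((negPow Φ n).map f') ≫ (negPowSucc Φ n Y').hom ≫ (negPow Φ n).map g' +
      Φ.inverse.map ((negPow Φ n).map f'') ≫ (negPowSucc Φ n Y'').hom ≫ (negPow Φ n).map g'') =
      (negPowSucc Φ n X).hom ≫ (negPow Φ n).map
        (Φ.inverse.map f ≫ g + (Φ.inverse.map f' ≫ g' + Φ.inverse.map f'' ≫ g'')) := by
  rw [inverse_negPow_comp, inverse_negPow_comp_add, negPowSucc_add]

lemma negPowSucc_of_eq_zero {f : Φ.inverse.obj X ⟶ Y} (h : f = 0) :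
    (negPowSucc Φ n X).hom ≫ (negPow Φ n).map f = 0 := by
  rw [h, negPowSucc_zero]

lemma negPowSucc_of_eq_invApp {f : Φ.inverse.obj X ⟶ X} (h : f = w.invApp X) :
    (negPowSucc Φ n X).hom ≫ (negPow Φ n).map f = w.invApp ((negPow Φ n).obj X) := by
  rw [h, negPowSucc_invApp]

end

/-- Two consecutive raising components come from the same resolution, and carry the sign either both
or not at all. So this is d² = 0. -/
lemma up_up (p : ℕ ⊕ ℕ) : (rootInv Φ).map (D.up p) ≫ D.up (nxt p) = 0 := by
  rcases p with l | l
  · exact Prod.ext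
      ((inverse_negPow_comp l (D.Rm.cocomplex.d (2 * l) (2 * l + 1))
        (Φ.inverse.map (D.Rm.cocomplex.d (2 * l + 1) (2 * l + 2)))).trans
        (negPowSucc_of_eq_zero l (by
          rw [← Functor.map_comp, HomologicalComplex.d_comp_d, Functor.map_zero])))
      ((negPow_comp l (Φ.inverse.map (-D.Rz.cocomplex.d (2 * l) (2 * l + 1)))
        (Φ.inverse.map (-D.Rz.cocomplex.d (2 * l + 1) (2 * l + 2)))).trans
        (negPowSucc_of_eq_zero l (by
          rw [← Functor.map_comp, Preadditive.neg_comp, Preadditive.comp_neg,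
            HomologicalComplex.d_comp_d, neg_zero, neg_zero, Functor.map_zero])))
  · exact Prod.ext
      ((inverse_negPow_comp (l + 1) (-D.Rz.cocomplex.d (2 * l + 1) (2 * l + 2))
        (Φ.inverse.map (-D.Rz.cocomplex.d (2 * l + 2) (2 * l + 3)))).trans
        (negPowSucc_of_eq_zero (l + 1) (by
          rw [← Functor.map_comp, Preadditive.neg_comp, Preadditive.comp_neg,
            HomologicalComplex.d_comp_d, neg_zero, neg_zero, Functor.map_zero])))
      ((negPow_comp l (Φ.inverse.map (D.Rm.cocomplex.d (2 * l + 1) (2 * l + 2)))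
        (Φ.inverse.map (D.Rm.cocomplex.d (2 * l + 2) (2 * l + 3)))).trans
        (negPowSucc_of_eq_zero l (by
          rw [← Functor.map_comp, HomologicalComplex.d_comp_d, Functor.map_zero])))

/-- Only the differentials of `I⁰` carry a sign, so the commutation of the lifts with the
differentials becomes anticommutation. -/
lemma up_diag (p : ℕ ⊕ ℕ) : (rootInv Φ).map (D.up p) ≫ D.diag (nxt p) +
    (rootInv Φ).map (D.diag p) ≫ D.up p = 0 := by
  rcases p with l | l
  · exact Prod.ext
      ((inverse_negPow_comp_add l (D.Rm.cocomplex.d (2 * l) (2 * l + 1))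
        (Φ.inverse.map (D.liftZero (2 * l + 1))) (D.liftZero (2 * l))
        (Φ.inverse.map (-D.Rz.cocomplex.d (2 * l) (2 * l + 1)))).trans
        (negPowSucc_of_eq_zero l (by
          rw [← Functor.map_comp, ← Functor.map_comp, D.d_liftZero, ← Functor.map_add,
            Preadditive.comp_neg, add_neg_cancel, Functor.map_zero])))
      ((negPow_comp_add l (Φ.inverse.map (-D.Rz.cocomplex.d (2 * l) (2 * l + 1)))
        (D.liftNeg (2 * l + 1)) (D.liftNeg (2 * l))
        (D.Rm.cocomplex.d (2 * l) (2 * l + 1))).trans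
        (negPowSucc_of_eq_zero l (by
          rw [Functor.map_neg, Preadditive.neg_comp, D.d_liftNeg, neg_add_cancel])))
  · exact Prod.ext
      ((inverse_negPow_comp_add l (Φ.inverse.map (-D.Rz.cocomplex.d (2 * l + 1) (2 * l + 2)))
        (Φ.inverse.map (D.liftNeg (2 * l + 2))) (D.liftNeg (2 * l + 1))
        (Φ.inverse.map (D.Rm.cocomplex.d (2 * l + 1) (2 * l + 2)))).trans
        (negPowSucc_of_eq_zero l (by
          rw [← Functor.map_comp, ← Functor.map_comp, ← Functor.map_add, Functor.map_neg,
            Preadditive.neg_comp, D.d_liftNeg, neg_add_cancel, Functor.map_zero])))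
      ((negPow_comp_add l (Φ.inverse.map (D.Rm.cocomplex.d (2 * l + 1) (2 * l + 2)))
        (Φ.inverse.map (D.liftZero (2 * l + 2))) (Φ.inverse.map (D.liftZero (2 * l + 1)))
        (Φ.inverse.map (-D.Rz.cocomplex.d (2 * l + 1) (2 * l + 2)))).trans
        (negPowSucc_of_eq_zero l (by
          rw [← Functor.map_comp, ← Functor.map_comp, D.d_liftZero, ← Functor.map_add,
            Preadditive.comp_neg, add_neg_cancel, Functor.map_zero])))

lemma diag_zero : (rootInv Φ).map (D.up (inl 0)) ≫ D.down (inl 0) +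
    (rootInv Φ).map (D.diag (inl 0)) ≫ D.diag (inl 0) =
      (pairPotential w).app (D.term (inl 0)) :=
  Prod.ext
    ((inverse_negPow_comp_add 0 (D.Rm.cocomplex.d 0 1) (D.hNegT 0) (D.liftZero 0)
      (D.liftNeg 0)).trans (negPowSucc_of_eq_invApp 0 D.hNegT_zero))
    ((negPow_comp_add 0 (Φ.inverse.map (-D.Rz.cocomplex.d 0 1)) (-D.hZero 0) (D.liftNeg 0)
      (D.liftZero 0)).trans (negPowSucc_of_eq_invApp 0 (by
        rw [Functor.map_neg, Preadditive.neg_comp, Preadditive.comp_neg, neg_neg, hZero_zero'])))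

/-- These are the homotopy equations. On `I⁰` both the differential and the homotopy carry a sign,
on `I⁻¹` neither does, so the products are the original ones. -/
lemma diag_succ (p : ℕ ⊕ ℕ) : (rootInv Φ).map (D.up (nxt p)) ≫ D.down (nxt p) +
    ((rootInv Φ).map (D.diag (nxt p)) ≫ D.diag (nxt p) +
      (rootInv Φ).map (D.down p) ≫ D.up p) = (pairPotential w).app (D.term (nxt p)) := by
  have hz : ∀ j, Φ.inverse.map (-D.Rz.cocomplex.d (j + 1) (j + 2)) ≫ (-D.hZero (j + 1)) +
      (D.liftNeg (j + 1) ≫ D.liftZero (j + 1) + (-D.hZero j) ≫ (-D.Rz.cocomplex.d j (j + 1))) =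
      w.invApp (D.Rz.cocomplex.X (j + 1)) := fun j => by
    rw [Functor.map_neg, Preadditive.neg_comp, Preadditive.comp_neg, neg_neg,
      Preadditive.neg_comp, Preadditive.comp_neg, neg_neg, hZero_succ']
  rcases p with l | l
  · exact Prod.ext
      ((inverse_negPow_comp_add_add l (Φ.inverse.map (-D.Rz.cocomplex.d (2 * l + 1) (2 * l + 2)))
        (Φ.inverse.map (-D.hZero (2 * l + 1))) (D.liftNeg (2 * l + 1))
        (Φ.inverse.map (D.liftZero (2 * l + 1))) (-D.hZero (2 * l))
        (Φ.inverse.map (-D.Rz.cocomplex.d (2 * l) (2 * l + 1)))).trans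
        (negPowSucc_of_eq_invApp l (by
          rw [← w.map_invApp, ← hz, Functor.map_add, Functor.map_add, Functor.map_comp,
            Functor.map_comp, Functor.map_comp])))
      ((negPow_comp_add_add l (Φ.inverse.map (D.Rm.cocomplex.d (2 * l + 1) (2 * l + 2)))
        (D.hNegT (2 * l + 1)) (Φ.inverse.map (D.liftZero (2 * l + 1))) (D.liftNeg (2 * l + 1))
        (D.hNegT (2 * l)) (D.Rm.cocomplex.d (2 * l) (2 * l + 1))).trans
        (negPowSucc_of_eq_invApp l (D.hNegT_succ (2 * l))))
  · exact Prod.ext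
      ((inverse_negPow_comp_add_add l (Φ.inverse.map (D.Rm.cocomplex.d (2 * l + 2) (2 * l + 3)))
        (Φ.inverse.map (D.hNegT (2 * l + 2))) (Φ.inverse.map (D.liftZero (2 * l + 2)))
        (Φ.inverse.map (D.liftNeg (2 * l + 2))) (D.hNegT (2 * l + 1))
        (Φ.inverse.map (D.Rm.cocomplex.d (2 * l + 1) (2 * l + 2)))).trans
        (negPowSucc_of_eq_invApp l (by
          rw [← w.map_invApp, ← hNegT_succ, Functor.map_add, Functor.map_add, Functor.map_comp,
            Functor.map_comp, Functor.map_comp])))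
      ((negPow_comp_add_add (l + 1) (Φ.inverse.map (-D.Rz.cocomplex.d (2 * l + 2) (2 * l + 3)))
        (-D.hZero (2 * l + 2)) (D.liftNeg (2 * l + 2)) (D.liftZero (2 * l + 2))
        (-D.hZero (2 * l + 1)) (-D.Rz.cocomplex.d (2 * l + 1) (2 * l + 2))).trans
        (negPowSucc_of_eq_invApp (l + 1) (hz (2 * l + 1))))

section

variable {X Y Z : A} {f : X ⟶ Y} {g : Y ⟶ Z}

lemma exactAt_negPowSucc_left (n : ℕ) (h : ExactAt f g) :
    ExactAt (Φ.inverse.map ((negPow Φ n).map f))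
      ((negPowSucc Φ n Y).hom ≫ (negPow Φ n).map (Φ.inverse.map g)) :=
  ((h.map Φ.inverse).map (negPow Φ n)).of_iso (negPowSucc Φ n _) (negPowSucc Φ n _) (Iso.refl _)
    (negPowSucc_naturality n _) (Category.comp_id _)

lemma exactAt_negPowSucc_right (n : ℕ) (h : ExactAt f g) :
    ExactAt ((negPowSucc Φ n X).hom ≫ (negPow Φ n).map (Φ.inverse.map f))
      ((negPow Φ n).map (Φ.inverse.map g)) :=
  ((h.map Φ.inverse).map (negPow Φ n)).of_iso (negPowSucc Φ n _) (Iso.refl _) (Iso.refl _)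
    (Category.comp_id _) ((Category.comp_id _).trans (Category.id_comp _).symm)

end

/-- `rootInv` interchanges the components, so the second component of one step is followed by the
first component of the next. Both belong to one resolution, whose exactness survives signs and
powers of `Φ⁻¹`. -/
lemma exactAt_up_fst (p : ℕ ⊕ ℕ) : ExactAt (Φ.inverse.map (D.up p).2) (D.up (nxt p)).1 := by
  rcases p with l | l
  · exact exactAt_negPowSucc_left l (exactAt_resolution D.Rm (2 * l))
  · exact exactAt_negPowSucc_left (l + 1)
      (exactAt_resolution D.Rz (2 * l + 1)).neg_left.neg_right

lemma exactAt_up_snd (p : ℕ ⊕ ℕ) : ExactAt (D.up p).1 (D.up (nxt p)).2 := by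
  rcases p with l | l
  · exact exactAt_negPowSucc_right l (exactAt_resolution D.Rz (2 * l)).neg_left.neg_right
  · exact exactAt_negPowSucc_right l (exactAt_resolution D.Rm (2 * l + 1))

instance injective_term_fst (p : ℕ ⊕ ℕ) : Injective (D.term p).1 := by
  rcases p with l | l
  · have := D.Rm.injective (2 * l)
    exact injective_obj (negPow Φ l) _
  · have := D.Rz.injective (2 * l + 1)
    exact injective_obj (negPow Φ (l + 1)) _

instance injective_term_snd (p : ℕ ⊕ ℕ) : Injective (D.term p).2 := by
  rcases p with l | l
  · have := D.Rz.injective (2 * l)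
    exact injective_obj (negPow Φ l) _
  · have := D.Rm.injective (2 * l + 1)
    exact injective_obj (negPow Φ l) _

/-- The prescribed components next to the diagonal. -/
def tridiagonal : Tridiagonal (pairPotential w) fun n => D.term (idx n) where
  up n := D.up (idx n)
  diag n := D.diag (idx n)
  down n := D.down (idx n)
  up_up n := D.up_up (idx n)
  up_diag n := D.up_diag (idx n)
  diag_zero := D.diag_zero
  diag_succ n := D.diag_succ (idx n)

/-- All components of the folding. -/
lemma exists_components : ∃ c : ∀ m r, (rootInv Φ).obj (D.term (idx m)) ⟶ D.term (idx r),
    D.tridiagonal.Extends c ∧ ∀ m r, m ≠ r → Tridiagonal.sq c m r = 0 := by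
  refine D.tridiagonal.exists_solution (map_pairPotential w) fun n r f hf => ?_
  -- The extension problem splits into its two components. In each, `G²(up n)` and `G(up (n + 1))`
  -- are consecutive differentials of a transformed resolution, and the target is injective.
  have h₁ := (D.exactAt_up_snd (idx n)).map Φ.inverse
  have h₂ := D.exactAt_up_fst (idx n)
  obtain ⟨g₁, hg₁⟩ := h₁.desc f.1 (congrArg Prod.fst hf)
  obtain ⟨g₂, hg₂⟩ := h₂.desc f.2 (congrArg Prod.snd hf)
  exact ⟨(g₁, g₂), Prod.ext hg₁ hg₂⟩

end ResolutionData

end MF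

namespace MF

/-! ## Countable coproduct decompositions -/

section Decomposition

variable {A : Type u} [Category.{v} A] [Abelian A]

/-- An expression of `M` as the coproduct of a sequence of objects. -/
structure Decomposition (M : A) (X : ℕ → A) where
  ι : ∀ n, X n ⟶ M
  π : ∀ n, M ⟶ X n
  ι_π : ∀ n, ι n ≫ π n = 𝟙 (X n)
  ι_π_ne : ∀ m n, m ≠ n → ι m ≫ π n = 0
  hom_ext : ∀ {Y : A} {f g : M ⟶ Y}, (∀ n, ι n ≫ f = ι n ≫ g) → f = g
  exists_desc : ∀ {Y : A} (f : ∀ n, X n ⟶ Y), ∃ g : M ⟶ Y, ∀ n, ι n ≫ g = f n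

namespace Decomposition

variable {M : A} {X : ℕ → A} (P : Decomposition M X)

/-- The morphism out of the coproduct with the given components. -/
def desc {Y : A} (f : ∀ n, X n ⟶ Y) : M ⟶ Y := (P.exists_desc f).choose

lemma ι_desc {Y : A} (f : ∀ n, X n ⟶ Y) (n : ℕ) : P.ι n ≫ P.desc f = f n :=
  (P.exists_desc f).choose_spec n

/-- The image of a decomposition under an equivalence. -/
@[simps] def map (F : A ⥤ A) [F.IsEquivalence] : Decomposition (F.obj M) fun n => F.obj (X n) where
  ι n := F.map (P.ι n)
  π n := F.map (P.π n)
  ι_π n := by rw [← F.map_comp, P.ι_π, F.map_id]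
  ι_π_ne m n h := by
    have : F.Additive := F.additive_of_preserves_binary_products
    rw [← F.map_comp, P.ι_π_ne m n h, F.map_zero]
  hom_ext {Y f g} h := by
    -- The universal property of `M` applies only to targets in the image of `F`, so `Y` is replaced
    -- by an isomorphic object `F(Y')`.
    rw [← cancel_mono (F.objObjPreimageIso Y).inv]
    obtain ⟨f', hf'⟩ := F.map_surjective (f ≫ (F.objObjPreimageIso Y).inv)
    obtain ⟨g', hg'⟩ := F.map_surjective (g ≫ (F.objObjPreimageIso Y).inv)
    rw [← hf', ← hg']
    refine congrArg _ (P.hom_ext fun n => F.map_injective ?_)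
    rw [F.map_comp, F.map_comp, hf', hg', reassoc_of% (h n)]
  exists_desc {Y} f := by
    obtain ⟨g, hg⟩ := P.exists_desc fun n => F.preimage (f n ≫ (F.objObjPreimageIso Y).inv)
    refine ⟨F.map g ≫ (F.objObjPreimageIso Y).hom, fun n => ?_⟩
    rw [← F.map_comp_assoc, hg, F.map_preimage, Category.assoc, Iso.inv_hom_id, Category.comp_id]

/-- A sequence with a new first term. -/
def consSeq (Y : A) (X : ℕ → A) : ℕ → A
  | 0 => Y
  | n + 1 => X n

/-- The decomposition of `Y ⊕ M`. -/
def cons (Y : A) : Decomposition (Y ⊞ M) (consSeq Y X) where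
  ι
    | 0 => biprod.inl
    | n + 1 => P.ι n ≫ biprod.inr
  π
    | 0 => biprod.fst
    | n + 1 => biprod.snd ≫ P.π n
  ι_π
    | 0 => biprod.inl_fst
    | n + 1 => by
      change (P.ι n ≫ biprod.inr) ≫ biprod.snd ≫ P.π n = 𝟙 (X n)
      simpa using P.ι_π n
  ι_π_ne
    | 0, 0, h => absurd rfl h
    | 0, n + 1, _ => by
      change biprod.inl ≫ biprod.snd ≫ P.π n = 0
      simp
    | n + 1, 0, _ => by
      change (P.ι n ≫ biprod.inr) ≫ biprod.fst = 0
      simp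
    | m + 1, n + 1, h => by
      change (P.ι m ≫ biprod.inr) ≫ biprod.snd ≫ P.π n = 0
      simpa using P.ι_π_ne m n fun e => h (congrArg _ e)
  hom_ext h := biprod.hom_ext' _ _ (h 0) (P.hom_ext fun n =>
    ((Category.assoc _ _ _).symm.trans (h (n + 1))).trans (Category.assoc _ _ _))
  exists_desc f := ⟨biprod.desc (f 0) (P.desc fun n => f (n + 1)), fun
    | 0 => biprod.inl_desc _ _
    | n + 1 => (Category.assoc _ _ _).trans
      ((congrArg _ (biprod.inr_desc _ _)).trans (P.ι_desc _ n))⟩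

/-- A composition with a banded matrix, entry by entry. -/
lemma sum_comp_row {Z : A} {n : ℕ} {Y : ℕ → A} (a : ∀ r, Z ⟶ Y r) (b : ∀ r s, Y r ⟶ X s)
    (hb : ∀ r s, r + 1 < s → b r s = 0) :
    ∑ r ∈ Finset.range (n + 2), a r ≫ ∑ s ∈ Finset.range (r + 2), b r s ≫ P.ι s =
      ∑ s ∈ Finset.range (n + 3), (∑ r ∈ Finset.range (n + 2), a r ≫ b r s) ≫ P.ι s := by
  simp only [Preadditive.sum_comp, Category.assoc]
  rw [Finset.sum_comm]
  refine Finset.sum_congr rfl fun r hr => ?_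
  have := Finset.mem_range.1 hr
  rw [Preadditive.comp_sum]
  refine Finset.sum_subset (Finset.range_mono (by omega)) fun s _ hs => ?_
  rw [hb r s (by simp only [Finset.mem_range] at hs; omega), zero_comp, comp_zero]

end Decomposition

variable [HasCoproducts.{v} A]

/-- A coproduct indexed by `ℕ ⊕ ℕ`, as a coproduct of a sequence. -/
def sigmaDecomposition (X : ℕ ⊕ ℕ → A) : Decomposition (∐ X) fun n => X (idx n) where
  ι n := Sigma.ι X (idx n)
  π n := Sigma.π X (idx n)
  ι_π n := Sigma.ι_π_eq_id X (idx n)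
  ι_π_ne m n h := Sigma.ι_π_of_ne X fun e => h (idx_injective e)
  hom_ext h := Sigma.hom_ext _ _ fun q => by rw [← idx_deg q]; exact h (deg q)
  exists_desc f := ⟨Sigma.desc fun q => eqToHom (by rw [idx_deg]) ≫ f (deg q), fun n => by
    rw [Sigma.ι_desc]
    -- The identity `deg (idx n) = n` holds only propositionally, so the component must be
    -- transported along it.
    have key : ∀ m (h : m = n) (h' : X (idx n) = X (idx m)), eqToHom h' ≫ f m = f n := by
      rintro m rfl h'
      simp
    exact key _ (deg_idx n) _⟩

end Decomposition

/-! ## The folding with given components -/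

namespace ResolutionData

open Sum

variable {A : Type u} [Category.{v} A] [Abelian A] [HasCoproducts.{v} A] {Φ : A ≌ A}
  {w : Potential Φ} {E : Factorization w} (D : ResolutionData E)

/-- The decomposition of `tot⁻¹`. -/
abbrev decompNeg : Decomposition (totNeg Φ D.Rm.cocomplex D.Rz.cocomplex)
    fun n => summandNeg Φ D.Rm.cocomplex D.Rz.cocomplex (idx n) :=
  sigmaDecomposition (summandNeg Φ D.Rm.cocomplex D.Rz.cocomplex)

/-- The decomposition of `tot⁰`. -/
abbrev decompZero : Decomposition (totZero Φ D.Rm.cocomplex D.Rz.cocomplex)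
    fun n => summandZero Φ D.Rm.cocomplex D.Rz.cocomplex (idx n) :=
  sigmaDecomposition (summandZero Φ D.Rm.cocomplex D.Rz.cocomplex)

variable {D} {c : ∀ m r, (rootInv Φ).obj (D.term (idx m)) ⟶ D.term (idx r)}

variable (c) in
/-- The entries of `φ⁻¹`. -/
def entryNeg (m r : ℕ) : Φ.inverse.obj (summandZero Φ D.Rm.cocomplex D.Rz.cocomplex (idx m)) ⟶
    summandNeg Φ D.Rm.cocomplex D.Rz.cocomplex (idx r) :=
  (c m r).1

variable (c) in
/-- The entries of `φ⁰`. -/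
def entryZero (m r : ℕ) : summandNeg Φ D.Rm.cocomplex D.Rz.cocomplex (idx m) ⟶
    summandZero Φ D.Rm.cocomplex D.Rz.cocomplex (idx r) :=
  (c m r).2

/-- The first component of the square of a matrix of pairs is `φ⁰` followed by `φ⁻¹`, the second is
`φ⁻¹` followed by `φ⁰`. Hence one matrix equation contains both axioms of a factorization. -/
lemma sum_entryZero_entryNeg (m r : ℕ) :
    ∑ q ∈ Finset.range (m + 2), Φ.inverse.map (entryZero c m q) ≫ entryNeg c q r =
      (Tridiagonal.sq c m r).1 :=
  (map_sum (AddMonoidHom.fst _ _) (fun q => (rootInv Φ).map (c m q) ≫ c q r) _).symm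

lemma sum_entryNeg_entryZero (m r : ℕ) :
    ∑ q ∈ Finset.range (m + 2), entryNeg c m q ≫ entryZero c q r =
      (Tridiagonal.sq c m r).2 :=
  (map_sum (AddMonoidHom.snd _ _) (fun q => (rootInv Φ).map (c m q) ≫ c q r) _).symm

section

variable (hc : D.tridiagonal.Extends c) (hs : ∀ m r, m ≠ r → Tridiagonal.sq c m r = 0)

include hc

lemma entryNeg_eq_zero (m r : ℕ) (h : m + 1 < r) : entryNeg c m r = 0 :=
  congrArg Prod.fst (hc.eq_zero m r h)

lemma entryZero_eq_zero (m r : ℕ) (h : m + 1 < r) : entryZero c m r = 0 :=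
  congrArg Prod.snd (hc.eq_zero m r h)

lemma sum_entryZero_entryNeg_self (m : ℕ) :
    ∑ q ∈ Finset.range (m + 2), Φ.inverse.map (entryZero c m q) ≫ entryNeg c q m =
      w.invApp _ :=
  (sum_entryZero_entryNeg m m).trans (congrArg Prod.fst (hc.sq_self m))

lemma sum_entryNeg_entryZero_self (m : ℕ) :
    ∑ q ∈ Finset.range (m + 2), entryNeg c m q ≫ entryZero c q m = w.invApp _ :=
  (sum_entryNeg_entryZero m m).trans (congrArg Prod.snd (hc.sq_self m))

end

variable (c) in
/-- The structure map `φ⁻¹` with given components. -/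
def foldNeg : Φ.inverse.obj (totZero Φ D.Rm.cocomplex D.Rz.cocomplex) ⟶
    totNeg Φ D.Rm.cocomplex D.Rz.cocomplex :=
  (D.decompZero.map Φ.inverse).desc fun m =>
    ∑ r ∈ Finset.range (m + 2), entryNeg c m r ≫ D.decompNeg.ι r

variable (c) in
/-- The structure map `φ⁰` with given components. -/
def foldZero : totNeg Φ D.Rm.cocomplex D.Rz.cocomplex ⟶
    totZero Φ D.Rm.cocomplex D.Rz.cocomplex :=
  D.decompNeg.desc fun m => ∑ r ∈ Finset.range (m + 2), entryZero c m r ≫ D.decompZero.ι r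

lemma ι_foldNeg (m : ℕ) : Φ.inverse.map (D.decompZero.ι m) ≫ foldNeg c =
    ∑ r ∈ Finset.range (m + 2), entryNeg c m r ≫ D.decompNeg.ι r :=
  (D.decompZero.map Φ.inverse).ι_desc _ m

lemma ι_foldZero (m : ℕ) : D.decompNeg.ι m ≫ foldZero c =
    ∑ r ∈ Finset.range (m + 2), entryZero c m r ≫ D.decompZero.ι r :=
  D.decompNeg.ι_desc _ m

lemma foldNeg_foldZero (hc : D.tridiagonal.Extends c)
    (hs : ∀ m r, m ≠ r → Tridiagonal.sq c m r = 0) :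
    foldNeg c ≫ foldZero c = w.invApp (totZero Φ D.Rm.cocomplex D.Rz.cocomplex) := by
  refine (D.decompZero.map Φ.inverse).hom_ext fun n => ?_
  simp only [Decomposition.map_ι]
  rw [reassoc_of% ι_foldNeg, w.invApp_naturality, Preadditive.sum_comp]
  simp only [Category.assoc, ι_foldZero]
  -- The composite has the entries of the square as its components; those off the diagonal vanish
  -- and the diagonal one is `w`.
  rw [D.decompZero.sum_comp_row _ (entryZero c) (entryZero_eq_zero hc),
    Finset.sum_eq_single n (fun s _ h => by
      rw [sum_entryNeg_entryZero, hs n s h.symm]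
      exact zero_comp)
    (fun hn => absurd (Finset.mem_range.2 (by omega)) hn), sum_entryNeg_entryZero_self hc]

lemma foldZero_foldNeg (hc : D.tridiagonal.Extends c)
    (hs : ∀ m r, m ≠ r → Tridiagonal.sq c m r = 0) :
    Φ.inverse.map (foldZero c) ≫ foldNeg c =
      w.invApp (totNeg Φ D.Rm.cocomplex D.Rz.cocomplex) := by
  refine (D.decompNeg.map Φ.inverse).hom_ext fun n => ?_
  simp only [Decomposition.map_ι]
  rw [← Functor.map_comp_assoc, ι_foldZero, w.invApp_naturality, Functor.map_sum,
    Preadditive.sum_comp]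
  simp only [Functor.map_comp, Category.assoc, ι_foldNeg]
  rw [D.decompNeg.sum_comp_row _ (entryNeg c) (entryNeg_eq_zero hc),
    Finset.sum_eq_single n (fun s _ h => by
      rw [sum_entryZero_entryNeg, hs n s h.symm]
      exact zero_comp)
    (fun hn => absurd (Finset.mem_range.2 (by omega)) hn), sum_entryZero_entryNeg_self hc]

lemma sum_row_π {T : A} {X : ℕ → A} (P : Decomposition T X) {Y : A} (b : ∀ s, Y ⟶ X s) {m : ℕ}
    (hb : ∀ s, m + 1 < s → b s = 0) (n : ℕ) :
    (∑ r ∈ Finset.range (m + 2), b r ≫ P.ι r) ≫ P.π n = b n := by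
  rw [Preadditive.sum_comp]
  by_cases hn : n < m + 2
  · rw [Finset.sum_eq_single n
      (fun s _ h => by rw [Category.assoc, P.ι_π_ne s n h, comp_zero])
      (fun h => absurd (Finset.mem_range.2 hn) h), Category.assoc, P.ι_π, Category.comp_id]
  · rw [hb n (by omega)]
    refine Finset.sum_eq_zero fun s hs => ?_
    have := Finset.mem_range.1 hs
    rw [Category.assoc, P.ι_π_ne s n (by omega), comp_zero]

lemma ι_foldNeg_π (hc : D.tridiagonal.Extends c) (m n : ℕ) :
    Φ.inverse.map (D.decompZero.ι m) ≫ foldNeg c ≫ D.decompNeg.π n = entryNeg c m n := by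
  rw [reassoc_of% ι_foldNeg]
  exact sum_row_π D.decompNeg (entryNeg c m) (entryNeg_eq_zero hc m) n

lemma ι_foldZero_π (hc : D.tridiagonal.Extends c) (m n : ℕ) :
    D.decompNeg.ι m ≫ foldZero c ≫ D.decompZero.π n = entryZero c m n := by
  rw [reassoc_of% ι_foldZero]
  exact sum_row_π D.decompZero (entryZero c m) (entryZero_eq_zero hc m) n

lemma compNeg_foldNeg (hc : D.tridiagonal.Extends c) (m n : ℕ) :
    compNeg (foldNeg c) (idx m) (idx n) = (summandInvZeroIso Φ _ _ (idx m)).hom ≫ (c m n).1 :=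
  congrArg _ (ι_foldNeg_π hc m n)

lemma compZero_foldZero (hc : D.tridiagonal.Extends c) (m n : ℕ) :
    compZero (foldZero c) (idx m) (idx n) = (c m n).2 :=
  ι_foldZero_π hc m n

section

variable (hc : D.tridiagonal.Extends c)

include hc

lemma compNeg_up (p : ℕ ⊕ ℕ) : compNeg (foldNeg c) p (nxt p) =
    (summandInvZeroIso Φ _ _ p).hom ≫ (D.up p).1 := by
  obtain ⟨n, rfl⟩ : ∃ n, idx n = p := ⟨_, idx_deg p⟩
  exact (compNeg_foldNeg hc n (n + 1)).trans (congrArg (fun f => _ ≫ Prod.fst f) (hc.up n))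

lemma compNeg_diag (p : ℕ ⊕ ℕ) : compNeg (foldNeg c) p p =
    (summandInvZeroIso Φ _ _ p).hom ≫ (D.diag p).1 := by
  obtain ⟨n, rfl⟩ : ∃ n, idx n = p := ⟨_, idx_deg p⟩
  exact (compNeg_foldNeg hc n n).trans (congrArg (fun f => _ ≫ Prod.fst f) (hc.diag n))

lemma compNeg_down (p : ℕ ⊕ ℕ) : compNeg (foldNeg c) (nxt p) p =
    (summandInvZeroIso Φ _ _ (nxt p)).hom ≫ (D.down p).1 := by
  obtain ⟨n, rfl⟩ : ∃ n, idx n = p := ⟨_, idx_deg p⟩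
  exact (compNeg_foldNeg hc (n + 1) n).trans (congrArg (fun f => _ ≫ Prod.fst f) (hc.down n))

lemma compZero_up (p : ℕ ⊕ ℕ) : compZero (foldZero c) p (nxt p) = (D.up p).2 := by
  obtain ⟨n, rfl⟩ : ∃ n, idx n = p := ⟨_, idx_deg p⟩
  exact (compZero_foldZero hc n (n + 1)).trans (congrArg Prod.snd (hc.up n))

lemma compZero_diag (p : ℕ ⊕ ℕ) : compZero (foldZero c) p p = (D.diag p).2 := by
  obtain ⟨n, rfl⟩ : ∃ n, idx n = p := ⟨_, idx_deg p⟩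
  exact (compZero_foldZero hc n n).trans (congrArg Prod.snd (hc.diag n))

lemma compZero_down (p : ℕ ⊕ ℕ) : compZero (foldZero c) (nxt p) p = (D.down p).2 := by
  obtain ⟨n, rfl⟩ : ∃ n, idx n = p := ⟨_, idx_deg p⟩
  exact (compZero_foldZero hc (n + 1) n).trans (congrArg Prod.snd (hc.down n))

lemma compNeg_eq_zero (p q : ℕ ⊕ ℕ) (h : deg p + 1 < deg q) : compNeg (foldNeg c) p q = 0 := by
  obtain ⟨m, rfl⟩ : ∃ n, idx n = p := ⟨_, idx_deg p⟩
  obtain ⟨n, rfl⟩ : ∃ n, idx n = q := ⟨_, idx_deg q⟩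
  rw [deg_idx, deg_idx] at h
  exact (compNeg_foldNeg hc m n).trans
    ((congrArg (fun f => _ ≫ Prod.fst f) (hc.eq_zero m n h)).trans comp_zero)

lemma compZero_eq_zero (p q : ℕ ⊕ ℕ) (h : deg p + 1 < deg q) : compZero (foldZero c) p q = 0 := by
  obtain ⟨m, rfl⟩ : ∃ n, idx n = p := ⟨_, idx_deg p⟩
  obtain ⟨n, rfl⟩ : ∃ n, idx n = q := ⟨_, idx_deg q⟩
  rw [deg_idx, deg_idx] at h
  exact (compZero_foldZero hc m n).trans (congrArg Prod.snd (hc.eq_zero m n h))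

end

lemma negPowComm_negPowSucc (n : ℕ) {X Y : A} (f : (negPow Φ n).obj (Φ.inverse.obj X) ⟶ Y) :
    ((negPowComm Φ n).app X).hom ≫ (negPowSucc Φ n X).hom ≫ f = f :=
  ((negPowComm Φ n).app X).hom_inv_id_assoc f

/-- The folding with given components. -/
def folding (hc : D.tridiagonal.Extends c) (hs : ∀ m r, m ≠ r → Tridiagonal.sq c m r = 0) :
    Folding w D.Rm.cocomplex D.Rz.cocomplex where
  φneg := foldNeg c
  φzero := foldZero c
  φneg_φzero := foldNeg_foldZero hc hs
  φzero_φneg := (factorization_aux w _ _).2 (foldZero_foldNeg hc hs)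
  compNeg_eq_zero := compNeg_eq_zero hc
  compZero_eq_zero := compZero_eq_zero hc
  compNeg_odd l := (compNeg_up hc (inr l)).trans (negPowComm_negPowSucc _ _)
  compNeg_even l := ((compNeg_up hc (inl l)).trans (negPowComm_negPowSucc _ _)).trans
    (Functor.map_neg _)
  compZero_odd l := (compZero_up hc (inr l)).trans
    (show (negPow Φ (l + 1)).map (-D.Rz.cocomplex.d _ _) = _ from Functor.map_neg _)
  compZero_even l := compZero_up hc (inl l)

lemma aug_up {X : A} (R : InjectiveResolution X) : aug R ≫ R.cocomplex.d 0 1 = 0 :=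
  (exactAt_aug R).1

lemma negPowSucc_zero_comp {X Y : A} (f : Φ.inverse.obj X ⟶ Y) :
    (negPowSucc Φ 0 X).hom ≫ f = f := by
  have h : (negPowSucc Φ 0 X).hom = 𝟙 (Φ.inverse.obj X) := Category.id_comp (𝟙 (Φ.inverse.obj X))
  exact (congrArg (fun k => k ≫ f) h).trans (Category.id_comp f)

variable (D) in
/-- The coaugmentation of the resolution of `E⁻¹`, with values in the first summand. -/
def augNeg : E.neg ⟶ summandNeg Φ D.Rm.cocomplex D.Rz.cocomplex (idx 0) := aug D.Rm

variable (D) in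
/-- The coaugmentation of the resolution of `E⁰`, with values in the first summand. -/
def augZero : E.zero ⟶ summandZero Φ D.Rm.cocomplex D.Rz.cocomplex (idx 0) := aug D.Rz

section

variable (hc : D.tridiagonal.Extends c)

include hc

lemma aug_entryNeg_zero : Φ.inverse.map D.augZero ≫ entryNeg c 0 0 = E.φneg ≫ D.augNeg := by
  have h : entryNeg c 0 0 = D.liftNeg 0 :=
    (congrArg Prod.fst (hc.diag 0)).trans (negPowSucc_zero_comp (D.liftNeg 0))
  rw [h]
  exact D.aug_liftNeg

lemma aug_entryNeg_one : Φ.inverse.map D.augZero ≫ entryNeg c 0 1 = 0 := by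
  have h : entryNeg c 0 1 = Φ.inverse.map (-D.Rz.cocomplex.d 0 1) :=
    (congrArg Prod.fst (hc.up 0)).trans
      (negPowSucc_zero_comp (Φ.inverse.map (-D.Rz.cocomplex.d 0 1)))
  have h' : Φ.inverse.map (aug D.Rz) ≫ Φ.inverse.map (-D.Rz.cocomplex.d 0 1) = 0 := by
    rw [← Functor.map_comp, Preadditive.comp_neg, aug_up, neg_zero, Functor.map_zero]
  rw [h]
  exact h'

lemma aug_entryZero_zero : D.augNeg ≫ entryZero c 0 0 = E.φzero ≫ D.augZero :=
  (congrArg _ (congrArg Prod.snd (hc.diag 0))).trans D.aug_liftZero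

lemma aug_entryZero_one : D.augNeg ≫ entryZero c 0 1 = 0 :=
  (congrArg _ (congrArg Prod.snd (hc.up 0))).trans (aug_up D.Rm)

/-- Row `0` has only the entries `0` and `1`. After the coaugmentation the first is the
compatibility of the lift with `φ⁻¹_E`, and the second is zero since the differential kills the
coaugmentation. -/
lemma aug_foldNeg : Φ.inverse.map (D.augZero ≫ D.decompZero.ι 0) ≫ foldNeg c =
    E.φneg ≫ D.augNeg ≫ D.decompNeg.ι 0 := by
  rw [Functor.map_comp, Category.assoc, ι_foldNeg, Finset.sum_range_succ, Finset.sum_range_one,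
    Preadditive.comp_add, reassoc_of% (aug_entryNeg_zero hc), reassoc_of% (aug_entryNeg_one hc),
    zero_comp,
    add_zero]

lemma aug_foldZero : (D.augNeg ≫ D.decompNeg.ι 0) ≫ foldZero c =
    E.φzero ≫ D.augZero ≫ D.decompZero.ι 0 := by
  rw [Category.assoc, ι_foldZero, Finset.sum_range_succ, Finset.sum_range_one,
    Preadditive.comp_add, reassoc_of% (aug_entryZero_zero hc), reassoc_of% (aug_entryZero_one hc),
    zero_comp,
    add_zero]

end

/-- The morphism from `E` to the folding. -/
def toFolding (hc : D.tridiagonal.Extends c) (hs : ∀ m r, m ≠ r → Tridiagonal.sq c m r = 0) :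
    E ⟶ (folding hc hs).toFactorization :=
  (⟨D.augNeg ≫ D.decompNeg.ι 0, D.augZero ≫ D.decompZero.ι 0, (aug_foldNeg hc).symm,
    (aug_foldZero hc).symm⟩ : Factorization.Hom E (folding hc hs).toFactorization)

end ResolutionData

end MF

namespace MF

/-! ## Thick subcategories and exact sequences of factorizations -/

section

variable {A : Type u} [Category.{v} A] [Abelian A] {Φ : A ≌ A} {w : Potential Φ}

namespace Factorization

/-- The transpose `E⁰ ⟶ Φ(E⁻¹)` of `φ⁻¹`. -/
def φsharp (E : Factorization w) : E.zero ⟶ Φ.functor.obj E.neg :=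
  Φ.counitIso.inv.app E.zero ≫ Φ.functor.map E.φneg

lemma φzero_φsharp (E : Factorization w) : E.φzero ≫ E.φsharp = w.app E.neg := E.φzero_φneg

lemma inverse_map_φzero_φneg (E : Factorization w) :
    Φ.inverse.map E.φzero ≫ E.φneg = w.invApp E.neg :=
  (factorization_aux w _ _).1 E.φzero_φneg

lemma inverse_map_φsharp (E : Factorization w) :
    Φ.inverse.map E.φsharp ≫ Φ.unitIso.inv.app E.neg = E.φneg := by
  rw [φsharp, Functor.map_comp, Category.assoc, transpose_aux]

lemma φsharp_naturality {E F : Factorization w} (g : E ⟶ F) :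
    E.φsharp ≫ Φ.functor.map g.neg = g.zero ≫ F.φsharp := by
  have h := Φ.counitIso.inv.naturality g.zero
  dsimp at h
  rw [φsharp, φsharp, Category.assoc, ← Functor.map_comp, g.comm_neg, Functor.map_comp,
    reassoc_of% h]

/-- A degreewise split short exact sequence of factorizations. -/
structure SplitSequence {L M N : Factorization w} (i : L ⟶ M) (q : M ⟶ N) where
  ρneg : M.neg ⟶ L.neg
  ρzero : M.zero ⟶ L.zero
  σneg : N.neg ⟶ M.neg
  σzero : N.zero ⟶ M.zero
  i_ρneg : i.neg ≫ ρneg = 𝟙 _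
  i_ρzero : i.zero ≫ ρzero = 𝟙 _
  σ_ρneg : σneg ≫ ρneg = 0
  σ_ρzero : σzero ≫ ρzero = 0
  σ_qneg : σneg ≫ q.neg = 𝟙 _
  σ_qzero : σzero ≫ q.zero = 𝟙 _
  id_neg : ρneg ≫ i.neg + q.neg ≫ σneg = 𝟙 _
  id_zero : ρzero ≫ i.zero + q.zero ≫ σzero = 𝟙 _

namespace SplitSequence

variable {L M N : Factorization w} {i : L ⟶ M} {q : M ⟶ N} (s : SplitSequence i q)

include s

/-- Inserting the decomposition of the identity of `M` between `i` and `q` gives iq + iq = iq. -/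
lemma i_q : i ≫ q = 0 := by
  have h1 := s.i_ρneg =≫ i.neg
  have h2 := s.i_ρzero =≫ i.zero
  have e1 := i.neg ≫= s.id_neg =≫ q.neg
  have e2 := i.zero ≫= s.id_zero =≫ q.zero
  simp only [Category.assoc, Preadditive.add_comp, Preadditive.comp_add, s.σ_qneg, s.σ_qzero,
    Category.comp_id, Category.id_comp, reassoc_of% s.i_ρneg, reassoc_of% s.i_ρzero] at e1 e2
  exact hom_ext (by simpa using e1) (by simpa using e2)

/-- Inserting the splitting before `φ⁰` shows that it is triangular: on the part `L` it is `φ⁰_L`,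
and the other term `σ ≫ φ⁰ ≫ ρ` is one component of the extension class N → L[1]. -/
lemma φzero_ρzero : M.φzero ≫ s.ρzero = s.ρneg ≫ L.φzero + q.neg ≫ s.σneg ≫ M.φzero ≫ s.ρzero := by
  have h := (s.id_neg =≫ M.φzero) =≫ s.ρzero
  simp only [Preadditive.add_comp, Category.assoc, Category.id_comp] at h
  refine h.symm.trans ?_
  rw [← reassoc_of% i.comm_zero, s.i_ρzero, Category.comp_id]

lemma φsharp_ρneg : M.φsharp ≫ Φ.functor.map s.ρneg =
    s.ρzero ≫ L.φsharp + q.zero ≫ s.σzero ≫ M.φsharp ≫ Φ.functor.map s.ρneg := by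
  have h := (s.id_zero =≫ M.φsharp) =≫ Φ.functor.map s.ρneg
  simp only [Preadditive.add_comp, Category.assoc, Category.id_comp] at h
  refine h.symm.trans ?_
  rw [← reassoc_of% φsharp_naturality, ← Functor.map_comp, s.i_ρneg, CategoryTheory.Functor.map_id,
    Category.comp_id]

/-- The component at `N⁻¹ ⟶ L⁰` of the extension class. -/
lemma σneg_comm : s.σneg ≫ M.φzero ≫ s.ρzero ≫ L.φsharp =
    -(N.φzero ≫ s.σzero ≫ M.φsharp ≫ Φ.functor.map s.ρneg) := by
  have h := s.σneg ≫= M.φzero ≫= s.φsharp_ρneg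
  rw [reassoc_of% M.φzero_φsharp, ← w.naturality, reassoc_of% s.σ_ρneg, Limits.zero_comp,
    Preadditive.comp_add, Preadditive.comp_add, reassoc_of% q.comm_zero,
    reassoc_of% s.σ_qneg] at h
  exact eq_neg_of_add_eq_zero_left h.symm

/-- The off-diagonal entry of `φ⁻¹ ≫ φ⁰` vanishes because `w` is natural. Read as a relation, this
says that the off-diagonal terms satisfy the condition for a morphism N → L[1]. -/
lemma σzero_comm : Φ.inverse.map s.σzero ≫ M.φneg ≫ s.ρneg ≫ L.φzero =
    -(N.φneg ≫ s.σneg ≫ M.φzero ≫ s.ρzero) := by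
  have h := Φ.inverse.map s.σzero ≫= M.φneg ≫= s.φzero_ρzero
  rw [reassoc_of% M.φneg_φzero, ← w.invApp_naturality, ← Functor.map_comp_assoc, s.σ_ρzero,
    Functor.map_zero, Limits.zero_comp, Preadditive.comp_add, Preadditive.comp_add,
    reassoc_of% q.comm_neg, ← Functor.map_comp_assoc, s.σ_qzero, CategoryTheory.Functor.map_id,
    Category.id_comp] at h
  exact eq_neg_of_add_eq_zero_left h.symm

end SplitSequence

/-- Morphisms out of `Φ⁻¹` of a biproduct are determined by their restrictions. -/
lemma inverse_biprod_hom_ext {X Y Z : A} {f g : Φ.inverse.obj (X ⊞ Y) ⟶ Z}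
    (hl : Φ.inverse.map biprod.inl ≫ f = Φ.inverse.map biprod.inl ≫ g)
    (hr : Φ.inverse.map biprod.inr ≫ f = Φ.inverse.map biprod.inr ≫ g) : f = g := by
  have := (Φ.inverse.map_id (X ⊞ Y)).symm.trans
    (congrArg Φ.inverse.map (biprod.total (X := X) (Y := Y)).symm)
  rw [← Category.id_comp f, ← Category.id_comp g, this, Functor.map_add, Functor.map_comp,
    Functor.map_comp, Preadditive.add_comp, Preadditive.add_comp, Category.assoc,
    Category.assoc, hl, hr, Category.assoc, Category.assoc]

section cone

variable {E F : Factorization w} (g : E ⟶ F)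

/-- The structure map `φ⁻¹` of the cone of `g`. -/
def coneφneg : Φ.inverse.obj (Φ.functor.obj E.neg ⊞ F.zero) ⟶ E.zero ⊞ F.neg := (cone g).φneg

/-- The structure map `φ⁰` of the cone of `g`. -/
def coneφzero : E.zero ⊞ F.neg ⟶ Φ.functor.obj E.neg ⊞ F.zero := (cone g).φzero

lemma inl_coneφneg : Φ.inverse.map biprod.inl ≫ coneφneg g =
    (Φ.unitIso.inv.app E.neg : Φ.inverse.obj (Φ.functor.obj E.neg) ⟶ E.neg) ≫
      (-(E.φzero ≫ biprod.inl) + g.neg ≫ biprod.inr) := by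
  have h1 : Φ.inverse.map (biprod.inl : Φ.functor.obj E.neg ⟶ Φ.functor.obj E.neg ⊞ F.zero) ≫
      Φ.inverse.map biprod.fst = 𝟙 _ := by
    rw [← Functor.map_comp, biprod.inl_fst, CategoryTheory.Functor.map_id]
  have h2 : Φ.inverse.map (biprod.inl : Φ.functor.obj E.neg ⟶ Φ.functor.obj E.neg ⊞ F.zero) ≫
      Φ.inverse.map biprod.snd = 0 := by
    rw [← Functor.map_comp, biprod.inl_snd, Functor.map_zero]
  apply biprod.hom_ext
  · simp only [coneφneg, cone, Category.assoc, biprod.lift_fst, Preadditive.comp_neg,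
      reassoc_of% h1, Preadditive.comp_add, Preadditive.add_comp, Preadditive.neg_comp,
      biprod.inl_fst, biprod.inr_fst, Category.comp_id, Limits.comp_zero, _root_.add_zero]
  · simp only [coneφneg, cone, Category.assoc, biprod.lift_snd, Preadditive.comp_neg,
      reassoc_of% h1, reassoc_of% h2, Preadditive.comp_add, Preadditive.add_comp,
      Preadditive.neg_comp, biprod.inl_snd, biprod.inr_snd, Category.comp_id, Limits.comp_zero,
      Limits.zero_comp, _root_.add_zero, _root_.neg_zero, _root_.zero_add]

lemma inr_coneφneg : Φ.inverse.map biprod.inr ≫ coneφneg g = F.φneg ≫ biprod.inr := by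
  have h3 : Φ.inverse.map (biprod.inr : F.zero ⟶ Φ.functor.obj E.neg ⊞ F.zero) ≫
      Φ.inverse.map biprod.fst = 0 := by
    rw [← Functor.map_comp, biprod.inr_fst, Functor.map_zero]
  have h4 : Φ.inverse.map (biprod.inr : F.zero ⟶ Φ.functor.obj E.neg ⊞ F.zero) ≫
      Φ.inverse.map biprod.snd = 𝟙 _ := by
    rw [← Functor.map_comp, biprod.inr_snd, CategoryTheory.Functor.map_id]
  apply biprod.hom_ext
  · simp only [coneφneg, cone, Category.assoc, biprod.lift_fst, Preadditive.comp_neg,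
      reassoc_of% h3, Limits.zero_comp, biprod.inr_fst, Limits.comp_zero, _root_.neg_zero]
  · simp only [coneφneg, cone, Category.assoc, biprod.lift_snd, Preadditive.comp_add,
      reassoc_of% h3, reassoc_of% h4, Limits.zero_comp, biprod.inr_snd, Category.comp_id,
      _root_.zero_add]

lemma inl_coneφzero : biprod.inl ≫ coneφzero g =
    -(E.φsharp ≫ biprod.inl) + g.zero ≫ biprod.inr := by
  apply biprod.hom_ext <;> simp [coneφzero, cone, φsharp]

lemma inr_coneφzero : biprod.inr ≫ coneφzero g = F.φzero ≫ biprod.inr := by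
  apply biprod.hom_ext <;> simp [coneφzero, cone]

end cone

/-- A morphism to `L[1]`, in terms of the structure maps of `L`. -/
def homToShift {F L : Factorization w} (a : F.neg ⟶ L.zero) (b : F.zero ⟶ Φ.functor.obj L.neg)
    (h₁ : F.φneg ≫ a = -(Φ.inverse.map b ≫ Φ.unitIso.inv.app L.neg ≫ L.φzero))
    (h₂ : F.φzero ≫ b = -(a ≫ L.φsharp)) : F ⟶ L.shiftObj :=
  have e₁ : Φ.inverse.map b ≫ Φ.unitIso.inv.app L.neg ≫ (-L.φzero) =
      -(Φ.inverse.map b ≫ Φ.unitIso.inv.app L.neg ≫ L.φzero) := by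
    rw [Preadditive.comp_neg, Preadditive.comp_neg]
  have e₂ : a ≫ Φ.counitIso.inv.app L.zero ≫ Φ.functor.map (-L.φneg) = -(a ≫ L.φsharp) := by
    rw [φsharp, Functor.map_neg, Preadditive.comp_neg, Preadditive.comp_neg]
  (⟨a, b, h₁.trans e₁.symm, h₂.trans e₂.symm⟩ : Hom F L.shiftObj)

/-- A morphism from `L[1]`, in terms of the structure maps of `L`. -/
def homFromShift {F L : Factorization w} (a : L.zero ⟶ F.neg) (b : Φ.functor.obj L.neg ⟶ F.zero)
    (h₁ : Φ.unitIso.inv.app L.neg ≫ L.φzero ≫ a = -(Φ.inverse.map b ≫ F.φneg))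
    (h₂ : L.φsharp ≫ b = -(a ≫ F.φzero)) : L.shiftObj ⟶ F :=
  have e₁ : (Φ.unitIso.inv.app L.neg ≫ (-L.φzero)) ≫ a =
      -(Φ.unitIso.inv.app L.neg ≫ L.φzero ≫ a) := by
    rw [Preadditive.comp_neg, Preadditive.neg_comp, Category.assoc]
  have e₂ : (Φ.counitIso.inv.app L.zero ≫ Φ.functor.map (-L.φneg)) ≫ b = -(L.φsharp ≫ b) := by
    rw [φsharp, Functor.map_neg, Preadditive.comp_neg, Preadditive.neg_comp]
  (⟨a, b, e₁.trans (neg_eq_iff_eq_neg.2 h₁), e₂.trans (neg_eq_iff_eq_neg.2 h₂)⟩ :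
    Hom L.shiftObj F)

section

variable {L M N : Factorization w} {i : L ⟶ M} {q : M ⟶ N}

lemma toCone_neg (h : i ≫ q = 0) : Φ.unitIso.inv.app L.neg ≫ L.φzero ≫ i.zero ≫ biprod.inl =
    -(Φ.inverse.map (Φ.functor.map i.neg ≫ biprod.inl) ≫ coneφneg q) := by
  have e := Φ.unitIso.inv.naturality i.neg
  have hn : i.neg ≫ q.neg = 0 := congrArg Hom.neg h
  dsimp at e
  rw [Functor.map_comp, Category.assoc, inl_coneφneg, reassoc_of% e, Preadditive.comp_add,
    Preadditive.comp_neg, reassoc_of% hn, Limits.zero_comp, _root_.add_zero,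
    Preadditive.comp_neg, _root_.neg_neg, reassoc_of% i.comm_zero]

lemma toCone_zero (h : i ≫ q = 0) : L.φsharp ≫ Φ.functor.map i.neg ≫ biprod.inl =
    -((i.zero ≫ biprod.inl) ≫ coneφzero q) := by
  have hz : i.zero ≫ q.zero = 0 := congrArg Hom.zero h
  rw [Category.assoc, inl_coneφzero, Preadditive.comp_add, Preadditive.comp_neg,
    reassoc_of% hz, Limits.zero_comp, _root_.add_zero, _root_.neg_neg,
    reassoc_of% φsharp_naturality]

/-- A morphism `L[1] ⟶ cone q` for a morphism `i` with `i ≫ q = 0`. -/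
def toCone (i : L ⟶ M) (q : M ⟶ N) (h : i ≫ q = 0) : L.shiftObj ⟶ cone q :=
  homFromShift (F := cone q) (i.zero ≫ biprod.inl : L.zero ⟶ M.zero ⊞ N.neg)
    (Φ.functor.map i.neg ≫ biprod.inl : Φ.functor.obj L.neg ⟶ Φ.functor.obj M.neg ⊞ N.zero)
    (toCone_neg h) (toCone_zero h)

/-- The retraction is `ρ` on the part M[1] of the cone and the extension class on `N`. Compatibility
on the first part is `φzero_ρzero`, on the second `σzero_comm`. -/
lemma SplitSequence.fromCone_neg (s : SplitSequence i q) :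
    coneφneg q ≫ biprod.desc s.ρzero (s.σneg ≫ M.φzero ≫ s.ρzero) =
      -(Φ.inverse.map (biprod.desc (Φ.functor.map s.ρneg)
        (s.σzero ≫ M.φsharp ≫ Φ.functor.map s.ρneg)) ≫ Φ.unitIso.inv.app L.neg ≫ L.φzero) := by
  have e := Φ.unitIso.inv.naturality s.ρneg
  have e' := M.inverse_map_φsharp
  dsimp at e
  apply inverse_biprod_hom_ext
  · rw [reassoc_of% inl_coneφneg, Preadditive.comp_neg, ← Functor.map_comp_assoc, biprod.inl_desc,
      reassoc_of% e]
    simp only [Preadditive.add_comp, Preadditive.neg_comp, Category.assoc, biprod.inl_desc,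
      biprod.inr_desc]
    rw [← sub_eq_iff_eq_add.2 s.φzero_ρzero]
    simp only [Preadditive.comp_add, Preadditive.comp_neg, Preadditive.comp_sub]
    abel
  · rw [reassoc_of% inr_coneφneg, Preadditive.comp_neg, ← Functor.map_comp_assoc, biprod.inr_desc,
      biprod.inr_desc, Functor.map_comp, Functor.map_comp, Category.assoc, Category.assoc,
      reassoc_of% e, reassoc_of% e', s.σzero_comm, _root_.neg_neg]

lemma SplitSequence.fromCone_zero (s : SplitSequence i q) :
    coneφzero q ≫ biprod.desc (Φ.functor.map s.ρneg)
        (s.σzero ≫ M.φsharp ≫ Φ.functor.map s.ρneg) =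
      -(biprod.desc s.ρzero (s.σneg ≫ M.φzero ≫ s.ρzero) ≫ L.φsharp) := by
  apply biprod.hom_ext'
  · rw [reassoc_of% inl_coneφzero, Preadditive.comp_neg, biprod.inl_desc_assoc]
    simp only [Preadditive.add_comp, Preadditive.neg_comp, Category.assoc, biprod.inl_desc,
      biprod.inr_desc]
    rw [← sub_eq_iff_eq_add.2 s.φsharp_ρneg]
    abel
  · rw [reassoc_of% inr_coneφzero, Preadditive.comp_neg, biprod.inr_desc_assoc, biprod.inr_desc,
      Category.assoc, Category.assoc, s.σneg_comm, _root_.neg_neg]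

/-- The retraction `cone q ⟶ L[1]` for a degreewise split sequence. -/
def SplitSequence.fromCone (s : SplitSequence i q) : cone q ⟶ L.shiftObj :=
  homToShift (F := cone q) (biprod.desc s.ρzero (s.σneg ≫ M.φzero ≫ s.ρzero))
    (biprod.desc (Φ.functor.map s.ρneg) (s.σzero ≫ M.φsharp ≫ Φ.functor.map s.ρneg))
    s.fromCone_neg s.fromCone_zero

end

/-- The homotopy equivalence of L[1] with the cone of `q` is a strict retraction on this side, so
closure under cones and summands applies directly. -/
lemma SplitSequence.toCone_fromCone {L M N : Factorization w} {i : L ⟶ M} {q : M ⟶ N}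
    (s : SplitSequence i q) : toCone i q s.i_q ≫ s.fromCone = 𝟙 L.shiftObj := by
  refine hom_ext ?_ ?_
  · change (i.zero ≫ biprod.inl) ≫ biprod.desc _ _ = 𝟙 L.zero
    rw [Category.assoc, biprod.inl_desc, s.i_ρzero]
  · change (Φ.functor.map i.neg ≫ biprod.inl) ≫ biprod.desc _ _ = 𝟙 (Φ.functor.obj L.neg)
    rw [Category.assoc, biprod.inl_desc, ← Functor.map_comp, s.i_ρneg,
      CategoryTheory.Functor.map_id]

end Factorization

namespace IsThick

open Factorization

variable {P : ObjectProperty (KFact w)} (hP : IsThick P)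

include hP

lemma of_iso {E F : Factorization w} (e : E ≅ F) (h : P ((toK w).obj E)) : P ((toK w).obj F) :=
  hP.iso.of_iso ((toK w).mapIso e) h

lemma of_retract {E F : Factorization w} (i : E ⟶ F) (r : F ⟶ E) (h : i ≫ r = 𝟙 E)
    (hF : P ((toK w).obj F)) : P ((toK w).obj E) :=
  hP.retract.of_retract (Retract.map ⟨i, r, h⟩ (toK w)) hF

lemma of_shift {E : Factorization w} (h : P ((toK w).obj E.shiftObj)) : P ((toK w).obj E) :=
  hP.of_iso ((shiftUnshiftIso w).app E) (hP.unshift _ h)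

lemma of_split {L M N : Factorization w} {i : L ⟶ M} {q : M ⟶ N} (s : SplitSequence i q)
    (hM : P ((toK w).obj M)) (hN : P ((toK w).obj N)) : P ((toK w).obj L) :=
  hP.of_shift (hP.of_retract _ _ s.toCone_fromCone (hP.cone q hM hN))

/-- Contractible factorizations belong to every thick subcategory. -/
lemma of_contractible {E : Factorization w} (h : Homotopy (𝟙 E) (0 : E ⟶ E)) :
    P ((toK w).obj E) := by
  refine hP.zero _ ?_
  have h1 : (toK w).map (𝟙 E) = (toK w).map (0 : E ⟶ E) := CategoryTheory.Quotient.sound _ ⟨h⟩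
  rw [CategoryTheory.Functor.map_id] at h1
  -- The identity is the zero morphism in the homotopy category, so every morphism out of the
  -- object, and below every morphism into it, is zero.
  have h2 : ∀ {X : KFact w} (f : (toK w).obj E ⟶ X), f = (toK w).map (0 : E ⟶ X.as) := by
    intro X f
    obtain ⟨f', rfl⟩ := (toK w).map_surjective (X := E) (Y := X.as) f
    rw [← Category.id_comp ((toK w).map f'), h1, ← Functor.map_comp, Limits.zero_comp]
  have h3 : ∀ {X : KFact w} (f : X ⟶ (toK w).obj E), f = (toK w).map (0 : X.as ⟶ E) := by
    intro X f
    obtain ⟨f', rfl⟩ := (toK w).map_surjective (X := X.as) (Y := E) f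
    rw [← Category.comp_id ((toK w).map f'), h1, ← Functor.map_comp, Limits.comp_zero]
  exact ⟨fun X => ⟨⟨⟨(toK w).map (0 : E ⟶ X.as)⟩, fun f => h2 f⟩⟩,
    fun X => ⟨⟨⟨(toK w).map (0 : X.as ⟶ E)⟩, fun f => h3 f⟩⟩⟩

end IsThick

end

end MF

/-! ### Totalizations of three-term complexes as split extensions -/

namespace MF

section

variable {A : Type u} [Category.{v} A] [Abelian A]

/-- A decomposition of `M` as a direct sum of three objects. -/
structure ThreeSum (M X Y Z : A) where
  ι₀ : X ⟶ M
  ι₁ : Y ⟶ M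
  ι₂ : Z ⟶ M
  π₀ : M ⟶ X
  π₁ : M ⟶ Y
  π₂ : M ⟶ Z
  ι₀_π₀ : ι₀ ≫ π₀ = 𝟙 X
  ι₀_π₁ : ι₀ ≫ π₁ = 0
  ι₀_π₂ : ι₀ ≫ π₂ = 0
  ι₁_π₀ : ι₁ ≫ π₀ = 0
  ι₁_π₁ : ι₁ ≫ π₁ = 𝟙 Y
  ι₁_π₂ : ι₁ ≫ π₂ = 0
  ι₂_π₀ : ι₂ ≫ π₀ = 0
  ι₂_π₁ : ι₂ ≫ π₁ = 0
  ι₂_π₂ : ι₂ ≫ π₂ = 𝟙 Z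
  total : π₀ ≫ ι₀ + π₁ ≫ ι₁ + π₂ ≫ ι₂ = 𝟙 M

namespace ThreeSum

attribute [simp] ι₀_π₀ ι₀_π₁ ι₀_π₂ ι₁_π₀ ι₁_π₁ ι₁_π₂ ι₂_π₀ ι₂_π₁ ι₂_π₂

variable {M X Y Z : A} (s : ThreeSum M X Y Z)

@[simp] lemma ι₀_π₀_assoc {W : A} (h : X ⟶ W) : s.ι₀ ≫ s.π₀ ≫ h = h := by
  rw [← Category.assoc, s.ι₀_π₀, Category.id_comp]

@[simp] lemma ι₀_π₁_assoc {W : A} (h : Y ⟶ W) : s.ι₀ ≫ s.π₁ ≫ h = 0 := by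
  rw [← Category.assoc, s.ι₀_π₁, Limits.zero_comp]

@[simp] lemma ι₁_π₀_assoc {W : A} (h : X ⟶ W) : s.ι₁ ≫ s.π₀ ≫ h = 0 := by
  rw [← Category.assoc, s.ι₁_π₀, Limits.zero_comp]

@[simp] lemma ι₁_π₁_assoc {W : A} (h : Y ⟶ W) : s.ι₁ ≫ s.π₁ ≫ h = h := by
  rw [← Category.assoc, s.ι₁_π₁, Category.id_comp]

@[simp] lemma ι₂_π₀_assoc {W : A} (h : X ⟶ W) : s.ι₂ ≫ s.π₀ ≫ h = 0 := by
  rw [← Category.assoc, s.ι₂_π₀, Limits.zero_comp]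

@[simp] lemma ι₂_π₁_assoc {W : A} (h : Y ⟶ W) : s.ι₂ ≫ s.π₁ ≫ h = 0 := by
  rw [← Category.assoc, s.ι₂_π₁, Limits.zero_comp]

include s in
lemma hom_ext {W : A} {f g : M ⟶ W} (h₀ : s.ι₀ ≫ f = s.ι₀ ≫ g) (h₁ : s.ι₁ ≫ f = s.ι₁ ≫ g)
    (h₂ : s.ι₂ ≫ f = s.ι₂ ≫ g) : f = g := by
  rw [← Category.id_comp f, ← Category.id_comp g, ← s.total]
  simp only [Preadditive.add_comp, Category.assoc, h₀, h₁, h₂]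

include s in
lemma map_hom_ext (F : A ⥤ A) [F.Additive] {W : A} {f g : F.obj M ⟶ W}
    (h₀ : F.map s.ι₀ ≫ f = F.map s.ι₀ ≫ g) (h₁ : F.map s.ι₁ ≫ f = F.map s.ι₁ ≫ g)
    (h₂ : F.map s.ι₂ ≫ f = F.map s.ι₂ ≫ g) : f = g := by
  rw [← Category.id_comp f, ← Category.id_comp g, ← F.map_id, ← s.total]
  simp only [Functor.map_add, Functor.map_comp, Preadditive.add_comp, Category.assoc, h₀, h₁, h₂]

/-- A coproduct over `ℤ` whose summands vanish outside of `{0, 1, 2}`. -/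
def ofCoproduct [HasCoproductsOfShape ℤ A] (F : ℤ → A)
    (hF : ∀ l, l ≠ 0 → l ≠ 1 → l ≠ 2 → IsZero (F l)) : ThreeSum (∐ F) (F 0) (F 1) (F 2) where
  ι₀ := Sigma.ι F 0
  ι₁ := Sigma.ι F 1
  ι₂ := Sigma.ι F 2
  π₀ := Sigma.π F 0
  π₁ := Sigma.π F 1
  π₂ := Sigma.π F 2
  ι₀_π₀ := Sigma.ι_π_eq_id F 0
  ι₀_π₁ := Sigma.ι_π_of_ne F (by decide)
  ι₀_π₂ := Sigma.ι_π_of_ne F (by decide)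
  ι₁_π₀ := Sigma.ι_π_of_ne F (by decide)
  ι₁_π₁ := Sigma.ι_π_eq_id F 1
  ι₁_π₂ := Sigma.ι_π_of_ne F (by decide)
  ι₂_π₀ := Sigma.ι_π_of_ne F (by decide)
  ι₂_π₁ := Sigma.ι_π_of_ne F (by decide)
  ι₂_π₂ := Sigma.ι_π_eq_id F 2
  total := by
    have h : ∀ a b : ℤ, a ≠ b → ∀ {W : A} (x : F b ⟶ W),
        Sigma.ι F a ≫ Sigma.π F b ≫ x = 0 := fun a b hab W x => by
      rw [← Category.assoc, Sigma.ι_π_of_ne F hab, Limits.zero_comp]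
    have h' : ∀ (a : ℤ) {W : A} (x : F a ⟶ W), Sigma.ι F a ≫ Sigma.π F a ≫ x = x :=
      fun a W x => by rw [← Category.assoc, Sigma.ι_π_eq_id, Category.id_comp]
    apply Sigma.hom_ext
    intro l
    simp only [Preadditive.comp_add, Category.comp_id]
    by_cases h0 : l = 0
    · subst h0
      rw [h', h _ _ (by decide), h _ _ (by decide), _root_.add_zero, _root_.add_zero]
    by_cases h1 : l = 1
    · subst h1
      rw [h', h _ _ (by decide), h _ _ (by decide), _root_.add_zero, _root_.zero_add]
    by_cases h2 : l = 2
    · subst h2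
      rw [h', h _ _ (by decide), h _ _ (by decide), _root_.zero_add, _root_.zero_add]
    exact (hF l h0 h1 h2).eq_of_src _ _

end ThreeSum

end

section

variable {A : Type u} [Category.{v} A] [Abelian A] {Φ : A ≌ A} {w : Potential Φ}

namespace Factorization

/-- A factorization `T` that is the totalization of `X ⟶ Y ⟶ Z`, with `X` in degree `0`. -/
structure ThreeTot {X Y Z : Factorization w} (f : X ⟶ Y) (g : Y ⟶ Z) (T : Factorization w) where
  n : ThreeSum T.neg X.neg (Φ.inverse.obj Y.zero) (Φ.inverse.obj Z.neg)
  z : ThreeSum T.zero X.zero Y.neg (Φ.inverse.obj Z.zero)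
  φzero₀ : n.ι₀ ≫ T.φzero = X.φzero ≫ z.ι₀ + f.neg ≫ z.ι₁
  φzero₁ : n.ι₁ ≫ T.φzero = -(Y.φneg ≫ z.ι₁) + Φ.inverse.map g.zero ≫ z.ι₂
  φzero₂ : n.ι₂ ≫ T.φzero = Φ.inverse.map Z.φzero ≫ z.ι₂
  φneg₀ : Φ.inverse.map z.ι₀ ≫ T.φneg = X.φneg ≫ n.ι₀ + Φ.inverse.map f.zero ≫ n.ι₁
  φneg₁ : Φ.inverse.map z.ι₁ ≫ T.φneg =
    -(Φ.inverse.map Y.φzero ≫ n.ι₁) + Φ.inverse.map g.neg ≫ n.ι₂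
  φneg₂ : Φ.inverse.map z.ι₂ ≫ T.φneg = Φ.inverse.map Z.φneg ≫ n.ι₂

namespace ThreeTot

variable {X Y Z : Factorization w} {f : X ⟶ Y} {g : Y ⟶ Z} {T : Factorization w}
  (t : ThreeTot f g T)

/-- The inclusion of `Z[-2]`. -/
def incl : Z.unshiftObj.unshiftObj ⟶ T :=
  have e₁ : -Φ.inverse.map (-Z.φneg) = Φ.inverse.map Z.φneg := by
    rw [Functor.map_neg, _root_.neg_neg]
  have e₂ : - -Φ.inverse.map Z.φzero = Φ.inverse.map Z.φzero := _root_.neg_neg _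
  (⟨t.n.ι₂, t.z.ι₂, (congrArg (· ≫ t.n.ι₂) e₁).trans t.φneg₂.symm,
    (congrArg (· ≫ t.z.ι₂) e₂).trans t.φzero₂.symm⟩ : Hom Z.unshiftObj.unshiftObj T)

/-- The map `φ⁻¹` of the cone of `f[-1]`. -/
def midNeg (f : X ⟶ Y) : Φ.inverse.obj (Φ.functor.obj (Φ.inverse.obj X.zero) ⊞ Y.neg) ⟶
    X.neg ⊞ Φ.inverse.obj Y.zero := coneφneg ((unshift w).map f)

/-- The map `φ⁰` of the cone of `f[-1]`. -/
def midZero (f : X ⟶ Y) : X.neg ⊞ Φ.inverse.obj Y.zero ⟶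
    Φ.functor.obj (Φ.inverse.obj X.zero) ⊞ Y.neg := coneφzero ((unshift w).map f)

lemma inl_midNeg : Φ.inverse.map biprod.inl ≫ midNeg f =
    Φ.unitIso.inv.app (Φ.inverse.obj X.zero) ≫
      (X.φneg ≫ biprod.inl + Φ.inverse.map f.zero ≫ biprod.inr) := by
  have h : Φ.inverse.map biprod.inl ≫ midNeg f = Φ.unitIso.inv.app (Φ.inverse.obj X.zero) ≫
      (-((-X.φneg) ≫ biprod.inl) + Φ.inverse.map f.zero ≫ biprod.inr) :=
    inl_coneφneg ((unshift w).map f)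
  rw [h, Preadditive.neg_comp, _root_.neg_neg]

lemma inr_midNeg : Φ.inverse.map biprod.inr ≫ midNeg f =
    -(Φ.inverse.map Y.φzero ≫ biprod.inr) := by
  have h : Φ.inverse.map biprod.inr ≫ midNeg f = (-Φ.inverse.map Y.φzero) ≫ biprod.inr :=
    inr_coneφneg ((unshift w).map f)
  rw [h, Preadditive.neg_comp]

lemma inl_midZero : biprod.inl ≫ midZero f =
    X.φzero ≫ Φ.counitIso.inv.app X.zero ≫ biprod.inl + f.neg ≫ biprod.inr := by
  have h : biprod.inl ≫ midZero f = -(((Φ.counitIso.inv.app X.neg ≫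
      Φ.functor.map (-Φ.inverse.map X.φzero) : X.neg ⟶ Φ.functor.obj (Φ.inverse.obj X.zero))) ≫
        biprod.inl) + f.neg ≫ biprod.inr :=
    inl_coneφzero ((unshift w).map f)
  have e := Φ.counitIso.inv.naturality X.φzero
  dsimp at e
  rw [h, Functor.map_neg, Preadditive.comp_neg, Preadditive.neg_comp, _root_.neg_neg, ← e,
    Category.assoc]
  rfl

lemma inr_midZero : biprod.inr ≫ midZero f = -(Y.φneg ≫ biprod.inr) := by
  have h : biprod.inr ≫ midZero f = (-Y.φneg) ≫ biprod.inr :=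
    inr_coneφzero ((unshift w).map f)
  rw [h, Preadditive.neg_comp]

lemma proj_comm_neg : T.φneg ≫ (t.n.π₀ ≫ biprod.inl + t.n.π₁ ≫ biprod.inr) =
    Φ.inverse.map (t.z.π₀ ≫ Φ.counitIso.inv.app X.zero ≫ biprod.inl + t.z.π₁ ≫ biprod.inr) ≫
      midNeg f := by
  have h3 := Φ.inverse_counitInv_comp X.zero
  -- Precomposing with an arbitrary `x` allows the right-hand side to be evaluated on each of the
  -- three summands.
  have hm : ∀ {W : A} (x : W ⟶ T.zero), Φ.inverse.map x ≫ Φ.inverse.map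
      (t.z.π₀ ≫ Φ.counitIso.inv.app X.zero ≫ biprod.inl + t.z.π₁ ≫ biprod.inr) ≫ midNeg f =
      Φ.inverse.map (x ≫ t.z.π₀) ≫ (X.φneg ≫ biprod.inl + Φ.inverse.map f.zero ≫ biprod.inr) -
        Φ.inverse.map (x ≫ t.z.π₁) ≫ Φ.inverse.map Y.φzero ≫ biprod.inr := by
    intro W x
    rw [Functor.map_add, Preadditive.add_comp, Preadditive.comp_add]
    simp only [Functor.map_comp, Category.assoc]
    rw [inl_midNeg, inr_midNeg, reassoc_of% h3]
    simp only [Preadditive.comp_neg, sub_eq_add_neg]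
  apply t.z.map_hom_ext Φ.inverse
  · rw [hm, reassoc_of% t.φneg₀]
    simp
  · rw [hm, reassoc_of% t.φneg₁]
    simp
  · rw [hm, reassoc_of% t.φneg₂]
    simp

lemma proj_comm_zero : T.φzero ≫
      (t.z.π₀ ≫ Φ.counitIso.inv.app X.zero ≫ biprod.inl + t.z.π₁ ≫ biprod.inr) =
    (t.n.π₀ ≫ biprod.inl + t.n.π₁ ≫ biprod.inr) ≫ midZero f := by
  apply t.n.hom_ext
  · rw [reassoc_of% t.φzero₀]
    simp [inl_midZero]
  · rw [reassoc_of% t.φzero₁]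
    simp [inr_midZero]
  · rw [reassoc_of% t.φzero₂]
    simp

/-- The projection to the cone of `f[-1]`. -/
def proj : T ⟶ cone ((unshift w).map f) :=
  (⟨t.n.π₀ ≫ biprod.inl + t.n.π₁ ≫ biprod.inr,
    t.z.π₀ ≫ Φ.counitIso.inv.app X.zero ≫ biprod.inl + t.z.π₁ ≫ biprod.inr,
    t.proj_comm_neg, t.proj_comm_zero⟩ : Hom T (cone ((unshift w).map f)))

lemma id_neg : t.n.π₂ ≫ t.n.ι₂ +
    (t.n.π₀ ≫ biprod.inl + t.n.π₁ ≫ biprod.inr) ≫ biprod.desc t.n.ι₀ t.n.ι₁ = 𝟙 T.neg := by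
  rw [← t.n.total]
  simp
  abel

lemma id_zero : t.z.π₂ ≫ t.z.ι₂ +
    (t.z.π₀ ≫ Φ.counitIso.inv.app X.zero ≫ biprod.inl + t.z.π₁ ≫ biprod.inr) ≫
      biprod.desc (Φ.counitIso.hom.app X.zero ≫ t.z.ι₀) t.z.ι₁ = 𝟙 T.zero := by
  rw [← t.z.total]
  simp
  abel

/-- The totalization of a three-term complex as a degreewise split extension. -/
def splitSequence : SplitSequence t.incl t.proj where
  ρneg := t.n.π₂
  ρzero := t.z.π₂
  σneg := (biprod.desc t.n.ι₀ t.n.ι₁ : X.neg ⊞ Φ.inverse.obj Y.zero ⟶ T.neg)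
  σzero := (biprod.desc (Φ.counitIso.hom.app X.zero ≫ t.z.ι₀) t.z.ι₁ :
    Φ.functor.obj (Φ.inverse.obj X.zero) ⊞ Y.neg ⟶ T.zero)
  i_ρneg := t.n.ι₂_π₂
  i_ρzero := t.z.ι₂_π₂
  σ_ρneg := by
    have : biprod.desc t.n.ι₀ t.n.ι₁ ≫ t.n.π₂ = 0 := by apply biprod.hom_ext' <;> simp
    exact this
  σ_ρzero := by
    have : biprod.desc (Φ.counitIso.hom.app X.zero ≫ t.z.ι₀) t.z.ι₁ ≫ t.z.π₂ = 0 := by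
      apply biprod.hom_ext' <;> simp
    exact this
  σ_qneg := by
    have : biprod.desc t.n.ι₀ t.n.ι₁ ≫ (t.n.π₀ ≫ biprod.inl + t.n.π₁ ≫ biprod.inr) = 𝟙 _ := by
      apply biprod.hom_ext' <;> simp
    exact this
  σ_qzero := by
    have : biprod.desc (Φ.counitIso.hom.app X.zero ≫ t.z.ι₀) t.z.ι₁ ≫
        (t.z.π₀ ≫ Φ.counitIso.inv.app X.zero ≫ biprod.inl + t.z.π₁ ≫ biprod.inr) = 𝟙 _ := by
      apply biprod.hom_ext' <;> simp
    exact this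
  id_neg := t.id_neg
  id_zero := t.id_zero

end ThreeTot

/-- The retraction of `E[-1][1]` onto `E`. -/
lemma exists_retract_shift_unshift (E : Factorization w) :
    ∃ (i : E ⟶ E.unshiftObj.shiftObj) (r : E.unshiftObj.shiftObj ⟶ E), i ≫ r = 𝟙 E := by
  have h3 := Φ.inverse_counitInv_comp E.zero
  have h4 := Φ.unitInv_app_inverse E.zero
  have e := Φ.counitIso.inv.naturality E.φzero
  have e' := Φ.counitIso.hom.naturality E.φzero
  dsimp at e e'
  have a₁ : E.φneg ≫ 𝟙 E.neg = -(Φ.inverse.map (Φ.counitIso.inv.app E.zero) ≫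
      Φ.unitIso.inv.app (Φ.inverse.obj E.zero) ≫ (-E.φneg)) := by
    rw [Preadditive.comp_neg, Preadditive.comp_neg, _root_.neg_neg, reassoc_of% h3,
      Category.comp_id]
  have a₂ : E.φzero ≫ Φ.counitIso.inv.app E.zero = -(𝟙 E.neg ≫ Φ.counitIso.inv.app E.neg ≫
      Φ.functor.map (-Φ.inverse.map E.φzero)) := by
    rw [Functor.map_neg, Preadditive.comp_neg, Preadditive.comp_neg, _root_.neg_neg,
      Category.id_comp, e]
  have b₁ : Φ.unitIso.inv.app (Φ.inverse.obj E.zero) ≫ (-E.φneg) ≫ 𝟙 E.neg =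
      -(Φ.inverse.map (Φ.counitIso.hom.app E.zero) ≫ E.φneg) := by
    rw [Category.comp_id, Preadditive.comp_neg, h4]
  have b₂ : (Φ.counitIso.inv.app E.neg ≫ Φ.functor.map (-Φ.inverse.map E.φzero)) ≫
      Φ.counitIso.hom.app E.zero = -(𝟙 E.neg ≫ E.φzero) := by
    rw [Functor.map_neg, Preadditive.comp_neg, Preadditive.neg_comp, Category.assoc, e',
      Iso.inv_hom_id_app_assoc, Category.id_comp]
  exact ⟨homToShift (L := E.unshiftObj) (𝟙 E.neg) (Φ.counitIso.inv.app E.zero) a₁ a₂,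
    homFromShift (L := E.unshiftObj) (𝟙 E.neg) (Φ.counitIso.hom.app E.zero) b₁ b₂,
    hom_ext (Category.comp_id (𝟙 E.neg)) (Φ.counitIso.inv_hom_id_app E.zero)⟩

end Factorization

namespace IsThick

open Factorization

variable {P : ObjectProperty (KFact w)} (hP : IsThick P)

include hP

lemma of_unshift {E : Factorization w} (h : P ((toK w).obj E.unshiftObj)) :
    P ((toK w).obj E) := by
  obtain ⟨i, r, hir⟩ := exists_retract_shift_unshift E
  exact hP.of_retract i r hir (hP.shift _ h)

/-- There is a degreewise split sequence from Z[-2] to `T` to the cone of f[-1]. The cone is in `P`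
with `X` and `Y`, so Z[-2] is in `P`, and hence `Z`. -/
lemma of_threeTot {X Y Z T : Factorization w} {f : X ⟶ Y} {g : Y ⟶ Z} (t : ThreeTot f g T)
    (hT : P ((toK w).obj T)) (hX : P ((toK w).obj X)) (hY : P ((toK w).obj Y)) :
    P ((toK w).obj Z) :=
  hP.of_unshift (hP.of_unshift (hP.of_split t.splitSequence hT
    (hP.cone _ (hP.unshift _ hX) (hP.unshift _ hY))))

end IsThick

end

end MF

/-! ### Short exact sequences of factorizations and thick subcategories -/

namespace MF

section

variable {A : Type u} [Category.{v} A] [Abelian A] {Φ : A ≌ A} {w : Potential Φ}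

namespace Factorization

open scoped ZeroObject in
/-- The zero factorization. -/
def zeroObj (w : Potential Φ) : Factorization w where
  neg := 0
  zero := 0
  φneg := 0
  φzero := 0
  φneg_φzero := (isZero_zero A).eq_of_tgt _ _
  φzero_φneg := (isZero_zero A).eq_of_src _ _

lemma isZero_of_components {E : Factorization w} (hn : IsZero E.neg) (hz : IsZero E.zero) :
    IsZero E :=
  ⟨fun _ => ⟨⟨⟨0⟩, fun _ => hom_ext (hn.eq_of_src _ _) (hz.eq_of_src _ _)⟩⟩,
    fun _ => ⟨⟨⟨0⟩, fun _ => hom_ext (hn.eq_of_tgt _ _) (hz.eq_of_tgt _ _)⟩⟩⟩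

lemma isZero_zeroObj : IsZero (zeroObj w) :=
  isZero_of_components (isZero_zero A) (isZero_zero A)

/-- Short exact sequences of factorizations, componentwise. -/
structure ShortExact {X Y Z : Factorization w} (f : X ⟶ Y) (g : Y ⟶ Z) : Prop where
  mono_neg : Mono f.neg
  mono_zero : Mono f.zero
  exact_neg : ExactAt f.neg g.neg
  exact_zero : ExactAt f.zero g.zero
  epi_neg : Epi g.neg
  epi_zero : Epi g.zero

lemma exactAt_components {K : CochainComplex (Factorization w) ℤ} (F : Factorization w ⥤ A)
    [F.Additive] (h : ∀ n : ℤ, ExactAt (F.map (K.d n (n + 1))) (F.map (K.d (n + 1) (n + 1 + 1)))) :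
    ((F.mapHomologicalComplex (ComplexShape.up ℤ)).obj K).Acyclic := by
  intro i
  obtain ⟨n, rfl⟩ : ∃ n, i = n + 1 := ⟨i - 1, by ring⟩
  rw [HomologicalComplex.exactAt_iff' _ n (n + 1) (n + 1 + 1) (by simp) (by simp)]
  exact (h n).2

lemma neg_inverse_map_neg {X Y : A} (f : X ⟶ Y) : -Φ.inverse.map (-f) = Φ.inverse.map f := by
  rw [Functor.map_neg, _root_.neg_neg]

section

variable {M W X Y : A} {e : M ⟶ W} {a a' : M ⟶ X} {b b' : M ⟶ Y} {i : X ⟶ W} {j : Y ⟶ W}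

lemma eq_add_of_eq (h : e = a ≫ i + b ≫ j) (ha : a = a') (hb : b = b') :
    e = a' ≫ i + b' ≫ j := by
  rw [h, ha, hb]

lemma eq_neg_add_of_eq (h : e = a ≫ i + b ≫ j) (ha : a = -a') (hb : b = b') :
    e = -(a' ≫ i) + b' ≫ j := by
  rw [h, ha, hb, Preadditive.neg_comp]

lemma eq_comp_of_eq (h : e = a ≫ i + b ≫ j) (ha : a = a') (hb : b = 0) : e = a' ≫ i := by
  rw [h, ha, hb, Limits.zero_comp, _root_.add_zero]

end

section threeTerm

variable {X Y Z : Factorization w} (f : X ⟶ Y) (g : Y ⟶ Z)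

/-- The objects of the complex `X ⟶ Y ⟶ Z`. -/
def threeObj (X Y Z : Factorization w) : ℤ → Factorization w
  | .ofNat 0 => X
  | .ofNat 1 => Y
  | .ofNat 2 => Z
  | .ofNat (_ + 3) => zeroObj w
  | .negSucc _ => zeroObj w

/-- The differentials of the complex `X ⟶ Y ⟶ Z`. -/
def threeD : ∀ n : ℤ, threeObj X Y Z n ⟶ threeObj X Y Z (n + 1)
  | .ofNat 0 => f
  | .ofNat 1 => g
  | .ofNat (_ + 2) => 0
  | .negSucc _ => 0

lemma isZero_threeObj (n : ℤ) (h0 : n ≠ 0) (h1 : n ≠ 1) (h2 : n ≠ 2) :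
    IsZero (threeObj X Y Z n) := by
  match n with
  | .ofNat 0 => exact absurd rfl h0
  | .ofNat 1 => exact absurd rfl h1
  | .ofNat 2 => exact absurd rfl h2
  | .ofNat (_ + 3) => exact isZero_zeroObj
  | .negSucc _ => exact isZero_zeroObj

lemma threeD_comp (h : f ≫ g = 0) (n : ℤ) : threeD f g n ≫ threeD f g (n + 1) = 0 := by
  match n with
  | .ofNat 0 => exact h
  | .ofNat 1 => exact Limits.comp_zero
  | .ofNat (_ + 2) => exact Limits.zero_comp
  | .negSucc _ => exact Limits.zero_comp

/-- The complex `X ⟶ Y ⟶ Z` with `X` in degree `0`. -/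
def threeTerm (h : f ≫ g = 0) : CochainComplex (Factorization w) ℤ :=
  CochainComplex.of (threeObj X Y Z) (threeD f g) (threeD_comp f g h)

lemma threeTerm_d (h : f ≫ g = 0) (n : ℤ) : (threeTerm f g h).d n (n + 1) = threeD f g n :=
  CochainComplex.of_d _ _ _

variable {f g}

lemma ShortExact.comp_eq_zero (h : ShortExact f g) : f ≫ g = 0 :=
  hom_ext h.exact_neg.1 h.exact_zero.1

/-- The index `n` refers to exactness at `n + 1`: `n = 0` is the middle term, `n = 1` surjectivity
onto `Z`, `n = -1` injectivity on `X`. Elsewhere the term is zero. -/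
lemma exactAt_threeD (F : Factorization w ⥤ A) [F.Additive] (h₁ : Mono (F.map f))
    (h₂ : ExactAt (F.map f) (F.map g)) (h₃ : Epi (F.map g)) (n : ℤ) :
    ExactAt (F.map (threeD f g n)) (F.map (threeD f g (n + 1))) := by
  match n with
  | .ofNat 0 => exact h₂
  | .ofNat 1 =>
    refine ⟨(congrArg _ (F.map_zero _ _)).trans Limits.comp_zero, ?_⟩
    exact (ShortComplex.exact_iff_epi _ (F.map_zero _ _)).2 h₃
  | .ofNat (n + 2) =>
    refine ⟨(congrArg _ (F.map_zero _ _)).trans Limits.comp_zero, ?_⟩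
    exact ShortComplex.exact_of_isZero_X₂ _ (F.map_isZero isZero_zeroObj)
  | .negSucc 0 =>
    refine ⟨(congrArg (· ≫ F.map f) (F.map_zero _ _)).trans Limits.zero_comp, ?_⟩
    exact (ShortComplex.exact_iff_mono _ (F.map_zero _ _)).2 h₁
  | .negSucc (n + 1) =>
    refine ⟨(congrArg (· ≫ F.map _) (F.map_zero _ _)).trans Limits.zero_comp, ?_⟩
    exact ShortComplex.exact_of_isZero_X₂ _ (F.map_isZero isZero_zeroObj)

lemma ShortExact.isBoundedExact (h : ShortExact f g) :
    IsBoundedExact (threeTerm f g h.comp_eq_zero) where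
  bounded := ⟨0, 2, fun i hi => isZero_threeObj i (by omega) (by omega) (by omega)⟩
  exact_neg := exactAt_components (evNeg w) fun n => by
    rw [threeTerm_d, threeTerm_d]
    exact exactAt_threeD (evNeg w) h.mono_neg h.exact_neg h.epi_neg n
  exact_zero := exactAt_components (evZero w) fun n => by
    rw [threeTerm_d, threeTerm_d]
    exact exactAt_threeD (evZero w) h.mono_zero h.exact_zero h.epi_zero n

lemma unshiftInt_isZero (l : ℤ) {E : Factorization w} (hE : IsZero E) :
    IsZero ((unshiftInt w l).obj E) := by
  rw [IsZero.iff_id_eq_zero] at hE ⊢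
  rw [← CategoryTheory.Functor.map_id, hE, unshiftInt_map_zero]

lemma isZero_neg {E : Factorization w} (hE : IsZero E) : IsZero E.neg :=
  (evNeg w).map_isZero hE

lemma isZero_zero' {E : Factorization w} (hE : IsZero E) : IsZero E.zero :=
  (evZero w).map_isZero hE

variable [HasCoproducts.{v} A]

lemma ι_tot_φzero (K : CochainComplex (Factorization w) ℤ) (l : ℤ) :
    Sigma.ι (fun l : ℤ => ((unshiftInt w l).obj (K.X l)).neg) l ≫ (tot K).φzero =
      ((unshiftInt w l).obj (K.X l)).φzero ≫
        Sigma.ι (fun l : ℤ => ((unshiftInt w l).obj (K.X l)).zero) l +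
      totDiffZero K l ≫ Sigma.ι (fun l : ℤ => ((unshiftInt w l).obj (K.X l)).zero) (l + 1) :=
  Sigma.ι_desc _ _

lemma ι_tot_φneg (K : CochainComplex (Factorization w) ℤ) (l : ℤ) :
    Φ.inverse.map (Sigma.ι (fun l : ℤ => ((unshiftInt w l).obj (K.X l)).zero) l) ≫
        (tot K).φneg =
      ((unshiftInt w l).obj (K.X l)).φneg ≫
        Sigma.ι (fun l : ℤ => ((unshiftInt w l).obj (K.X l)).neg) l +
      totDiffNeg K l ≫ Sigma.ι (fun l : ℤ => ((unshiftInt w l).obj (K.X l)).neg) (l + 1) := by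
  change _ ≫ (PreservesCoproduct.iso Φ.inverse
    (fun l : ℤ => ((unshiftInt w l).obj (K.X l)).zero)).hom ≫ Sigma.desc _ = _
  rw [reassoc_of% (ι_coproductIso_hom (Φ := Φ)
    (fun l : ℤ => ((unshiftInt w l).obj (K.X l)).zero) l)]
  exact Sigma.ι_desc _ _

variable (f g)

/-- The totalization of `X ⟶ Y ⟶ Z`. -/
def threeTot (h : f ≫ g = 0) : ThreeTot f g (tot (threeTerm f g h)) :=
  have hz : ∀ l : ℤ, l ≠ 0 → l ≠ 1 → l ≠ 2 →
      IsZero ((unshiftInt w l).obj ((threeTerm f g h).X l)) := fun l h0 h1 h2 =>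
    unshiftInt_isZero l (isZero_threeObj l h0 h1 h2)
  let n : ThreeSum (tot (threeTerm f g h)).neg X.neg (Φ.inverse.obj Y.zero)
      (Φ.inverse.obj Z.neg) := ThreeSum.ofCoproduct
        (fun l : ℤ => ((unshiftInt w l).obj ((threeTerm f g h).X l)).neg)
        fun l h0 h1 h2 => isZero_neg (hz l h0 h1 h2)
  let z : ThreeSum (tot (threeTerm f g h)).zero X.zero Y.neg
      (Φ.inverse.obj Z.zero) := ThreeSum.ofCoproduct
        (fun l : ℤ => ((unshiftInt w l).obj ((threeTerm f g h).X l)).zero)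
        fun l h0 h1 h2 => isZero_zero' (hz l h0 h1 h2)
  -- For `l = 0, 1, 2` the iterated translations unfold by definition, and E[-l][-1] is E[-(l + 1)]
  -- itself; only a composition with an identity has to be removed.
  have en₀ : totDiffNeg (threeTerm f g h) 0 = Φ.inverse.map f.zero :=
    (Category.comp_id _).trans
      (congrArg (fun x : X ⟶ Y => Φ.inverse.map x.zero) (threeTerm_d f g h 0))
  have en₁ : totDiffNeg (threeTerm f g h) 1 = Φ.inverse.map g.neg :=
    (Category.comp_id _).trans
      (congrArg (fun x : Y ⟶ Z => Φ.inverse.map x.neg) (threeTerm_d f g h 1))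
  have en₂ : totDiffNeg (threeTerm f g h) 2 = 0 :=
    (isZero_neg (hz 3 (by decide) (by decide) (by decide))).eq_of_tgt _ _
  have ez₀ : totDiffZero (threeTerm f g h) 0 = f.neg :=
    (Category.comp_id _).trans (congrArg (fun x : X ⟶ Y => x.neg) (threeTerm_d f g h 0))
  have ez₁ : totDiffZero (threeTerm f g h) 1 = Φ.inverse.map g.zero :=
    (Category.comp_id _).trans
      (congrArg (fun x : Y ⟶ Z => Φ.inverse.map x.zero) (threeTerm_d f g h 1))
  have ez₂ : totDiffZero (threeTerm f g h) 2 = 0 :=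
    (isZero_zero' (hz 3 (by decide) (by decide) (by decide))).eq_of_tgt _ _
  { n := n
    z := z
    φzero₀ := eq_add_of_eq (ι_tot_φzero (threeTerm f g h) 0) rfl ez₀
    -- One translation changes the sign of the structure maps of `Y`; for `Z`, translated twice, the
    -- signs cancel.
    φzero₁ := eq_neg_add_of_eq (ι_tot_φzero (threeTerm f g h) 1) rfl ez₁
    φzero₂ := eq_comp_of_eq (ι_tot_φzero (threeTerm f g h) 2) (_root_.neg_neg _) ez₂
    φneg₀ := eq_add_of_eq (ι_tot_φneg (threeTerm f g h) 0) rfl en₀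
    φneg₁ := eq_neg_add_of_eq (ι_tot_φneg (threeTerm f g h) 1) rfl en₁
    φneg₂ := eq_comp_of_eq (ι_tot_φneg (threeTerm f g h) 2) (neg_inverse_map_neg Z.φneg) en₂ }

end threeTerm

end Factorization

namespace IsThick

open Factorization

variable [HasCoproducts.{v} A] {P : ObjectProperty (KFact w)} (hP : IsThick P)

include hP

/-- A thick subcategory containing the totalizations of the bounded exact complexes contains the
third term of a short exact sequence if it contains the others. -/
lemma of_shortExact (hT : ∀ K : CochainComplex (Factorization w) ℤ, IsBoundedExact K →
    P ((toK w).obj (tot K))) {X Y Z : Factorization w} {f : X ⟶ Y} {g : Y ⟶ Z}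
    (h : ShortExact f g) (hX : P ((toK w).obj X)) (hY : P ((toK w).obj Y)) :
    P ((toK w).obj Z) :=
  hP.of_threeTot (threeTot f g h.comp_eq_zero) (hT _ h.isBoundedExact) hX hY

end IsThick

end

end MF

/-! ### Truncations, leading terms and telescopes -/

namespace MF

section

variable {A : Type u} [Category.{v} A] [Abelian A]

namespace Decomposition

variable {M : A} {X : ℕ → A} (P : Decomposition M X)

/-- The projection to the sum of the first `k` summands. -/
def trunc (k : ℕ) : M ⟶ M := ∑ i ∈ Finset.range k, P.π i ≫ P.ι i

lemma trunc_zero : P.trunc 0 = 0 := rfl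

lemma trunc_succ (k : ℕ) : P.trunc (k + 1) = P.trunc k + P.π k ≫ P.ι k :=
  Finset.sum_range_succ _ _

lemma ι_trunc {n k : ℕ} (h : n < k) : P.ι n ≫ P.trunc k = P.ι n := by
  rw [trunc, Preadditive.comp_sum, Finset.sum_eq_single n]
  · rw [← Category.assoc, P.ι_π, Category.id_comp]
  · intro i _ hi
    rw [← Category.assoc, P.ι_π_ne n i (Ne.symm hi), zero_comp]
  · intro hn
    exact absurd (Finset.mem_range.2 h) hn

lemma ι_trunc_of_le {n k : ℕ} (h : k ≤ n) : P.ι n ≫ P.trunc k = 0 := by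
  rw [trunc, Preadditive.comp_sum]
  refine Finset.sum_eq_zero fun i hi => ?_
  have := Finset.mem_range.1 hi
  rw [← Category.assoc, P.ι_π_ne n i (by omega), zero_comp]

lemma trunc_π_of_le {n k : ℕ} (h : k ≤ n) : P.trunc k ≫ P.π n = 0 := by
  rw [trunc, Preadditive.sum_comp]
  refine Finset.sum_eq_zero fun i hi => ?_
  have := Finset.mem_range.1 hi
  rw [Category.assoc, P.ι_π_ne i n (by omega), comp_zero]

lemma trunc_trunc {j k : ℕ} (h : j ≤ k) : P.trunc j ≫ P.trunc k = P.trunc j := by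
  conv_lhs => rw [trunc, Preadditive.sum_comp]
  refine Finset.sum_congr rfl fun i hi => ?_
  have := Finset.mem_range.1 hi
  rw [Category.assoc, P.ι_trunc (by omega)]

lemma trunc_eq_id {k : ℕ} (h : ∀ n, k ≤ n → IsZero (X n)) : P.trunc k = 𝟙 M := by
  apply P.hom_ext
  intro n
  by_cases hn : n < k
  · rw [P.ι_trunc hn, Category.comp_id]
  · exact (h n (by omega)).eq_of_src _ _

lemma map_trunc (F : A ⥤ A) [F.IsEquivalence] (k : ℕ) :
    (P.map F).trunc k = F.map (P.trunc k) := by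
  have : F.Additive := F.additive_of_preserves_binary_products
  simp [trunc, Functor.map_sum]

/-- A morphism that raises the index of the summands by at most `1`. -/
lemma trunc_comp_of_ι {V : A} {Y : ℕ → A} (Q : Decomposition V Y) {f : M ⟶ V}
    (hf : ∀ m, P.ι m ≫ f ≫ Q.trunc (m + 2) = P.ι m ≫ f) (k : ℕ) :
    P.trunc k ≫ f ≫ Q.trunc (k + 1) = P.trunc k ≫ f := by
  rw [trunc, Preadditive.sum_comp, Preadditive.sum_comp]
  refine Finset.sum_congr rfl fun i hi => ?_
  have := Finset.mem_range.1 hi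
  have h := hf i =≫ Q.trunc (k + 1)
  simp only [Category.assoc, Q.trunc_trunc (show i + 2 ≤ k + 1 by omega)] at h
  rw [Category.assoc, Category.assoc, ← h, hf]

end Decomposition

/-- An argument with leading terms. If `x` and its image under `g` both lie in the first `p + 1`
summands, then the component of `x` of index `p` is killed by the leading part of `g`. By exactness
it is, after an epimorphism, the leading part of `f` applied to some `y` of index `p - 1`, and
subtracting the image of `y` lowers the filtration of `x`. The composite of `f` and `g` need not
vanish. -/
lemma exists_lift_of_exact_of_filtered {U V W : A} {X Y Z : ℕ → A} (P : Decomposition U X)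
    (Q : Decomposition V Y) (R : Decomposition W Z) {f : U ⟶ V} {g : V ⟶ W}
    (hf : ∀ m, P.ι m ≫ f ≫ Q.trunc (m + 2) = P.ι m ≫ f)
    (hg : ∀ m, Q.ι m ≫ g ≫ R.trunc (m + 2) = Q.ι m ≫ g)
    (hex : ∀ m, ExactAt (P.ι m ≫ f ≫ Q.π (m + 1)) (Q.ι (m + 1) ≫ g ≫ R.π (m + 2)))
    (hmono : Mono (Q.ι 0 ≫ g ≫ R.π 1)) (p : ℕ) {T : A} (x : T ⟶ V)
    (hx : x ≫ Q.trunc (p + 1) = x) (hxg : x ≫ g ≫ R.trunc (p + 1) = x ≫ g) :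
    ∃ (T' : A) (π : T' ⟶ T) (_ : Epi π) (y : T' ⟶ U), y ≫ P.trunc p = y ∧
      (π ≫ x - y ≫ f) ≫ Q.trunc p = π ≫ x - y ≫ f := by
  have h0 : (x ≫ Q.π p) ≫ Q.ι p ≫ g ≫ R.π (p + 1) = 0 := by
    have h1 : x ≫ g ≫ R.π (p + 1) = 0 := by
      rw [← Category.assoc, ← hxg, Category.assoc, Category.assoc, R.trunc_π_of_le le_rfl,
        comp_zero, comp_zero]
    -- Components of index below `p` reach at most index `p`, so they do not contribute to index `p
    -- + 1`.
    have h2 : Q.trunc p ≫ g ≫ R.π (p + 1) = 0 := by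
      have := Q.trunc_comp_of_ι R hg p
      rw [← Category.assoc, ← this, Category.assoc, Category.assoc, R.trunc_π_of_le le_rfl,
        comp_zero, comp_zero]
    rw [← hx, Q.trunc_succ, Preadditive.comp_add, Preadditive.add_comp, Category.assoc, h2,
      comp_zero, _root_.zero_add] at h1
    simpa only [Category.assoc] using h1
  have hx' : x = x ≫ Q.trunc p + (x ≫ Q.π p) ≫ Q.ι p := by
    conv_lhs => rw [← hx, Q.trunc_succ, Preadditive.comp_add, ← Category.assoc x]
  -- For `p = 0` nothing precedes; injectivity of the leading part of `g` forces `x = 0`.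
  cases p with
  | zero =>
    have h1 : x ≫ Q.π 0 = 0 := by
      rw [← cancel_mono (Q.ι 0 ≫ g ≫ R.π 1), h0, zero_comp]
    have h2 : x = 0 := by
      rw [hx', h1, Q.trunc_zero, comp_zero, zero_comp, _root_.add_zero]
    exact ⟨T, 𝟙 T, inferInstance, 0, zero_comp, by rw [h2]; simp⟩
  | succ p =>
    obtain ⟨T', π, hπ, y, hy⟩ := (hex p).exists_lift _ h0
    refine ⟨T', π, hπ, y ≫ P.ι p, by rw [Category.assoc, P.ι_trunc (by omega)], ?_⟩
    have h3 : P.ι p ≫ f = P.ι p ≫ f ≫ Q.trunc (p + 1) +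
        (P.ι p ≫ f ≫ Q.π (p + 1)) ≫ Q.ι (p + 1) := by
      conv_lhs => rw [← hf p, Q.trunc_succ, Preadditive.comp_add, Preadditive.comp_add]
      simp only [Category.assoc]
    have h4 : π ≫ x - (y ≫ P.ι p) ≫ f =
        (π ≫ x - (y ≫ P.ι p) ≫ f) ≫ Q.trunc (p + 1) := by
      conv_lhs => rw [Category.assoc, h3, hx', Preadditive.comp_add, Preadditive.comp_add]
      simp only [Preadditive.sub_comp, Category.assoc]
      rw [reassoc_of% hy]
      abel
    exact h4.symm

/-- The telescope sequence of an increasing sequence of subobjects `τ p` of `M` that interlaces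
with the sums of the first `p` summands of `M`. -/
structure Interlaced {M : A} {X : ℕ → A} (P : Decomposition M X) (τ : ℕ → A) where
  j : ∀ p, τ p ⟶ M
  θ : ∀ p, M ⟶ τ p
  mono_j : ∀ p, Mono (j p)
  j_trunc : ∀ p, j p ≫ P.trunc (p + 1) = j p
  θ_j : ∀ p, θ p ≫ j p = P.trunc p

namespace Interlaced

variable {M : A} {X τ : ℕ → A} {P : Decomposition M X} (t : Interlaced P τ)

instance (p : ℕ) : Mono (t.j p) := t.mono_j p

/-- The inclusion of `τ p` in `τ (p + 1)`. -/
def s (p : ℕ) : τ p ⟶ τ (p + 1) := t.j p ≫ t.θ (p + 1)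

/-- `τ p` lies in the sum of the first `p + 1` summands, where `θ (p + 1)` followed by the inclusion
is the identity. -/
lemma s_j (p : ℕ) : t.s p ≫ t.j (p + 1) = t.j p := by
  rw [s, Category.assoc, t.θ_j, t.j_trunc]

variable {C : A} (Q : Decomposition C τ)

/-- The difference of the identity and the shift. -/
def δ : C ⟶ C := Q.desc fun p => Q.ι p - t.s p ≫ Q.ι (p + 1)

/-- The sum of the inclusions. -/
def ε : C ⟶ M := Q.desc t.j

lemma ι_δ (p : ℕ) : Q.ι p ≫ t.δ Q = Q.ι p - t.s p ≫ Q.ι (p + 1) := Q.ι_desc _ p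

lemma ι_ε (p : ℕ) : Q.ι p ≫ t.ε Q = t.j p := Q.ι_desc _ p

/-- There is an explicit retraction. Its correction on `τ p` is the sum of `j p ≫ θ i` over `i ≤ p`;
after `δ` the sums cancel up to `j p ≫ θ (p + 1)`, which is the shift `s p`. No exactness of
filtered colimits is needed. -/
lemma mono_δ : Mono (t.δ Q) := by
  suffices h : t.δ Q ≫ Q.desc (fun p =>
      Q.ι p - ∑ i ∈ Finset.range (p + 1), t.j p ≫ t.θ i ≫ Q.ι i) = 𝟙 C from mono_of_mono_fac h
  apply Q.hom_ext
  intro p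
  rw [reassoc_of% t.ι_δ Q, Preadditive.sub_comp, Category.assoc, Q.ι_desc, Q.ι_desc,
    Finset.sum_range_succ _ (p + 1), Preadditive.comp_sub, Preadditive.comp_add,
    Preadditive.comp_sum, reassoc_of% t.s_j, Category.comp_id]
  simp only [reassoc_of% t.s_j]
  rw [s, Category.assoc]
  abel

lemma δ_ε : t.δ Q ≫ t.ε Q = 0 := by
  apply Q.hom_ext
  intro p
  rw [reassoc_of% t.ι_δ Q, Preadditive.sub_comp, Category.assoc, t.ι_ε, t.ι_ε, t.s_j, sub_self,
    comp_zero]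

lemma ι_θ_succ {n p : ℕ} (h : n < p) : (P.ι n ≫ t.θ p) ≫ t.s p = P.ι n ≫ t.θ (p + 1) := by
  rw [← cancel_mono (t.j (p + 1)), Category.assoc, Category.assoc, t.s_j, t.θ_j, Category.assoc,
    t.θ_j, P.ι_trunc h, P.ι_trunc (by omega)]

lemma ι_θ_ε (n : ℕ) : P.ι n ≫ t.θ (n + 1) ≫ Q.ι (n + 1) ≫ t.ε Q = P.ι n := by
  rw [t.ι_ε, t.θ_j, P.ι_trunc (by omega)]

lemma epi_ε : Epi (t.ε Q) := by
  refine ⟨fun a b h => P.hom_ext fun n => ?_⟩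
  rw [← t.ι_θ_ε Q]
  simp only [Category.assoc, h]

/-- It suffices that `ε` is a cokernel of `δ`. A morphism killed by `δ` is a compatible family on
the `τ p`. Since `M` is the coproduct of the `X n`, a morphism on `M` may be prescribed on each `X
n`, which is contained in `τ (n + 1)`. -/
lemma exactAt_δ_ε : ExactAt (t.δ Q) (t.ε Q) := by
  refine ⟨t.δ_ε Q, ?_⟩
  have := t.epi_ε Q
  refine ShortComplex.exact_of_g_is_cokernel _ ?_
  refine Classical.choice (?_ : Nonempty (IsColimit (CokernelCofork.ofπ (t.ε Q) (t.δ_ε Q))))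
  have key : ∀ {W : A} (x : C ⟶ W), t.δ Q ≫ x = 0 → ∃ y, t.ε Q ≫ y = x := by
    intro W x hx
    have h1 : ∀ p, t.s p ≫ Q.ι (p + 1) ≫ x = Q.ι p ≫ x := by
      intro p
      have := Q.ι p ≫= hx
      rw [reassoc_of% t.ι_δ Q, Preadditive.sub_comp, comp_zero, Category.assoc] at this
      exact (sub_eq_zero.1 this).symm
    -- Using a later stage than `n + 1` to define the value on `X n` gives the same result.
    have h2 : ∀ n k, P.ι n ≫ t.θ (n + 1 + k) ≫ Q.ι (n + 1 + k) ≫ x =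
        P.ι n ≫ t.θ (n + 1) ≫ Q.ι (n + 1) ≫ x := by
      intro n k
      induction k with
      | zero => rfl
      | succ k ih =>
        have h5 := t.ι_θ_succ (show n < n + 1 + k by omega) =≫ (Q.ι (n + 1 + k + 1) ≫ x)
        simp only [Category.assoc] at h5
        rw [← ih, ← h1 (n + 1 + k)]
        exact h5.symm
    refine ⟨P.desc fun n => P.ι n ≫ t.θ (n + 1) ≫ Q.ι (n + 1) ≫ x, Q.hom_ext fun p => ?_⟩
    rw [reassoc_of% t.ι_ε Q, ← t.j_trunc, ← h1 p, s, Category.assoc]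
    -- `θ (p + 1)` sees only the first `p + 1` summands, so on `τ p` the identity becomes a finite
    -- sum over `n ≤ p`.
    have h3 : P.trunc (p + 1) ≫ t.θ (p + 1) = t.θ (p + 1) := by
      rw [← cancel_mono (t.j (p + 1)), Category.assoc, t.θ_j, P.trunc_trunc le_rfl]
    rw [← h3, Decomposition.trunc]
    simp only [Preadditive.comp_sum, Preadditive.sum_comp, Category.assoc, P.ι_desc]
    refine Finset.sum_congr rfl fun n hn => ?_
    obtain ⟨k, rfl⟩ : ∃ k, p = n + k := ⟨p - n, by have := Finset.mem_range.1 hn; omega⟩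
    have h4 := h2 n k
    rw [show n + 1 + k = n + k + 1 by omega] at h4
    rw [h4]
  exact ⟨CokernelCofork.IsColimit.ofπ _ _ (fun x hx => (key x hx).choose)
    (fun x hx => (key x hx).choose_spec)
    (fun x hx m hm => by rw [← cancel_epi (t.ε Q), hm, (key x hx).choose_spec])⟩

end Interlaced

end

end MF

/-! ### Free factorizations and largest subfactorizations -/

namespace MF

section

variable {A : Type u} [Category.{v} A] [Abelian A] {Φ : A ≌ A} {w : Potential Φ}

namespace Factorization

/-! ### Free factorizations -/

section free

variable (w) in
/-- The map `φ⁻¹` of a free factorization. -/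
def freeNeg (X Y : A) : Φ.inverse.obj (Y ⊞ X) ⟶ X ⊞ Φ.inverse.obj Y :=
  biprod.lift (Φ.inverse.map biprod.snd ≫ w.invApp X) (Φ.inverse.map biprod.fst)

variable (w) in
/-- The map `φ⁰` of a free factorization. -/
def freeZero (X Y : A) : X ⊞ Φ.inverse.obj Y ⟶ Y ⊞ X :=
  biprod.lift (biprod.snd ≫ w.invApp Y) biprod.fst

variable (w) in
/-- The factorization freely generated by `X` in degree `-1` and `Y` in degree `0`. -/
def free (X Y : A) : Factorization w where
  neg := X ⊞ Φ.inverse.obj Y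
  zero := Y ⊞ X
  φneg := freeNeg w X Y
  φzero := freeZero w X Y
  φneg_φzero := by
    rw [freeNeg, freeZero]
    apply biprod.hom_ext
    · rw [Category.assoc, biprod.lift_fst, biprod.lift_snd_assoc, w.invApp_naturality]
    · rw [Category.assoc, biprod.lift_snd, biprod.lift_fst, w.invApp_naturality]
  φzero_φneg := by
    rw [factorization_aux, freeNeg, freeZero]
    apply biprod.hom_ext
    · rw [Category.assoc, biprod.lift_fst, ← Functor.map_comp_assoc, biprod.lift_snd,
        w.invApp_naturality]
    · rw [Category.assoc, biprod.lift_snd, ← Functor.map_comp, biprod.lift_fst,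
        Functor.map_comp, w.map_invApp, w.invApp_naturality]

variable {X Y : A}

lemma inl_freeNeg : Φ.inverse.map biprod.inl ≫ freeNeg w X Y = biprod.inr := by
  apply biprod.hom_ext
  · rw [Category.assoc, freeNeg, biprod.lift_fst, ← Functor.map_comp_assoc, biprod.inl_snd,
      Functor.map_zero, Limits.zero_comp, biprod.inr_fst]
  · rw [Category.assoc, freeNeg, biprod.lift_snd, ← Functor.map_comp, biprod.inl_fst,
      CategoryTheory.Functor.map_id, biprod.inr_snd]

lemma inr_freeNeg : Φ.inverse.map biprod.inr ≫ freeNeg w X Y = w.invApp X ≫ biprod.inl := by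
  apply biprod.hom_ext
  · rw [Category.assoc, freeNeg, biprod.lift_fst, ← Functor.map_comp_assoc, biprod.inr_snd,
      CategoryTheory.Functor.map_id, Category.id_comp, Category.assoc, biprod.inl_fst,
      Category.comp_id]
  · rw [Category.assoc, freeNeg, biprod.lift_snd, ← Functor.map_comp, biprod.inr_fst,
      Functor.map_zero, Category.assoc, biprod.inl_snd, Limits.comp_zero]

lemma inl_freeZero : biprod.inl ≫ freeZero w X Y = biprod.inr := by
  apply biprod.hom_ext <;> simp [freeZero]

lemma inr_freeZero : biprod.inr ≫ freeZero w X Y = w.invApp Y ≫ biprod.inl := by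
  apply biprod.hom_ext <;> simp [freeZero]

lemma freeNeg_snd_inl :
    freeNeg w X Y ≫ biprod.snd ≫ Φ.inverse.map (biprod.inl : Y ⟶ Y ⊞ X) =
      Φ.inverse.map (biprod.fst ≫ biprod.inl) := by
  rw [freeNeg, biprod.lift_snd_assoc, Functor.map_comp]

/-- Free factorizations are contractible. -/
def freeHomotopy (X Y : A) : Homotopy (𝟙 (free w X Y)) 0 where
  neg := (biprod.snd ≫ Φ.inverse.map biprod.inl : X ⊞ Φ.inverse.obj Y ⟶ Φ.inverse.obj (Y ⊞ X))
  zero := (biprod.snd ≫ biprod.inl : Y ⊞ X ⟶ X ⊞ Φ.inverse.obj Y)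
  eq_neg := by
    have h : 𝟙 (X ⊞ Φ.inverse.obj Y) - 0 = freeZero w X Y ≫ biprod.snd ≫ biprod.inl +
        (biprod.snd ≫ Φ.inverse.map biprod.inl) ≫ freeNeg w X Y := by
      rw [Category.assoc, inl_freeNeg, freeZero, biprod.lift_snd_assoc, biprod.total,
        _root_.sub_zero]
    exact h
  eq_zero := by
    have e := Φ.counitIso.inv.naturality (biprod.fst ≫ biprod.inl : Y ⊞ X ⟶ Y ⊞ X)
    dsimp at e
    have h₀ : Φ.counitIso.inv.app (Y ⊞ X) ≫ Φ.functor.map (Φ.inverse.map (biprod.fst ≫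
        (biprod.inl : Y ⟶ Y ⊞ X))) ≫ Φ.counitIso.hom.app (Y ⊞ X) = biprod.fst ≫ biprod.inl := by
      rw [← reassoc_of% e]
      simp
    have h : 𝟙 (Y ⊞ X) - 0 =
        (biprod.snd ≫ biprod.inl : Y ⊞ X ⟶ X ⊞ Φ.inverse.obj Y) ≫ freeZero w X Y +
        (Φ.counitIso.inv.app (Y ⊞ X) ≫ Φ.functor.map (freeNeg w X Y) ≫
          Φ.functor.map (biprod.snd ≫ Φ.inverse.map biprod.inl) ≫
            Φ.counitIso.hom.app (Y ⊞ X) : Y ⊞ X ⟶ Y ⊞ X) := by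
      rw [Category.assoc, inl_freeZero, ← Functor.map_comp_assoc, freeNeg_snd_inl, h₀,
        _root_.sub_zero, add_comm, biprod.total]
    exact h

variable {E : Factorization w}

/-- The morphism out of a free factorization given by the images of the generators. -/
def freeDesc (a : X ⟶ E.neg) (b : Y ⟶ E.zero) : free w X Y ⟶ E :=
  have h₁ : freeNeg w X Y ≫ biprod.desc a (Φ.inverse.map b ≫ E.φneg) =
      Φ.inverse.map (biprod.desc b (a ≫ E.φzero)) ≫ E.φneg := by
    apply inverse_biprod_hom_ext
    · rw [reassoc_of% inl_freeNeg, ← Functor.map_comp_assoc, biprod.inl_desc, biprod.inr_desc]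
    · rw [reassoc_of% inr_freeNeg, ← Functor.map_comp_assoc, biprod.inl_desc, biprod.inr_desc,
        Functor.map_comp, Category.assoc, inverse_map_φzero_φneg, w.invApp_naturality]
  have h₂ : freeZero w X Y ≫ biprod.desc b (a ≫ E.φzero) =
      biprod.desc a (Φ.inverse.map b ≫ E.φneg) ≫ E.φzero := by
    apply biprod.hom_ext'
    · rw [reassoc_of% inl_freeZero, biprod.inl_desc_assoc, biprod.inr_desc]
    · rw [reassoc_of% inr_freeZero, biprod.inr_desc_assoc, biprod.inl_desc, Category.assoc,
        E.φneg_φzero, w.invApp_naturality]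
  (⟨biprod.desc a (Φ.inverse.map b ≫ E.φneg), biprod.desc b (a ≫ E.φzero), h₁, h₂⟩ :
    Hom (free w X Y) E)

/-- The morphism from `E[-1]` to a free factorization. -/
def unshiftToFree (a : E.neg ⟶ X) (b : E.zero ⟶ Y) : E.unshiftObj ⟶ free w X Y :=
  have h₁ : (-Φ.inverse.map E.φzero) ≫ biprod.lift (-(E.φneg ≫ a)) (Φ.inverse.map b) =
      Φ.inverse.map (biprod.lift (-(E.φzero ≫ b)) a) ≫ freeNeg w X Y := by
    rw [freeNeg]
    apply biprod.hom_ext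
    · rw [Category.assoc, Category.assoc, biprod.lift_fst, biprod.lift_fst,
        ← Functor.map_comp_assoc, biprod.lift_snd, Preadditive.neg_comp, Preadditive.comp_neg,
        _root_.neg_neg, reassoc_of% E.inverse_map_φzero_φneg, w.invApp_naturality]
    · rw [Category.assoc, Category.assoc, biprod.lift_snd, biprod.lift_snd,
        ← Functor.map_comp, biprod.lift_fst, Preadditive.neg_comp, Functor.map_neg,
        Functor.map_comp]
  have h₂ : (-E.φneg) ≫ biprod.lift (-(E.φzero ≫ b)) a =
      biprod.lift (-(E.φneg ≫ a)) (Φ.inverse.map b) ≫ freeZero w X Y := by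
    rw [freeZero]
    apply biprod.hom_ext
    · rw [Category.assoc, Category.assoc, biprod.lift_fst, biprod.lift_fst,
        biprod.lift_snd_assoc, Preadditive.neg_comp, Preadditive.comp_neg, _root_.neg_neg,
        ← Category.assoc, E.φneg_φzero, w.invApp_naturality]
    · rw [Category.assoc, Category.assoc, biprod.lift_snd, biprod.lift_snd, biprod.lift_fst,
        Preadditive.neg_comp]
  (⟨biprod.lift (-(E.φneg ≫ a)) (Φ.inverse.map b), biprod.lift (-(E.φzero ≫ b)) a, h₁, h₂⟩ :
    Hom E.unshiftObj (free w X Y))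

end free

/-! ### Subfactorizations -/

section sub

/-- `Φ⁻¹` is exact, so it carries the kernel of `a` to the kernel of `Φ⁻¹(a)`. -/
lemma exists_inverse_kernel_lift {X Y T : A} (a : X ⟶ Y) (y : T ⟶ Φ.inverse.obj X)
    (h : y ≫ Φ.inverse.map a = 0) :
    ∃ l : T ⟶ Φ.inverse.obj (kernel a), l ≫ Φ.inverse.map (kernel.ι a) = y := by
  have hex : ExactAt (kernel.ι a) a := ⟨kernel.condition a, ShortComplex.exact_kernel a⟩
  exact ⟨(hex.map Φ.inverse).2.lift y h, (hex.map Φ.inverse).2.lift_f y h⟩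

variable (E : Factorization w) {Q R : A} (a : E.neg ⟶ Q) (b : E.zero ⟶ R)

/-- The component in degree `-1` of the largest subfactorization killed by `a` and `b`. -/
def subNeg : A := kernel (biprod.lift a (E.φzero ≫ b))

/-- The component in degree `0` of the largest subfactorization killed by `a` and `b`. -/
def subZero : A := kernel (biprod.lift b (E.φsharp ≫ Φ.functor.map a))

/-- The inclusion in degree `-1`. -/
def subNegι : E.subNeg a b ⟶ E.neg := kernel.ι _

/-- The inclusion in degree `0`. -/
def subZeroι : E.subZero a b ⟶ E.zero := kernel.ι _

instance : Mono (E.subNegι a b) := inferInstanceAs (Mono (kernel.ι _))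
instance : Mono (E.subZeroι a b) := inferInstanceAs (Mono (kernel.ι _))

lemma subNegι_comp : E.subNegι a b ≫ a = 0 := by
  have := kernel.condition (biprod.lift a (E.φzero ≫ b)) =≫ biprod.fst
  rwa [Category.assoc, biprod.lift_fst, Limits.zero_comp] at this

lemma subNegι_φzero_comp : E.subNegι a b ≫ E.φzero ≫ b = 0 := by
  have := kernel.condition (biprod.lift a (E.φzero ≫ b)) =≫ biprod.snd
  rwa [Category.assoc, biprod.lift_snd, Limits.zero_comp] at this

lemma subZeroι_comp : E.subZeroι a b ≫ b = 0 := by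
  have := kernel.condition (biprod.lift b (E.φsharp ≫ Φ.functor.map a)) =≫ biprod.fst
  rwa [Category.assoc, biprod.lift_fst, Limits.zero_comp] at this

lemma subZeroι_φsharp_comp : E.subZeroι a b ≫ E.φsharp ≫ Φ.functor.map a = 0 := by
  have := kernel.condition (biprod.lift b (E.φsharp ≫ Φ.functor.map a)) =≫ biprod.snd
  rwa [Category.assoc, biprod.lift_snd, Limits.zero_comp] at this

variable {a b} in
lemma exists_subNeg_lift {T : A} (x : T ⟶ E.neg) (h₁ : x ≫ a = 0) (h₂ : x ≫ E.φzero ≫ b = 0) :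
    ∃ l, l ≫ E.subNegι a b = x :=
  ⟨kernel.lift _ x (by apply biprod.hom_ext <;> simp [h₁, h₂]), kernel.lift_ι _ _ _⟩

variable {a b} in
lemma exists_subZero_lift {T : A} (x : T ⟶ E.zero) (h₁ : x ≫ b = 0)
    (h₂ : x ≫ E.φsharp ≫ Φ.functor.map a = 0) : ∃ l, l ≫ E.subZeroι a b = x :=
  ⟨kernel.lift _ x (by apply biprod.hom_ext <;> simp [h₁, h₂]), kernel.lift_ι _ _ _⟩

/-- Transposition for compositions with `φ⁻¹`. -/
lemma comp_φneg_comp {T : A} (x : T ⟶ E.zero) :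
    Φ.inverse.map x ≫ E.φneg ≫ a = Φ.inverse.map (x ≫ E.φsharp ≫ Φ.functor.map a) ≫
      Φ.unitIso.inv.app Q := by
  have e := Φ.unitIso.inv.naturality a
  dsimp at e
  simp only [Functor.map_comp, Category.assoc]
  rw [e, reassoc_of% E.inverse_map_φsharp]

variable {a b} in
-- The kernel in degree 0 is cut out by a condition on the transpose of `φ⁻¹`. After `Φ⁻¹` that
-- condition becomes the one on `φ⁻¹` itself.
lemma exists_inverse_subZero_lift {T : A} (x : T ⟶ Φ.inverse.obj E.zero)
    (h₁ : x ≫ Φ.inverse.map b = 0) (h₂ : x ≫ E.φneg ≫ a = 0) :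
    ∃ l, l ≫ Φ.inverse.map (E.subZeroι a b) = x := by
  have e := Φ.unitIso.inv.naturality a
  dsimp at e
  refine exists_inverse_kernel_lift _ x ?_
  have h₃ : x ≫ Φ.inverse.map (E.φsharp ≫ Φ.functor.map a) = 0 := by
    rw [← cancel_mono (Φ.unitIso.inv.app Q), Category.assoc, Functor.map_comp, Category.assoc,
      e, reassoc_of% E.inverse_map_φsharp, h₂, Limits.zero_comp]
  have h₄ : biprod.lift b (E.φsharp ≫ Φ.functor.map a) = b ≫ biprod.inl +
      (E.φsharp ≫ Φ.functor.map a) ≫ biprod.inr := by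
    apply biprod.hom_ext <;> simp
  rw [h₄, Functor.map_add, Preadditive.comp_add, Functor.map_comp, Functor.map_comp _ _ biprod.inr,
    reassoc_of% h₁, reassoc_of% h₃, Limits.zero_comp, Limits.zero_comp, _root_.add_zero]

/-- The condition for `b` is part of the definition of the kernel. The condition for `a` concerns
`φ⁰` followed by the transpose of `φ⁻¹`, that is `w`, and by naturality `w` can be moved past `a`,
which kills the subobject. -/
lemma exists_sub_φzero : ∃ f, f ≫ E.subZeroι a b = E.subNegι a b ≫ E.φzero :=
  E.exists_subZero_lift _ (by rw [Category.assoc, E.subNegι_φzero_comp]) (by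
    have := E.φzero_φsharp
    rw [Category.assoc, reassoc_of% this, ← w.naturality, reassoc_of% E.subNegι_comp a b,
      Limits.zero_comp])

lemma exists_sub_φneg :
    ∃ f, f ≫ E.subNegι a b = Φ.inverse.map (E.subZeroι a b) ≫ E.φneg :=
  E.exists_subNeg_lift _ (by
    rw [Category.assoc, comp_φneg_comp, E.subZeroι_φsharp_comp, Functor.map_zero,
      Limits.zero_comp]) (by
    rw [Category.assoc, reassoc_of% E.φneg_φzero, ← w.invApp_naturality,
      ← Functor.map_comp_assoc, E.subZeroι_comp, Functor.map_zero, Limits.zero_comp])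

/-- The largest subfactorization of `E` killed by `a` and `b`. -/
def sub : Factorization w where
  neg := E.subNeg a b
  zero := E.subZero a b
  φneg := (E.exists_sub_φneg a b).choose
  φzero := (E.exists_sub_φzero a b).choose
  φneg_φzero := by
    rw [← cancel_mono (E.subZeroι a b), Category.assoc, (E.exists_sub_φzero a b).choose_spec,
      reassoc_of% (E.exists_sub_φneg a b).choose_spec, E.φneg_φzero, w.invApp_naturality]
  φzero_φneg := by
    rw [factorization_aux, ← cancel_mono (E.subNegι a b), Category.assoc,
      (E.exists_sub_φneg a b).choose_spec, ← Functor.map_comp_assoc,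
      (E.exists_sub_φzero a b).choose_spec, Functor.map_comp, Category.assoc,
      E.inverse_map_φzero_φneg, w.invApp_naturality]

/-- The inclusion of the largest subfactorization killed by `a` and `b`. -/
def subι : E.sub a b ⟶ E :=
  (⟨E.subNegι a b, E.subZeroι a b, (E.exists_sub_φneg a b).choose_spec,
    (E.exists_sub_φzero a b).choose_spec⟩ : Hom (E.sub a b) E)

instance : Mono (E.subι a b).neg := inferInstanceAs (Mono (kernel.ι _))
instance : Mono (E.subι a b).zero := inferInstanceAs (Mono (kernel.ι _))

end sub

end Factorization

end

end MF

/-! ### Countable coproducts of factorizations -/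

namespace MF

section

variable {A : Type u} [Category.{v} A] [Abelian A] {Φ : A ≌ A} {w : Potential Φ}
  [HasCoproducts.{v} A]

instance hasCoproductsOfShape_nat : HasCoproductsOfShape ℕ A := hasCoproductsOfShape_type_zero ℕ

/-- A coproduct of a sequence of objects. -/
def natDecomposition (X : ℕ → A) : Decomposition (∐ X) X where
  ι := Sigma.ι X
  π := Sigma.π X
  ι_π := Sigma.ι_π_eq_id X
  ι_π_ne _ _ h := Sigma.ι_π_of_ne X h
  hom_ext h := Sigma.hom_ext _ _ h
  exists_desc f := ⟨Sigma.desc f, Sigma.ι_desc f⟩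

namespace Factorization

section sum

variable (τ : ℕ → Factorization w)

/-- The decomposition of the component in degree `-1` of a coproduct. -/
abbrev sumDecompNeg : Decomposition (∐ fun p => (τ p).neg) fun p => (τ p).neg :=
  natDecomposition _

/-- The decomposition of the component in degree `0` of a coproduct. -/
abbrev sumDecompZero : Decomposition (∐ fun p => (τ p).zero) fun p => (τ p).zero :=
  natDecomposition _

/-- The map `φ⁻¹` of a coproduct. -/
def sumφneg : Φ.inverse.obj (∐ fun p => (τ p).zero) ⟶ ∐ fun p => (τ p).neg :=
  ((sumDecompZero τ).map Φ.inverse).desc fun p => (τ p).φneg ≫ (sumDecompNeg τ).ι p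

/-- The map `φ⁰` of a coproduct. -/
def sumφzero : (∐ fun p => (τ p).neg) ⟶ ∐ fun p => (τ p).zero :=
  (sumDecompNeg τ).desc fun p => (τ p).φzero ≫ (sumDecompZero τ).ι p

lemma ι_sumφneg (p : ℕ) : Φ.inverse.map ((sumDecompZero τ).ι p) ≫ sumφneg τ =
    (τ p).φneg ≫ (sumDecompNeg τ).ι p :=
  ((sumDecompZero τ).map Φ.inverse).ι_desc _ p

lemma ι_sumφzero (p : ℕ) : (sumDecompNeg τ).ι p ≫ sumφzero τ =
    (τ p).φzero ≫ (sumDecompZero τ).ι p :=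
  (sumDecompNeg τ).ι_desc _ p

/-- The coproduct of a sequence of factorizations. -/
def sum : Factorization w where
  neg := ∐ fun p => (τ p).neg
  zero := ∐ fun p => (τ p).zero
  φneg := sumφneg τ
  φzero := sumφzero τ
  φneg_φzero := ((sumDecompZero τ).map Φ.inverse).hom_ext fun p => by
    change Φ.inverse.map ((sumDecompZero τ).ι p) ≫ _ = Φ.inverse.map ((sumDecompZero τ).ι p) ≫ _
    rw [reassoc_of% ι_sumφneg τ p, ι_sumφzero, w.invApp_naturality, ← (τ p).φneg_φzero,
      Category.assoc]
  φzero_φneg := by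
    rw [factorization_aux]
    refine ((sumDecompNeg τ).map Φ.inverse).hom_ext fun p => ?_
    change Φ.inverse.map ((sumDecompNeg τ).ι p) ≫ _ = Φ.inverse.map ((sumDecompNeg τ).ι p) ≫ _
    rw [← Functor.map_comp_assoc, ι_sumφzero, w.invApp_naturality,
      ← (τ p).inverse_map_φzero_φneg, Functor.map_comp, Category.assoc, Category.assoc,
      ι_sumφneg]

/-- An expression of a factorization as the coproduct of a sequence of factorizations. -/
structure SumData (S : Factorization w) (τ : ℕ → Factorization w) where
  n : Decomposition S.neg fun p => (τ p).neg
  z : Decomposition S.zero fun p => (τ p).zero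
  ι_φneg : ∀ p, Φ.inverse.map (z.ι p) ≫ S.φneg = (τ p).φneg ≫ n.ι p
  ι_φzero : ∀ p, n.ι p ≫ S.φzero = (τ p).φzero ≫ z.ι p

/-- The components of `sum τ`. -/
def sumData : SumData (sum τ) τ where
  n := sumDecompNeg τ
  z := sumDecompZero τ
  ι_φneg := ι_sumφneg τ
  ι_φzero := ι_sumφzero τ

namespace SumData

variable {τ} {S : Factorization w} (d : SumData S τ)

/-- The inclusion of a summand. -/
def ι (p : ℕ) : τ p ⟶ S :=
  (⟨d.n.ι p, d.z.ι p, (d.ι_φneg p).symm, (d.ι_φzero p).symm⟩ : Hom (τ p) S)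

lemma ι_neg (p : ℕ) : (d.ι p).neg = d.n.ι p := rfl

lemma ι_zero (p : ℕ) : (d.ι p).zero = d.z.ι p := rfl

/-- The morphism out of a coproduct with the given components. -/
def desc {E : Factorization w} (f : ∀ p, τ p ⟶ E) : S ⟶ E :=
  (⟨d.n.desc fun p => (f p).neg, d.z.desc fun p => (f p).zero, by
    refine (d.z.map Φ.inverse).hom_ext fun p => ?_
    rw [Decomposition.map_ι, reassoc_of% d.ι_φneg, Decomposition.ι_desc,
      ← Functor.map_comp_assoc, Decomposition.ι_desc, (f p).comm_neg], by
    refine d.n.hom_ext fun p => ?_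
    rw [reassoc_of% d.ι_φzero, Decomposition.ι_desc, reassoc_of% d.n.ι_desc,
      (f p).comm_zero]⟩ : Hom S E)

lemma ι_desc {E : Factorization w} (f : ∀ p, τ p ⟶ E) (p : ℕ) : d.ι p ≫ d.desc f = f p :=
  hom_ext (d.n.ι_desc _ p) (d.z.ι_desc _ p)

/-- Morphisms out of a coproduct are homotopic if their components are. -/
def homotopy {E : Factorization w} {f g : S ⟶ E}
    (h : ∀ p, Homotopy (d.ι p ≫ f) (d.ι p ≫ g)) : Homotopy f g where
  neg := d.n.desc fun p => (h p).neg
  zero := d.z.desc fun p => (h p).zero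
  eq_neg := d.n.hom_ext fun p => by
    have h' := (h p).eq_neg
    rw [comp_neg, comp_neg, ← Preadditive.comp_sub, ι_neg] at h'
    rw [h', Preadditive.comp_add, reassoc_of% d.ι_φzero, Decomposition.ι_desc,
      reassoc_of% d.n.ι_desc]
  eq_zero := d.z.hom_ext fun p => by
    have h' := (h p).eq_zero
    have e := Φ.counitIso.inv.naturality (d.z.ι p)
    dsimp at e
    rw [comp_zero, comp_zero, ← Preadditive.comp_sub, ι_zero] at h'
    rw [h', Preadditive.comp_add, reassoc_of% d.z.ι_desc, reassoc_of% e,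
      ← Functor.map_comp_assoc _ _ S.φneg, d.ι_φneg, Functor.map_comp_assoc,
      ← Functor.map_comp_assoc _ (d.n.ι p), Decomposition.ι_desc]

/-- The coproduct in the homotopy category. -/
lemma nonempty_isColimit : Nonempty (IsColimit (Cofan.mk ((toK w).obj S)
    fun i : ULift.{v} ℕ => (toK w).map (d.ι i.down))) := by
  -- The functor to the homotopy category is full, so the legs of a cofan lift to morphisms of
  -- factorizations.
  refine ⟨Cofan.IsColimit.mk _ (fun s => (toK w).map (d.desc (E := s.pt.as) fun p =>
    ((toK w).map_surjective (X := τ p) (Y := s.pt.as) (s.inj ⟨p⟩)).choose)) ?_ ?_⟩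
  · intro s i
    refine ((toK w).map_comp _ _).symm.trans ?_
    rw [ι_desc]
    exact ((toK w).map_surjective (X := τ i.down) (Y := s.pt.as) (s.inj i)).choose_spec
  · intro s m hm
    obtain ⟨m', rfl⟩ := (toK w).map_surjective (X := S) (Y := s.pt.as) m
    -- For uniqueness, homotopies chosen on the summands assemble to a homotopy on the coproduct.
    refine CategoryTheory.Quotient.sound _ ⟨d.homotopy fun p => Nonempty.some ?_⟩
    rw [ι_desc]
    refine (Quotient.functor_map_eq_iff (homotopic w) _ _).1 ?_
    refine ((toK w).map_comp _ _).trans ((hm ⟨p⟩).trans ?_)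
    exact ((toK w).map_surjective (X := τ p) (Y := s.pt.as) (s.inj ⟨p⟩)).choose_spec.symm

end SumData

end sum

end Factorization

/-- Closure under coproducts is given for index types in the universe `v`, so the index set `ℕ` is
lifted there. -/
lemma prop_sum {P : ObjectProperty (KFact w)}
    (hP : ∀ J : Type v, P.IsClosedUnderColimitsOfShape (Discrete J)) {τ : ℕ → Factorization w}
    (h : ∀ p, P ((toK w).obj (τ p))) : P ((toK w).obj (Factorization.sum τ)) := by
  have := hP (ULift.{v} ℕ)
  exact P.prop_of_isColimit (Factorization.sumData τ).nonempty_isColimit.some fun i => h _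

end

end MF

/-! ### Filtered factorizations and their subfactorizations τ_p -/

namespace MF

section

variable {A : Type u} [Category.{v} A] [Abelian A] {Φ : A ≌ A} {w : Potential Φ}

/-- A factorization whose components are sums of sequences of objects, such that the structure
maps raise the index by at most `1` and the parts raising the index are exact. -/
structure Filtration (M : Factorization w) (X Y : ℕ → A) where
  n : Decomposition M.neg X
  z : Decomposition M.zero Y
  φzero : ∀ m, n.ι m ≫ M.φzero ≫ z.trunc (m + 2) = n.ι m ≫ M.φzero
  φneg : ∀ m, Φ.inverse.map (z.ι m) ≫ M.φneg ≫ n.trunc (m + 2) =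
    Φ.inverse.map (z.ι m) ≫ M.φneg
  exact_neg : ∀ m, ExactAt (Φ.inverse.map (z.ι m) ≫ M.φneg ≫ n.π (m + 1))
    (n.ι (m + 1) ≫ M.φzero ≫ z.π (m + 2))
  exact_zero : ∀ m, ExactAt (Φ.inverse.map (n.ι m ≫ M.φzero ≫ z.π (m + 1)))
    (Φ.inverse.map (z.ι (m + 1)) ≫ M.φneg ≫ n.π (m + 2))
  mono_neg : Mono (n.ι 0 ≫ M.φzero ≫ z.π 1)
  mono_zero : Mono (Φ.inverse.map (z.ι 0) ≫ M.φneg ≫ n.π 1)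

namespace Filtration

open Factorization

variable {M : Factorization w} {X Y : ℕ → A} (F : Filtration M X Y)

lemma φsharp (m : ℕ) : F.z.ι m ≫ M.φsharp ≫ (F.n.map Φ.functor).trunc (m + 2) =
    F.z.ι m ≫ M.φsharp := by
  apply Φ.inverse.map_injective
  rw [← cancel_mono (Φ.unitIso.inv.app M.neg), F.n.map_trunc, ← comp_φneg_comp, F.φneg,
    Functor.map_comp, Category.assoc, inverse_map_φsharp]

/-- Membership in `τ p` in degree 0 is a condition on M⁰ → Φ(M⁻¹). The exactness assumed for `φ⁻¹`
after `Φ⁻¹` is therefore transposed, `Φ⁻¹` reflecting exactness. -/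
lemma exact_sharp (m : ℕ) : ExactAt (F.n.ι m ≫ M.φzero ≫ F.z.π (m + 1))
    (F.z.ι (m + 1) ≫ M.φsharp ≫ (F.n.map Φ.functor).π (m + 2)) :=
  ExactAt.of_map Φ.inverse ((F.exact_zero m).of_iso (Iso.refl _) (Iso.refl _)
    (Φ.unitIso.symm.app (X (m + 2))) (by simp)
    ((comp_φneg_comp M (F.n.π (m + 2)) (F.z.ι (m + 1))).symm.trans (Category.id_comp _).symm))

lemma mono_sharp : Mono (F.z.ι 0 ≫ M.φsharp ≫ (F.n.map Φ.functor).π 1) := by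
  have := F.mono_zero
  rw [comp_φneg_comp] at this
  have := mono_of_mono (Φ.inverse.map (F.z.ι 0 ≫ M.φsharp ≫ Φ.functor.map (F.n.π 1)))
    (Φ.unitIso.inv.app (X 1))
  exact Φ.inverse.mono_of_mono_map this

/-- The sum of the first `p` summands of `M⁻¹`. -/
def genNeg (p : ℕ) : A := kernel (𝟙 _ - F.n.trunc p)

/-- The sum of the first `p` summands of `M⁰`. -/
def genZero (p : ℕ) : A := kernel (𝟙 _ - F.z.trunc p)

/-- The inclusion of the sum of the first `p` summands. -/
def genNegι (p : ℕ) : F.genNeg p ⟶ M.neg := kernel.ι _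

/-- The inclusion of the sum of the first `p` summands. -/
def genZeroι (p : ℕ) : F.genZero p ⟶ M.zero := kernel.ι _

instance (p : ℕ) : Mono (F.genNegι p) := inferInstanceAs (Mono (kernel.ι _))
instance (p : ℕ) : Mono (F.genZeroι p) := inferInstanceAs (Mono (kernel.ι _))

lemma comp_id_sub {T M : A} {x : T ⟶ M} {e : M ⟶ M} : x ≫ (𝟙 M - e) = 0 ↔ x ≫ e = x := by
  rw [Preadditive.comp_sub, Category.comp_id, sub_eq_zero, eq_comm]

lemma genNegι_trunc (p : ℕ) : F.genNegι p ≫ F.n.trunc p = F.genNegι p :=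
  comp_id_sub.1 (kernel.condition _)

lemma genZeroι_trunc (p : ℕ) : F.genZeroι p ≫ F.z.trunc p = F.genZeroι p :=
  comp_id_sub.1 (kernel.condition _)

lemma exists_genNeg_lift {p : ℕ} {T : A} (x : T ⟶ M.neg) (h : x ≫ F.n.trunc p = x) :
    ∃ l, l ≫ F.genNegι p = x :=
  ⟨kernel.lift _ x (comp_id_sub.2 h), kernel.lift_ι _ _ _⟩

lemma exists_genZero_lift {p : ℕ} {T : A} (x : T ⟶ M.zero) (h : x ≫ F.z.trunc p = x) :
    ∃ l, l ≫ F.genZeroι p = x :=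
  ⟨kernel.lift _ x (comp_id_sub.2 h), kernel.lift_ι _ _ _⟩

lemma comp_map_id_sub {T : A} (G : A ⥤ A) [G.Additive] {M : A} {x : T ⟶ G.obj M} {e : M ⟶ M} :
    x ≫ G.map (𝟙 M - e) = 0 ↔ x ≫ G.map e = x := by
  rw [Functor.map_sub, CategoryTheory.Functor.map_id, comp_id_sub]

lemma exists_inverse_genZero_lift {p : ℕ} {T : A} (x : T ⟶ Φ.inverse.obj M.zero)
    (h : x ≫ Φ.inverse.map (F.z.trunc p) = x) : ∃ l, l ≫ Φ.inverse.map (F.genZeroι p) = x :=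
  exists_inverse_kernel_lift _ x ((comp_map_id_sub Φ.inverse).2 h)

/-- The largest subfactorization contained in the sum of the first `p + 1` summands. -/
def τ (p : ℕ) : Factorization w := M.sub (𝟙 _ - F.n.trunc (p + 1)) (𝟙 _ - F.z.trunc (p + 1))

/-- The inclusion of `τ p`. -/
def j (p : ℕ) : F.τ p ⟶ M := M.subι _ _

instance (p : ℕ) : Mono (F.j p).neg :=
  inferInstanceAs (Mono (M.subι (𝟙 _ - F.n.trunc (p + 1)) (𝟙 _ - F.z.trunc (p + 1))).neg)
instance (p : ℕ) : Mono (F.j p).zero :=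
  inferInstanceAs (Mono (M.subι (𝟙 _ - F.n.trunc (p + 1)) (𝟙 _ - F.z.trunc (p + 1))).zero)

lemma jneg_trunc (p : ℕ) : (F.j p).neg ≫ F.n.trunc (p + 1) = (F.j p).neg :=
  comp_id_sub.1 (M.subNegι_comp _ _)

lemma jzero_trunc (p : ℕ) : (F.j p).zero ≫ F.z.trunc (p + 1) = (F.j p).zero :=
  comp_id_sub.1 (M.subZeroι_comp _ _)

lemma jneg_φzero_trunc (p : ℕ) :
    (F.j p).neg ≫ M.φzero ≫ F.z.trunc (p + 1) = (F.j p).neg ≫ M.φzero := by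
  rw [← reassoc_of% (F.j p).comm_zero, F.jzero_trunc, (F.j p).comm_zero]

lemma jzero_φsharp_trunc (p : ℕ) :
    (F.j p).zero ≫ M.φsharp ≫ (F.n.map Φ.functor).trunc (p + 1) = (F.j p).zero ≫ M.φsharp := by
  rw [F.n.map_trunc, ← reassoc_of% φsharp_naturality (F.j p), ← Functor.map_comp, F.jneg_trunc,
    φsharp_naturality]

lemma exists_τneg_lift {p : ℕ} {T : A} (x : T ⟶ M.neg) (h₁ : x ≫ F.n.trunc (p + 1) = x)
    (h₂ : x ≫ M.φzero ≫ F.z.trunc (p + 1) = x ≫ M.φzero) : ∃ l, l ≫ (F.j p).neg = x :=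
  M.exists_subNeg_lift x (comp_id_sub.2 h₁) (by
    rw [← Category.assoc]
    exact comp_id_sub.2 ((Category.assoc _ _ _).trans h₂))

lemma exists_τzero_lift {p : ℕ} {T : A} (x : T ⟶ M.zero) (h₁ : x ≫ F.z.trunc (p + 1) = x)
    (h₂ : x ≫ M.φsharp ≫ Φ.functor.map (F.n.trunc (p + 1)) = x ≫ M.φsharp) :
    ∃ l, l ≫ (F.j p).zero = x :=
  M.exists_subZero_lift x (comp_id_sub.2 h₁) (by
    rw [← Category.assoc]
    exact (comp_map_id_sub Φ.functor).2 ((Category.assoc _ _ _).trans h₂))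

lemma exists_inverse_τzero_lift {p : ℕ} {T : A} (x : T ⟶ Φ.inverse.obj M.zero)
    (h₁ : x ≫ Φ.inverse.map (F.z.trunc (p + 1)) = x)
    (h₂ : x ≫ M.φneg ≫ F.n.trunc (p + 1) = x ≫ M.φneg) :
    ∃ l, l ≫ Φ.inverse.map (F.j p).zero = x :=
  M.exists_inverse_subZero_lift x ((comp_map_id_sub Φ.inverse).2 h₁) (by
    rw [← Category.assoc]
    exact comp_id_sub.2 ((Category.assoc _ _ _).trans h₂))

/-- The argument with leading terms for Φ⁻¹(M⁰) → M⁻¹ → M⁰. It gives τ_p = F_p + φ(F_p) in degree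
-1, where F_p is the sum of the first `p` summands. -/
lemma exists_neg (p : ℕ) {T : A} (x : T ⟶ M.neg) (h₁ : x ≫ F.n.trunc (p + 1) = x)
    (h₂ : x ≫ M.φzero ≫ F.z.trunc (p + 1) = x ≫ M.φzero) :
    ∃ (T' : A) (π : T' ⟶ T) (_ : Epi π) (y : T' ⟶ Φ.inverse.obj M.zero),
      y ≫ Φ.inverse.map (F.z.trunc p) = y ∧
      (π ≫ x - y ≫ M.φneg) ≫ F.n.trunc p = π ≫ x - y ≫ M.φneg := by
  rw [← F.z.map_trunc]
  exact exists_lift_of_exact_of_filtered (F.z.map Φ.inverse) F.n F.z F.φneg F.φzero F.exact_neg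
    F.mono_neg p x h₁ h₂

lemma exists_zero (p : ℕ) {T : A} (x : T ⟶ M.zero) (h₁ : x ≫ F.z.trunc (p + 1) = x)
    (h₂ : x ≫ M.φsharp ≫ (F.n.map Φ.functor).trunc (p + 1) = x ≫ M.φsharp) :
    ∃ (T' : A) (π : T' ⟶ T) (_ : Epi π) (y : T' ⟶ M.neg), y ≫ F.n.trunc p = y ∧
      (π ≫ x - y ≫ M.φzero) ≫ F.z.trunc p = π ≫ x - y ≫ M.φzero :=
  exists_lift_of_exact_of_filtered F.n F.z (F.n.map Φ.functor) F.φzero F.φsharp F.exact_sharp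
    F.mono_sharp p x h₁ h₂

/-- The lifting of `M⁻¹ → (first p summands)` to `τ p`. -/
lemma exists_θneg (p : ℕ) : ∃ l, l ≫ (F.j p).neg = F.n.trunc p :=
  F.exists_τneg_lift _ (F.n.trunc_trunc (by omega)) (F.n.trunc_comp_of_ι F.z F.φzero p)

/-- The structure maps raise the index by at most one, so the first `p` summands and their images
lie in the first `p + 1`. This is the inclusion of F_p in τ_p. -/
lemma exists_θzero (p : ℕ) : ∃ l, l ≫ (F.j p).zero = F.z.trunc p :=
  F.exists_τzero_lift _ (F.z.trunc_trunc (by omega)) (by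
    rw [← F.n.map_trunc]
    exact F.z.trunc_comp_of_ι (F.n.map Φ.functor) F.φsharp p)

/-- The components in degree `-1` of the filtration by the `τ p`. -/
def interlacedNeg : Interlaced F.n fun p => (F.τ p).neg where
  j p := (F.j p).neg
  θ p := (F.exists_θneg p).choose
  mono_j _ := inferInstance
  j_trunc := F.jneg_trunc
  θ_j p := (F.exists_θneg p).choose_spec

/-- The components in degree `0` of the filtration by the `τ p`. -/
def interlacedZero : Interlaced F.z fun p => (F.τ p).zero where
  j p := (F.j p).zero
  θ p := (F.exists_θzero p).choose
  mono_j _ := inferInstance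
  j_trunc := F.jzero_trunc
  θ_j p := (F.exists_θzero p).choose_spec

/-- The inclusion of `τ p` in `τ (p + 1)`. -/
def s (p : ℕ) : F.τ p ⟶ F.τ (p + 1) :=
  (⟨F.interlacedNeg.s p, F.interlacedZero.s p, by
    have h₁ : F.interlacedNeg.s p ≫ (F.j (p + 1)).neg = (F.j p).neg := F.interlacedNeg.s_j p
    have h₂ : F.interlacedZero.s p ≫ (F.j (p + 1)).zero = (F.j p).zero := F.interlacedZero.s_j p
    rw [← cancel_mono (F.j (p + 1)).neg, Category.assoc, Category.assoc, (F.j (p + 1)).comm_neg,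
      h₁, (F.j p).comm_neg, ← Functor.map_comp_assoc, h₂], by
    have h₁ : F.interlacedNeg.s p ≫ (F.j (p + 1)).neg = (F.j p).neg := F.interlacedNeg.s_j p
    have h₂ : F.interlacedZero.s p ≫ (F.j (p + 1)).zero = (F.j p).zero := F.interlacedZero.s_j p
    rw [← cancel_mono (F.j (p + 1)).zero, Category.assoc, Category.assoc,
      (F.j (p + 1)).comm_zero, h₂, (F.j p).comm_zero, reassoc_of% h₁]⟩ :
    Hom (F.τ p) (F.τ (p + 1)))

/-- The telescope sequence of the filtration by the `τ p`. -/
lemma shortExact_telescope {S : Factorization w} (d : SumData S F.τ) :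
    ShortExact (d.desc fun p => d.ι p - F.s p ≫ d.ι (p + 1)) (d.desc F.j) where
  mono_neg := F.interlacedNeg.mono_δ d.n
  mono_zero := F.interlacedZero.mono_δ d.z
  exact_neg := F.interlacedNeg.exactAt_δ_ε d.n
  exact_zero := F.interlacedZero.exactAt_δ_ε d.z
  epi_neg := F.interlacedNeg.epi_ε d.n
  epi_zero := F.interlacedZero.epi_ε d.z

end Filtration

end

end MF

/-! ### Acyclicity of filtered factorizations -/

namespace MF

section

variable {A : Type u} [Category.{v} A] [Abelian A] {Φ : A ≌ A} {w : Potential Φ}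

section

variable {X Y Z : A} {f : X ⟶ Y} {g : Y ⟶ Z}

lemma ExactAt.of_exists_lift (h : f ≫ g = 0)
    (hl : ∀ {T : A} (y : T ⟶ Y), y ≫ g = 0 → ∃ x, x ≫ f = y) : ExactAt f g := by
  refine ⟨h, (ShortComplex.exact_iff_exact_up_to_refinements _).2 fun T y hy => ?_⟩
  obtain ⟨x, hx⟩ := hl y hy
  exact ⟨T, 𝟙 T, inferInstance, x, (Category.id_comp _).trans hx.symm⟩

lemma epi_of_exists_lift (h : ∀ {T : A} (y : T ⟶ Y),
    ∃ (T' : A) (π : T' ⟶ T) (_ : Epi π) (x : T' ⟶ X), π ≫ y = x ≫ f) : Epi f :=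
  (epi_iff_surjective_up_to_refinements f).2 fun _ y => h y

end

namespace Factorization

/-- Zero factorizations are contractible. -/
def homotopyOfIsZero {E : Factorization w} (h : IsZero E) : Homotopy (𝟙 E) 0 where
  neg := 0
  zero := 0
  eq_neg := (isZero_neg h).eq_of_src _ _
  eq_zero := (isZero_zero' h).eq_of_src _ _

section

variable {T T' : Factorization w} {X Y : A} {a : T.neg ⟶ X} {b : T.zero ⟶ Y} {α : X ⟶ T'.neg}
  {β : Y ⟶ T'.zero}

/-- A criterion for the exactness of `0 → T[-1] → free X Y → T' → 0`. -/
lemma shortExact_free [Mono a] [Mono b]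
    (hn : T.φneg ≫ a ≫ α = Φ.inverse.map (b ≫ β) ≫ T'.φneg)
    (hz : T.φzero ≫ b ≫ β = a ≫ α ≫ T'.φzero)
    (ex_neg : ∀ {W : A} (x : W ⟶ X) (y : W ⟶ Φ.inverse.obj Y),
      x ≫ α + y ≫ Φ.inverse.map β ≫ T'.φneg = 0 →
        ∃ l, l ≫ Φ.inverse.map b = y ∧ -(l ≫ T.φneg ≫ a) = x)
    (ex_zero : ∀ {W : A} (x : W ⟶ Y) (y : W ⟶ X), x ≫ β + y ≫ α ≫ T'.φzero = 0 →
      ∃ l, l ≫ a = y ∧ -(l ≫ T.φzero ≫ b) = x)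
    (ep_neg : ∀ {W : A} (x : W ⟶ T'.neg), ∃ (W' : A) (π : W' ⟶ W) (_ : Epi π) (y : W' ⟶ X)
      (z : W' ⟶ Φ.inverse.obj Y), π ≫ x = y ≫ α + z ≫ Φ.inverse.map β ≫ T'.φneg)
    (ep_zero : ∀ {W : A} (x : W ⟶ T'.zero), ∃ (W' : A) (π : W' ⟶ W) (_ : Epi π) (y : W' ⟶ Y)
      (z : W' ⟶ X), π ≫ x = y ≫ β + z ≫ α ≫ T'.φzero) :
    ShortExact (unshiftToFree a b) (freeDesc (w := w) α β) where
  mono_neg := by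
    have : Mono (biprod.lift (-(T.φneg ≫ a)) (Φ.inverse.map b)) :=
      mono_of_mono_fac (biprod.lift_snd _ _)
    exact this
  mono_zero := by
    have : Mono (biprod.lift (-(T.φzero ≫ b)) a) := mono_of_mono_fac (biprod.lift_snd _ _)
    exact this
  exact_neg := by
    have : ExactAt (biprod.lift (-(T.φneg ≫ a)) (Φ.inverse.map b))
        (biprod.desc α (Φ.inverse.map β ≫ T'.φneg)) := by
      refine ExactAt.of_exists_lift ?_ fun {W} x hx => ?_
      · rw [biprod.lift_desc, Preadditive.neg_comp, Category.assoc, hn, Functor.map_comp,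
          Category.assoc, neg_add_cancel]
      · obtain ⟨l, h₁, h₂⟩ := ex_neg (x ≫ biprod.fst) (x ≫ biprod.snd) (by
          rw [← hx, biprod.desc_eq, Preadditive.comp_add]
          simp only [Category.assoc])
        refine ⟨l, ?_⟩
        apply biprod.hom_ext
        · rw [Category.assoc, biprod.lift_fst, Preadditive.comp_neg, h₂]
        · rw [Category.assoc, biprod.lift_snd, h₁]
    exact this
  exact_zero := by
    have : ExactAt (biprod.lift (-(T.φzero ≫ b)) a) (biprod.desc β (α ≫ T'.φzero)) := by
      refine ExactAt.of_exists_lift ?_ fun {W} x hx => ?_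
      · rw [biprod.lift_desc, Preadditive.neg_comp, Category.assoc, hz, neg_add_cancel]
      · obtain ⟨l, h₁, h₂⟩ := ex_zero (x ≫ biprod.fst) (x ≫ biprod.snd) (by
          rw [← hx, biprod.desc_eq, Preadditive.comp_add]
          simp only [Category.assoc])
        refine ⟨l, ?_⟩
        apply biprod.hom_ext
        · rw [Category.assoc, biprod.lift_fst, Preadditive.comp_neg, h₂]
        · rw [Category.assoc, biprod.lift_snd, h₁]
    exact this
  epi_neg := by
    have : Epi (biprod.desc α (Φ.inverse.map β ≫ T'.φneg)) :=
      epi_of_exists_lift fun {W} x => by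
        obtain ⟨W', π, hπ, y, z, h⟩ := ep_neg x
        exact ⟨W', π, hπ, biprod.lift y z, by rw [h, biprod.lift_desc]⟩
    exact this
  epi_zero := by
    have : Epi (biprod.desc β (α ≫ T'.φzero)) :=
      epi_of_exists_lift fun {W} x => by
        obtain ⟨W', π, hπ, y, z, h⟩ := ep_zero x
        exact ⟨W', π, hπ, biprod.lift y z, by rw [h, biprod.lift_desc]⟩
    exact this

end

end Factorization

namespace Filtration

open Factorization

variable {M : Factorization w} {X Y : ℕ → A} (F : Filtration M X Y)

lemma isZero_of_mono_of_exists {Z W : A} (i : Z ⟶ W) [Mono i]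
    (h : ∃ (T : A) (π : T ⟶ Z) (_ : Epi π), π ≫ i = 0) : IsZero Z := by
  obtain ⟨T, π, hπ, h⟩ := h
  rw [IsZero.iff_id_eq_zero, ← cancel_mono i, ← cancel_epi π, Category.id_comp, h,
    Limits.zero_comp, Limits.comp_zero]

/-- With `p = 0` there are no earlier summands: both the correction `y` and the remainder are zero,
so the inclusion of `τ 0` vanishes after an epimorphism. -/
lemma isZero_τ_zero : IsZero (F.τ 0) := by
  apply isZero_of_components
  · obtain ⟨T, π, hπ, y, h₁, h₂⟩ := F.exists_neg 0 _ (F.jneg_trunc 0) (F.jneg_φzero_trunc 0)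
    rw [Decomposition.trunc_zero, Limits.comp_zero] at h₂
    rw [Decomposition.trunc_zero, Functor.map_zero, Limits.comp_zero] at h₁
    rw [← h₁, Limits.zero_comp, _root_.sub_zero] at h₂
    exact isZero_of_mono_of_exists (F.j 0).neg ⟨T, π, hπ, h₂.symm⟩
  · obtain ⟨T, π, hπ, y, h₁, h₂⟩ := F.exists_zero 0 _ (F.jzero_trunc 0) (F.jzero_φsharp_trunc 0)
    rw [Decomposition.trunc_zero, Limits.comp_zero] at h₁ h₂
    rw [← h₁, Limits.zero_comp, _root_.sub_zero] at h₂
    exact isZero_of_mono_of_exists (F.j 0).zero ⟨T, π, hπ, h₂.symm⟩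

/-- Let F be the sum of the first `p + 1` summands. Since τ_{p+1} = F + φ(F), the free factorization
on F maps onto τ_{p+1}. In a relation x + φ(y) = 0 with x, y in F, the element y satisfies φ(y) ∈ F,
that is y ∈ τ_p, and it determines x. So the kernel is τ_p[-1]. -/
lemma exists_shortExact (p : ℕ) : ∃ (f : (F.τ p).unshiftObj ⟶ free w (F.genNeg (p + 1))
    (F.genZero (p + 1))) (g : free w (F.genNeg (p + 1)) (F.genZero (p + 1)) ⟶ F.τ (p + 1)),
    ShortExact f g := by
  obtain ⟨a, ha⟩ := F.exists_genNeg_lift _ (F.jneg_trunc p)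
  obtain ⟨b, hb⟩ := F.exists_genZero_lift _ (F.jzero_trunc p)
  obtain ⟨θn, hθn⟩ := F.exists_θneg (p + 1)
  obtain ⟨θz, hθz⟩ := F.exists_θzero (p + 1)
  -- The generators are included in `τ (p + 1)` by `α` and `β`, and `a`, `b` include `τ p` in the
  -- generators.
  obtain ⟨α, hα⟩ : ∃ α, α ≫ (F.j (p + 1)).neg = F.genNegι (p + 1) :=
    ⟨F.genNegι (p + 1) ≫ θn, by rw [Category.assoc, hθn, F.genNegι_trunc]⟩
  obtain ⟨β, hβ⟩ : ∃ β, β ≫ (F.j (p + 1)).zero = F.genZeroι (p + 1) :=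
    ⟨F.genZeroι (p + 1) ≫ θz, by rw [Category.assoc, hθz, F.genZeroι_trunc]⟩
  have : Mono a := mono_of_mono_fac ha
  have : Mono b := mono_of_mono_fac hb
  have eneg : Φ.inverse.map β ≫ (F.τ (p + 1)).φneg ≫ (F.j (p + 1)).neg =
      Φ.inverse.map (F.genZeroι (p + 1)) ≫ M.φneg := by
    rw [(F.j (p + 1)).comm_neg, ← Functor.map_comp_assoc, hβ]
  have ezero : α ≫ (F.τ (p + 1)).φzero ≫ (F.j (p + 1)).zero =
      F.genNegι (p + 1) ≫ M.φzero := by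
    rw [(F.j (p + 1)).comm_zero, reassoc_of% hα]
  refine ⟨unshiftToFree a b, freeDesc α β, shortExact_free ?_ ?_ ?_ ?_ ?_ ?_⟩
  · rw [← cancel_mono (F.j (p + 1)).neg, Functor.map_comp]
    simp only [Category.assoc]
    rw [hα, ha, eneg, ← Functor.map_comp_assoc, hb, (F.j p).comm_neg]
  · rw [← cancel_mono (F.j (p + 1)).zero]
    simp only [Category.assoc]
    rw [hβ, hb, ezero, reassoc_of% ha, (F.j p).comm_zero]
  · intro W x y h
    have h' := h =≫ (F.j (p + 1)).neg
    simp only [Preadditive.add_comp, Category.assoc, Limits.zero_comp] at h'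
    rw [hα, eneg] at h'
    -- By the relation the image of `y` under `φ⁻¹` is minus a map into the first `p + 1` summands,
    -- which is the condition for `y` to lie in `τ p`.
    obtain ⟨l, hl⟩ := F.exists_inverse_τzero_lift (p := p) (y ≫ Φ.inverse.map (F.genZeroι (p + 1)))
      (by rw [Category.assoc, ← Functor.map_comp, F.genZeroι_trunc]) (by
        rw [Category.assoc, ← Category.assoc, ← Category.assoc, Category.assoc y,
          eq_neg_of_add_eq_zero_right h', Preadditive.neg_comp, Category.assoc, F.genNegι_trunc])
    refine ⟨l, ?_, ?_⟩
    · rw [← cancel_mono (Φ.inverse.map (F.genZeroι (p + 1))), Category.assoc,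
        ← Functor.map_comp, hb, hl]
    · rw [← cancel_mono (F.genNegι (p + 1)), Preadditive.neg_comp, Category.assoc, Category.assoc,
        ha, (F.j p).comm_neg, reassoc_of% hl]
      exact (eq_neg_of_add_eq_zero_left h').symm
  · intro W x y h
    have h' := h =≫ (F.j (p + 1)).zero
    simp only [Preadditive.add_comp, Category.assoc, Limits.zero_comp] at h'
    rw [hβ, ezero] at h'
    obtain ⟨l, hl⟩ := F.exists_τneg_lift (p := p) (y ≫ F.genNegι (p + 1))
      (by rw [Category.assoc, F.genNegι_trunc]) (by
        rw [Category.assoc, ← Category.assoc, ← Category.assoc, Category.assoc y,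
          eq_neg_of_add_eq_zero_right h', Preadditive.neg_comp, Category.assoc, F.genZeroι_trunc])
    refine ⟨l, ?_, ?_⟩
    · rw [← cancel_mono (F.genNegι (p + 1)), Category.assoc, ha, hl]
    · rw [← cancel_mono (F.genZeroι (p + 1)), Preadditive.neg_comp, Category.assoc, Category.assoc,
        hb, (F.j p).comm_zero, reassoc_of% hl]
      exact (eq_neg_of_add_eq_zero_left h').symm
  · intro W x
    -- Locally `x` is the image under `φ⁻¹` of a `y` among the generators, plus a remainder `z`
    -- among the generators.
    obtain ⟨W', π, hπ, y, h₁, h₂⟩ := F.exists_neg (p + 1) (x ≫ (F.j (p + 1)).neg)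
      (by rw [Category.assoc, F.jneg_trunc]) (by
        rw [Category.assoc, F.jneg_φzero_trunc, Category.assoc])
    obtain ⟨y', hy'⟩ := F.exists_inverse_genZero_lift y h₁
    obtain ⟨z, hz⟩ := F.exists_genNeg_lift _ h₂
    refine ⟨W', π, hπ, z, y', ?_⟩
    rw [← cancel_mono (F.j (p + 1)).neg]
    simp only [Preadditive.add_comp, Category.assoc]
    rw [hα, eneg, hz, reassoc_of% hy', sub_add_cancel]
  · intro W x
    obtain ⟨W', π, hπ, y, h₁, h₂⟩ := F.exists_zero (p + 1) (x ≫ (F.j (p + 1)).zero)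
      (by rw [Category.assoc, F.jzero_trunc]) (by
        rw [Category.assoc, F.jzero_φsharp_trunc, Category.assoc])
    obtain ⟨y', hy'⟩ := F.exists_genNeg_lift y h₁
    obtain ⟨z, hz⟩ := F.exists_genZero_lift _ h₂
    refine ⟨W', π, hπ, z, y', ?_⟩
    rw [← cancel_mono (F.j (p + 1)).zero]
    simp only [Preadditive.add_comp, Category.assoc]
    rw [hβ, ezero, hz, reassoc_of% hy', sub_add_cancel]

variable [HasCoproducts.{v} A] {P : ObjectProperty (KFact w)} (hP : IsThick P)
  (hT : ∀ K : CochainComplex (Factorization w) ℤ, IsBoundedExact K → P ((toK w).obj (tot K)))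

include F hP hT

/-- In the sequence of `exists_shortExact` the middle term is contractible and the first is a
translate of `τ p`, so membership passes from `τ p` to `τ (p + 1)`. -/
lemma prop_τ (p : ℕ) : P ((toK w).obj (F.τ p)) := by
  induction p with
  | zero => exact hP.of_contractible (homotopyOfIsZero F.isZero_τ_zero)
  | succ p ih =>
    obtain ⟨f, g, h⟩ := F.exists_shortExact p
    exact hP.of_shortExact hT h (hP.unshift _ ih) (hP.of_contractible (freeHomotopy _ _))

/-- A factorization with a filtration belongs to every localizing subcategory containing the
totalizations of the bounded exact complexes. -/
lemma prop_of_coproducts (hC : ∀ J : Type v, P.IsClosedUnderColimitsOfShape (Discrete J)) :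
    P ((toK w).obj M) :=
  have h := prop_sum hC (F.prop_τ hP hT)
  hP.of_shortExact hT (F.shortExact_telescope (sumData F.τ)) h h

/-- A factorization with a finite filtration belongs to every thick subcategory containing the
totalizations of the bounded exact complexes. -/
lemma prop_of_finite (N : ℕ) (hX : ∀ n, N ≤ n → IsZero (X n)) (hY : ∀ n, N ≤ n → IsZero (Y n)) :
    P ((toK w).obj M) := by
  obtain ⟨θn, hθn⟩ := F.exists_θneg N
  obtain ⟨θz, hθz⟩ := F.exists_θzero N
  rw [F.n.trunc_eq_id hX] at hθn
  rw [F.z.trunc_eq_id hY] at hθz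
  -- The truncation at `N` is the identity, so `θ` splits the inclusion of `τ N`.
  refine hP.of_retract (⟨θn, θz, ?_, ?_⟩ : Hom M (F.τ N)) (F.j N) (hom_ext hθn hθz)
    (F.prop_τ hP hT N)
  · rw [← cancel_mono (F.j N).neg, Category.assoc, Category.assoc, (F.j N).comm_neg, hθn,
      ← Functor.map_comp_assoc, hθz, CategoryTheory.Functor.map_id, Category.comp_id,
      Category.id_comp]
  · rw [← cancel_mono (F.j N).zero, Category.assoc, Category.assoc, (F.j N).comm_zero, hθz,
      reassoc_of% hθn, Category.comp_id]

end Filtration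

end

end MF

/-! ### The cone of a coaugmentation -/

namespace MF

section

variable {A : Type u} [Category.{v} A] [Abelian A]

namespace Decomposition

variable {M : A} {X : ℕ → A} (P : Decomposition M X) (Y : A)

lemma inl_cons_trunc (k : ℕ) : biprod.inl ≫ (P.cons Y).trunc (k + 1) = biprod.inl :=
  (P.cons Y).ι_trunc (Nat.succ_pos k)

lemma inr_cons_trunc (k : ℕ) :
    biprod.inr ≫ (P.cons Y).trunc (k + 1) = P.trunc k ≫ biprod.inr := by
  refine P.hom_ext fun n => ?_
  have h : (P.ι n ≫ biprod.inr) ≫ (P.cons Y).trunc (k + 1) =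
      P.ι n ≫ P.trunc k ≫ biprod.inr := by
    by_cases hn : n < k
    · rw [← Category.assoc (P.ι n) (P.trunc k), P.ι_trunc hn]
      exact (P.cons Y).ι_trunc (n := n + 1) (by omega)
    · rw [← Category.assoc (P.ι n) (P.trunc k), P.ι_trunc_of_le (by omega), zero_comp]
      exact (P.cons Y).ι_trunc_of_le (n := n + 1) (by omega)
  rw [← h, Category.assoc]

end Decomposition

variable {Φ : A ≌ A} {w : Potential Φ}

open Factorization

/-- A morphism `g : E ⟶ I` of factorizations such that the components of `I` are sums of sequences
of objects, the maps raising the index by `1` form resolutions, and `g` is the augmentation. -/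
structure Coaugmentation {E I : Factorization w} (g : E ⟶ I) (X Y : ℕ → A) where
  n : Decomposition I.neg X
  z : Decomposition I.zero Y
  a : E.neg ⟶ X 0
  b : E.zero ⟶ Y 0
  neg_eq : g.neg = a ≫ n.ι 0
  zero_eq : g.zero = b ≫ z.ι 0
  φzero : ∀ m, n.ι m ≫ I.φzero ≫ z.trunc (m + 2) = n.ι m ≫ I.φzero
  φneg : ∀ m, Φ.inverse.map (z.ι m) ≫ I.φneg ≫ n.trunc (m + 2) =
    Φ.inverse.map (z.ι m) ≫ I.φneg
  mono_a : Mono a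
  mono_b : Mono b
  exact_a : ExactAt a (n.ι 0 ≫ I.φzero ≫ z.π 1)
  exact_b : ExactAt (Φ.inverse.map b) (Φ.inverse.map (z.ι 0) ≫ I.φneg ≫ n.π 1)
  exact_neg : ∀ m, ExactAt (Φ.inverse.map (z.ι m) ≫ I.φneg ≫ n.π (m + 1))
    (n.ι (m + 1) ≫ I.φzero ≫ z.π (m + 2))
  exact_zero : ∀ m, ExactAt (Φ.inverse.map (n.ι m ≫ I.φzero ≫ z.π (m + 1)))
    (Φ.inverse.map (z.ι (m + 1)) ≫ I.φneg ≫ n.π (m + 2))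

namespace Coaugmentation

variable {E I : Factorization w} {g : E ⟶ I} {X Y : ℕ → A} (C : Coaugmentation g X Y)

/-- The leading part of the cone from index 0 to index 1 is the augmentation itself. So the leading
parts of the cone form the coaugmented resolutions. -/
lemma inl_up_zero : biprod.inl ≫ coneφzero g ≫ biprod.snd ≫ C.z.π 0 = C.b := by
  rw [reassoc_of% inl_coneφzero g, Preadditive.add_comp, Preadditive.neg_comp, Category.assoc,
    Category.assoc, biprod.inl_snd_assoc, biprod.inr_snd_assoc, Limits.zero_comp,
    Limits.comp_zero, _root_.neg_zero, _root_.zero_add, C.zero_eq, Category.assoc, C.z.ι_π,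
    Category.comp_id]

lemma inl_up_neg : Φ.inverse.map biprod.inl ≫ coneφneg g ≫ biprod.snd ≫ C.n.π 0 =
    Φ.unitIso.inv.app E.neg ≫ C.a := by
  rw [reassoc_of% inl_coneφneg g, Preadditive.add_comp, Preadditive.neg_comp, Category.assoc,
    Category.assoc, biprod.inl_snd_assoc, biprod.inr_snd_assoc, Limits.zero_comp,
    Limits.comp_zero, _root_.neg_zero, _root_.zero_add, C.neg_eq, Category.assoc, C.n.ι_π,
    Category.comp_id]

lemma inr_up_zero (m k : ℕ) : (C.n.ι m ≫ biprod.inr) ≫ coneφzero g ≫ biprod.snd ≫ C.z.π k =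
    C.n.ι m ≫ I.φzero ≫ C.z.π k := by
  rw [Category.assoc, reassoc_of% inr_coneφzero g, biprod.inr_snd_assoc]

lemma inr_up_neg (m k : ℕ) : Φ.inverse.map (C.z.ι m ≫ biprod.inr) ≫ coneφneg g ≫ biprod.snd ≫
    C.n.π k = Φ.inverse.map (C.z.ι m) ≫ I.φneg ≫ C.n.π k := by
  rw [Functor.map_comp, Category.assoc, reassoc_of% inr_coneφneg g, biprod.inr_snd_assoc]

lemma inl_φzero : biprod.inl ≫ coneφzero g ≫ (C.z.cons (Φ.functor.obj E.neg)).trunc 2 =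
    biprod.inl ≫ coneφzero g := by
  have h : C.z.ι 0 ≫ C.z.trunc 1 = C.z.ι 0 := C.z.ι_trunc (by omega)
  rw [reassoc_of% inl_coneφzero g, inl_coneφzero, Preadditive.add_comp, Preadditive.neg_comp,
    Category.assoc, Category.assoc, C.z.inl_cons_trunc, C.z.inr_cons_trunc, C.zero_eq,
    Category.assoc, Category.assoc, reassoc_of% h]

lemma inl_φneg : Φ.inverse.map biprod.inl ≫ coneφneg g ≫ (C.n.cons E.zero).trunc 2 =
    Φ.inverse.map biprod.inl ≫ coneφneg g := by
  have h : C.n.ι 0 ≫ C.n.trunc 1 = C.n.ι 0 := C.n.ι_trunc (by omega)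
  rw [reassoc_of% inl_coneφneg g, inl_coneφneg, Preadditive.add_comp, Preadditive.neg_comp,
    Category.assoc, Category.assoc, C.n.inl_cons_trunc, C.n.inr_cons_trunc, C.neg_eq,
    Category.assoc, Category.assoc, reassoc_of% h]

lemma inr_φzero (m : ℕ) : (C.n.ι m ≫ biprod.inr) ≫ coneφzero g ≫
    (C.z.cons (Φ.functor.obj E.neg)).trunc (m + 3) = (C.n.ι m ≫ biprod.inr) ≫ coneφzero g := by
  rw [Category.assoc, Category.assoc, reassoc_of% inr_coneφzero g, inr_coneφzero,
    C.z.inr_cons_trunc, reassoc_of% C.φzero]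

lemma inr_φneg (m : ℕ) : Φ.inverse.map (C.z.ι m ≫ biprod.inr) ≫ coneφneg g ≫
    (C.n.cons E.zero).trunc (m + 3) = Φ.inverse.map (C.z.ι m ≫ biprod.inr) ≫ coneφneg g := by
  rw [Functor.map_comp, Category.assoc, Category.assoc, reassoc_of% inr_coneφneg g, inr_coneφneg,
    C.n.inr_cons_trunc, reassoc_of% C.φneg]

lemma cone_exact_neg_zero : ExactAt (Φ.inverse.map biprod.inl ≫ coneφneg g ≫ biprod.snd ≫ C.n.π 0)
    ((C.n.ι 0 ≫ biprod.inr) ≫ coneφzero g ≫ biprod.snd ≫ C.z.π 1) := by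
  rw [inl_up_neg, inr_up_zero]
  exact C.exact_a.of_iso (Φ.unitIso.symm.app E.neg) (Iso.refl _) (Iso.refl _)
    (Category.comp_id _) ((Category.comp_id _).trans (Category.id_comp _).symm)

lemma cone_exact_neg_succ (m : ℕ) : ExactAt (Φ.inverse.map (C.z.ι m ≫ biprod.inr) ≫ coneφneg g ≫
    biprod.snd ≫ C.n.π (m + 1))
    ((C.n.ι (m + 1) ≫ biprod.inr) ≫ coneφzero g ≫ biprod.snd ≫ C.z.π (m + 2)) := by
  rw [inr_up_neg, inr_up_zero]
  exact C.exact_neg m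

lemma cone_exact_zero_zero :
    ExactAt (Φ.inverse.map (biprod.inl ≫ coneφzero g ≫ biprod.snd ≫ C.z.π 0))
      (Φ.inverse.map (C.z.ι 0 ≫ biprod.inr) ≫ coneφneg g ≫ biprod.snd ≫ C.n.π 1) := by
  rw [inl_up_zero, inr_up_neg]
  exact C.exact_b

lemma cone_exact_zero_succ (m : ℕ) :
    ExactAt (Φ.inverse.map ((C.n.ι m ≫ biprod.inr) ≫ coneφzero g ≫ biprod.snd ≫ C.z.π (m + 1)))
      (Φ.inverse.map (C.z.ι (m + 1) ≫ biprod.inr) ≫ coneφneg g ≫ biprod.snd ≫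
        C.n.π (m + 2)) := by
  rw [inr_up_zero, inr_up_neg]
  exact C.exact_zero m

/-- The filtration of the cone of a coaugmentation. -/
def filtration : Filtration (cone g) (Decomposition.consSeq E.zero X)
    (Decomposition.consSeq (Φ.functor.obj E.neg) Y) where
  n := C.n.cons E.zero
  z := C.z.cons (Φ.functor.obj E.neg)
  φzero
    | 0 => C.inl_φzero
    | m + 1 => C.inr_φzero m
  φneg
    | 0 => C.inl_φneg
    | m + 1 => C.inr_φneg m
  exact_neg
    | 0 => C.cone_exact_neg_zero
    | m + 1 => C.cone_exact_neg_succ m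
  exact_zero
    | 0 => C.cone_exact_zero_zero
    | m + 1 => C.cone_exact_zero_succ m
  -- Index 0 of the component of the cone in degree -1 is `E⁰`, so its leading map is the
  -- augmentation `b`, not `a`.
  mono_neg := by
    have h : Mono (biprod.inl ≫ coneφzero g ≫ biprod.snd ≫ C.z.π 0) := by
      rw [inl_up_zero]
      exact C.mono_b
    exact h
  mono_zero := by
    have h : Mono (Φ.inverse.map biprod.inl ≫ coneφneg g ≫ biprod.snd ≫ C.n.π 0) := by
      rw [inl_up_neg]
      have := C.mono_a
      infer_instance
    exact h

variable [HasCoproducts.{v} A]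

include C

lemma isCoQuasiIso : IsCoQuasiIso g := by
  refine MorphismProperty.Q_inverts (coneIn (coacyclic w)) ((toK w).map g) ⟨g, rfl, ?_⟩
  intro P hP hC hT
  exact C.filtration.prop_of_coproducts hP hT hC

lemma isQuasiIso (N : ℕ) (hX : ∀ n, N ≤ n → IsZero (X n)) (hY : ∀ n, N ≤ n → IsZero (Y n)) :
    IsQuasiIso g := by
  refine MorphismProperty.Q_inverts (coneIn (totallyAcyclic w)) ((toK w).map g) ⟨g, rfl, ?_⟩
  intro P hP hT
  -- The summands of `I` are moved up by one index in the cone, index 0 being taken by E[1].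
  refine C.filtration.prop_of_finite hP hT (N + 1) ?_ ?_ <;> rintro (_ | n) hn
  · omega
  · exact hX n (by omega)
  · omega
  · exact hY n (by omega)

end Coaugmentation

end

end MF

namespace MF

/-! ## The coaugmentation of the folding -/

namespace ResolutionData

open Sum

variable {A : Type u} [Category.{v} A] [Abelian A] [HasCoproducts.{v} A] {Φ : A ≌ A}
  {w : Potential Φ} {E : Factorization w} {D : ResolutionData E}
  {c : ∀ m r, (rootInv Φ).obj (D.term (idx m)) ⟶ D.term (idx r)}

lemma sum_row_trunc {T Y : A} {X : ℕ → A} (P : Decomposition T X) (b : ∀ s, Y ⟶ X s) (m : ℕ) :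
    (∑ r ∈ Finset.range m, b r ≫ P.ι r) ≫ P.trunc m = ∑ r ∈ Finset.range m, b r ≫ P.ι r := by
  rw [Preadditive.sum_comp]
  refine Finset.sum_congr rfl fun r hr => ?_
  rw [Category.assoc, P.ι_trunc (Finset.mem_range.1 hr)]

lemma ι_foldNeg_trunc (m : ℕ) : Φ.inverse.map (D.decompZero.ι m) ≫ foldNeg c ≫
    D.decompNeg.trunc (m + 2) = Φ.inverse.map (D.decompZero.ι m) ≫ foldNeg c := by
  rw [reassoc_of% ι_foldNeg, ι_foldNeg, sum_row_trunc]

lemma ι_foldZero_trunc (m : ℕ) : D.decompNeg.ι m ≫ foldZero c ≫ D.decompZero.trunc (m + 2) =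
    D.decompNeg.ι m ≫ foldZero c := by
  rw [reassoc_of% ι_foldZero, ι_foldZero, sum_row_trunc]

section

variable (hc : D.tridiagonal.Extends c)

include hc

/-- The components of the folding raising the degree by one are the prescribed differentials, so the
leading parts are exact whatever the entries constructed below the diagonals are. -/
lemma exactAt_fold_neg (m : ℕ) :
    ExactAt (Φ.inverse.map (D.decompZero.ι m) ≫ foldNeg c ≫ D.decompNeg.π (m + 1))
      (D.decompNeg.ι (m + 1) ≫ foldZero c ≫ D.decompZero.π (m + 2)) := by
  rw [ι_foldNeg_π hc, ι_foldZero_π hc]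
  have h₁ : entryNeg c m (m + 1) = (D.up (idx m)).1 := congrArg Prod.fst (hc.up m)
  have h₂ : entryZero c (m + 1) (m + 2) = (D.up (nxt (idx m))).2 :=
    congrArg Prod.snd (hc.up (m + 1))
  rw [h₁, h₂]
  exact D.exactAt_up_snd (idx m)

lemma exactAt_fold_zero (m : ℕ) :
    ExactAt (Φ.inverse.map (D.decompNeg.ι m ≫ foldZero c ≫ D.decompZero.π (m + 1)))
      (Φ.inverse.map (D.decompZero.ι (m + 1)) ≫ foldNeg c ≫ D.decompNeg.π (m + 2)) := by
  rw [ι_foldNeg_π hc, ι_foldZero_π hc]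
  have h₁ : entryZero c m (m + 1) = (D.up (idx m)).2 := congrArg Prod.snd (hc.up m)
  have h₂ : entryNeg c (m + 1) (m + 2) = (D.up (nxt (idx m))).1 :=
    congrArg Prod.fst (hc.up (m + 1))
  rw [h₁, h₂]
  exact D.exactAt_up_fst (idx m)

lemma exactAt_augNeg :
    ExactAt D.augNeg (D.decompNeg.ι 0 ≫ foldZero c ≫ D.decompZero.π 1) := by
  rw [ι_foldZero_π hc]
  have h : entryZero c 0 1 = D.Rm.cocomplex.d 0 1 := congrArg Prod.snd (hc.up 0)
  rw [h]
  exact exactAt_aug D.Rm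

lemma exactAt_augZero : ExactAt (Φ.inverse.map D.augZero)
    (Φ.inverse.map (D.decompZero.ι 0) ≫ foldNeg c ≫ D.decompNeg.π 1) := by
  rw [ι_foldNeg_π hc]
  have h : entryNeg c 0 1 = Φ.inverse.map (-D.Rz.cocomplex.d 0 1) :=
    (congrArg Prod.fst (hc.up 0)).trans
      (negPowSucc_zero_comp (Φ.inverse.map (-D.Rz.cocomplex.d 0 1)))
  rw [h]
  exact (exactAt_aug D.Rz).neg_right.map Φ.inverse

end

/-- The folding as a coaugmented factorization. -/
def coaugmentation (hc : D.tridiagonal.Extends c)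
    (hs : ∀ m r, m ≠ r → Tridiagonal.sq c m r = 0) :
    Coaugmentation (toFolding hc hs)
      (fun n => summandNeg Φ D.Rm.cocomplex D.Rz.cocomplex (idx n))
      (fun n => summandZero Φ D.Rm.cocomplex D.Rz.cocomplex (idx n)) where
  n := D.decompNeg
  z := D.decompZero
  a := D.augNeg
  b := D.augZero
  neg_eq := rfl
  zero_eq := rfl
  φzero := ι_foldZero_trunc
  φneg := ι_foldNeg_trunc
  mono_a := mono_aug D.Rm
  mono_b := mono_aug D.Rz
  exact_a := exactAt_augNeg hc
  exact_b := exactAt_augZero hc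
  exact_neg := exactAt_fold_neg hc
  exact_zero := exactAt_fold_zero hc

lemma isZero_summandNeg {N : ℕ} (hm : ∀ i, N < i → IsZero (D.Rm.cocomplex.X i))
    (hz : ∀ i, N < i → IsZero (D.Rz.cocomplex.X i)) (p : ℕ ⊕ ℕ) (hp : N < deg p) :
    IsZero (summandNeg Φ D.Rm.cocomplex D.Rz.cocomplex p) := by
  rcases p with l | l
  · exact (negPow Φ l).map_isZero (hm _ hp)
  · exact (negPow Φ (l + 1)).map_isZero (hz _ hp)

lemma isZero_summandZero {N : ℕ} (hm : ∀ i, N < i → IsZero (D.Rm.cocomplex.X i))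
    (hz : ∀ i, N < i → IsZero (D.Rz.cocomplex.X i)) (p : ℕ ⊕ ℕ) (hp : N < deg p) :
    IsZero (summandZero Φ D.Rm.cocomplex D.Rz.cocomplex p) := by
  rcases p with l | l
  · exact (negPow Φ l).map_isZero (hz _ hp)
  · exact (negPow Φ l).map_isZero (hm _ hp)

lemma isQuasiIso_toFolding (hc : D.tridiagonal.Extends c)
    (hs : ∀ m r, m ≠ r → Tridiagonal.sq c m r = 0) (hm : IsFiniteResolution D.Rm)
    (hz : IsFiniteResolution D.Rz) : IsQuasiIso (toFolding hc hs) := by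
  obtain ⟨a, ha⟩ := hm
  obtain ⟨b, hb⟩ := hz
  -- Finiteness of a resolution says that the terms vanish strictly beyond `a` or `b`, whereas here
  -- they must vanish from the bound on; hence the `+ 1`.
  refine (coaugmentation hc hs).isQuasiIso (max a b + 1) (fun n hn => ?_) (fun n hn => ?_)
  · exact isZero_summandNeg (N := max a b) (fun i hi => ha i (by omega))
      (fun i hi => hb i (by omega)) _ (by rw [deg_idx]; omega)
  · exact isZero_summandZero (N := max a b) (fun i hi => ha i (by omega))
      (fun i hi => hb i (by omega)) _ (by rw [deg_idx]; omega)

end ResolutionData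

end MF

/-! ### The theorem -/

open MF Sum in
theorem mainTheorem1 {A : Type u} [Category.{v} A] [Abelian A] [HasCoproducts.{v} A]
    [EnoughInjectives A] (Φ : A ≌ A) (w : Potential Φ) (E : Factorization w)
    (D : ResolutionData E) :
    ∃ (I : Folding w D.Rm.cocomplex D.Rz.cocomplex) (d₀ : E ⟶ I.toFactorization),
      IsCoQuasiIso d₀ ∧
      -- diagonal components
      (∀ l : ℕ, compNeg I.φneg (inr l) (inr l) =
        (negPow Φ (l + 1)).map (D.liftZero (2 * l + 1))) ∧
      (∀ l : ℕ, compNeg I.φneg (inl l) (inl l) = (negPow Φ l).map (D.liftNeg (2 * l))) ∧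
      (∀ l : ℕ, compZero I.φzero (inr l) (inr l) =
        (negPow Φ l).map (D.liftNeg (2 * l + 1))) ∧
      (∀ l : ℕ, compZero I.φzero (inl l) (inl l) = (negPow Φ l).map (D.liftZero (2 * l))) ∧
      -- subdiagonal components
      (∀ l : ℕ, compNeg I.φneg (inr l) (inl l) =
        (negPow Φ (l + 1)).map (D.hNeg (2 * l)) ≫
          negPowCancel Φ l (D.Rm.cocomplex.X (2 * l))) ∧
      (∀ l : ℕ, compNeg I.φneg (inl (l + 1)) (inr l) =
        -(negPow Φ (l + 1)).map (D.hZero (2 * l + 1))) ∧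
      (∀ l : ℕ, compZero I.φzero (inr l) (inl l) = -(negPow Φ l).map (D.hZero (2 * l))) ∧
      (∀ l : ℕ, compZero I.φzero (inl (l + 1)) (inr l) =
        (negPow Φ (l + 1)).map (D.hNeg (2 * l + 1)) ≫
          negPowCancel Φ l (D.Rm.cocomplex.X (2 * l + 1))) ∧
      -- the map from `E`
      d₀.neg = aug D.Rm ≫ Sigma.ι (summandNeg Φ D.Rm.cocomplex D.Rz.cocomplex) (inl 0) ∧
      d₀.zero = aug D.Rz ≫ Sigma.ι (summandZero Φ D.Rm.cocomplex D.Rz.cocomplex) (inl 0) ∧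
      (IsFiniteResolution D.Rm → IsFiniteResolution D.Rz → IsQuasiIso d₀) := by
  obtain ⟨c, hc, hs⟩ := D.exists_components
  refine ⟨D.folding hc hs, ResolutionData.toFolding hc hs,
    (ResolutionData.coaugmentation hc hs).isCoQuasiIso, fun l => ?_, fun l => ?_, fun l => ?_,
    fun l => ?_, fun l => ?_, fun l => ?_, fun l => ?_, fun l => ?_, rfl, rfl,
    ResolutionData.isQuasiIso_toFolding hc hs⟩
  · exact (ResolutionData.compNeg_diag hc (inr l)).trans
      (ResolutionData.negPowComm_negPowSucc _ _)
  · exact (ResolutionData.compNeg_diag hc (inl l)).trans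
      (ResolutionData.negPowComm_negPowSucc _ _)
  · exact ResolutionData.compZero_diag hc (inr l)
  · exact ResolutionData.compZero_diag hc (inl l)
  -- The matrix contains the transpose of `h⁻¹`. By functoriality of `Φ⁻ˡ` its image is `Φ⁻ˡ⁻¹(h⁻¹)`
  -- followed by the cancellation of `Φ⁻¹Φ`.
  · exact ((ResolutionData.compNeg_down hc (inl l)).trans
      (ResolutionData.negPowComm_negPowSucc _ _)).trans (Functor.map_comp _ _ _)
  · exact ((ResolutionData.compNeg_down hc (inr l)).trans
      (ResolutionData.negPowComm_negPowSucc _ _)).trans (Functor.map_neg _)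
  · exact (ResolutionData.compZero_down hc (inl l)).trans
      (show (negPow Φ l).map (-D.hZero (2 * l)) = _ from Functor.map_neg _)
  · exact (ResolutionData.compZero_down hc (inr l)).trans (Functor.map_comp _ _ _)
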